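/- Let $\Lambda>0$ and $\alpha>0$, and let $\varepsilon_1(k),\varepsilon_2(k)\in\mathbb R^3$ ($k\in\mathbb R^3\setminus\{0\}$) be measurable polarization vectors that are orthonormal, perpendicular to $k$, and such that each $\varepsilon_\lambda$ is either even or odd in $k$. On the Hilbert space $\mathcal H=L^2(\mathbb R^3;\mathbb C^2)\otimes\mathcal F_b(L^2(\mathbb R^3;\mathbb C^2))$ of one spin-$\tfrac12$ electron and the photon field, where $\mathcal F_b$ is the bosonic Fock space and $a_\lambda(k),a_\lambda^*(k)$ are the usual annihilation and creation operators, put $p=-i\nabla_x$, let $\sigma=(\sigma_1,\sigma_2,\sigma_3)$ be the vector of Pauli matrices, and let $$A(x)=\sum_{\lambda=1,2}\frac1{2\pi}\int_{|k|\le\Lambda}\frac{\varepsilon_\lambda(k)}{|k|^{1/2}}\left[a_\lambda(k)e^{ik\cdot x}+a_\lambda^*(k)e^{-ik\cdot x}\right]dk,$$ $$B(x)=\operatorname{curl}A(x)=\sum_{\lambda=1,2}\frac1{2\pi}\int_{|k|\le\Lambda}\frac{k\wedge i\varepsilon_\lambda(k)}{|k|^{1/2}}\left[a_\lambda(k)e^{ik\cdot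 x}-a_\lambda^*(k)e^{-ik\cdot x}\right]dk,$$ $$H_f=\sum_{\lambda=1,2}\int_{\mathbb R^3}|k|\,a_\lambda^*(k)a_\lambda(k)\,dk .$$ Let $\Sigma_\alpha$ be the infimum of the spectrum of the self-adjoint Pauli–Fierz operator $$T=(p+\sqrt\alpha\,A(x))^2+\sqrt\alpha\,\sigma\cdot B(x)+H_f ,$$ that is, of the operator associated with its quadratic form on the form domain of $p^2+H_f$. Then there are constants $C_1,C_2>0$, independent of $\alpha$, of $\Lambda$ and of the choice of the polarization vectors, such that for all $\alpha>0$ and $\Lambda>0$ $$\left|\Sigma_\alpha-\frac{2\alpha}{\pi}\left[\Lambda-\ln(1+\Lambda)\right]\right|\le C_1\alpha^2(\Lambda^2+\Lambda^3)+C_2\alpha^3(\Lambda^3+\Lambda^4)\ln(1+\Lambda).$$ -/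

import Mathlib

open MeasureTheory
open scoped ENNReal ContDiff

noncomputable section

namespace PauliFierz

/-! ### The Hilbert space `L²(ℝ³; ℂ²) ⊗ F_b(L²(ℝ³; ℂ²))` -/

/-- Physical space, and also the space of wave vectors. -/
abbrev R3 : Type := EuclideanSpace ℝ (Fin 3)

/-- A photon is described by its wave vector `k` and its polarization index `λ`. -/
abbrev Photon : Type := R3 × Fin 2

/-- Lebesgue measure in the wave vector times counting measure in the polarization index. -/
def photonMeasure : Measure Photon := (volume : Measure R3).prod Measure.count

/-- The variables other than the electron position: electron spin and `n` photons. -/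
abbrev Inner (n : ℕ) : Type := Fin 2 × (Fin n → Photon)

def innerMeasure (n : ℕ) : Measure (Inner n) :=
  (Measure.count : Measure (Fin 2)).prod (Measure.pi fun _ : Fin n => photonMeasure)

/-- The arguments `(x, s, (k₁, λ₁), …, (kₙ, λₙ))` of an `n`-photon wave function:
electron position, electron spin, and photons. -/
abbrev Sector (n : ℕ) : Type := R3 × Inner n

def sectorMeasure (n : ℕ) : Measure (Sector n) := (volume : Measure R3).prod (innerMeasure n)

/-- Square summable sequences `{ψ₀, ψ₁, ψ₂, …}` of square integrable `n`-photon wave functions,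
without permutation symmetry. -/
abbrev FullSpace : Type := lp (fun n : ℕ => Lp ℂ 2 (sectorMeasure n)) 2

/-- The wave functions are symmetric under permutations of the photons. -/
def IsBosonic (Ψ : FullSpace) : Prop :=
  ∀ (n : ℕ) (τ : Equiv.Perm (Fin n)),
    ∀ᵐ z ∂(sectorMeasure n), Ψ n (z.1, z.2.1, z.2.2 ∘ τ) = Ψ n z

theorem measurePreserving_perm (n : ℕ) (τ : Equiv.Perm (Fin n)) :
    MeasurePreserving (fun z : Sector n => ((z.1, z.2.1, z.2.2 ∘ τ) : Sector n))
      (sectorMeasure n) (sectorMeasure n) := by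
  have : SigmaFinite photonMeasure := by unfold photonMeasure; infer_instance
  have : SigmaFinite (innerMeasure n) := by unfold innerMeasure; infer_instance
  have h1 : MeasurePreserving (fun k : Fin n → Photon => k ∘ τ)
      (Measure.pi fun _ : Fin n => photonMeasure) (Measure.pi fun _ : Fin n => photonMeasure) := by
    have := measurePreserving_piCongrLeft (fun _ : Fin n => photonMeasure) τ.symm
    convert this using 1
    funext k i
    simp [MeasurableEquiv.piCongrLeft, Equiv.piCongrLeft, Equiv.piCongrLeft']
  exact (MeasurePreserving.id volume).prod ((MeasurePreserving.id Measure.count).prod h1)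

/-- The state space `L²(ℝ³; ℂ²) ⊗ F_b(L²(ℝ³; ℂ²))`. -/
def State : Submodule ℂ FullSpace where
  carrier := {Ψ | IsBosonic Ψ}
  zero_mem' := by
    intro n τ
    have h0 : ∀ᵐ z ∂(sectorMeasure n), ((0 : FullSpace) n) z = 0 := Lp.coeFn_zero ℂ 2 _
    filter_upwards [h0, (measurePreserving_perm n τ).quasiMeasurePreserving.ae h0] with z h1 h2
    rw [h1, h2]
  add_mem' := by
    intro Ψ Φ hΨ hΦ n τ
    have h0 : ∀ᵐ z ∂(sectorMeasure n), ((Ψ + Φ : FullSpace) n) z = Ψ n z + Φ n z :=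
      Lp.coeFn_add _ _
    filter_upwards [h0, (measurePreserving_perm n τ).quasiMeasurePreserving.ae h0, hΨ n τ, hΦ n τ]
      with z h1 h2 h3 h4
    rw [h1, h2, h3, h4]
  smul_mem' := by
    intro c Ψ hΨ n τ
    have h0 : ∀ᵐ z ∂(sectorMeasure n), ((c • Ψ : FullSpace) n) z = c * Ψ n z :=
      Lp.coeFn_smul c _
    filter_upwards [h0, (measurePreserving_perm n τ).quasiMeasurePreserving.ae h0, hΨ n τ]
      with z h1 h2 h3
    rw [h1, h2, h3]

/-- The `n`-photon component of a state, as a function of `(x, s, (k₁, λ₁), …, (kₙ, λₙ))`. -/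
def comp (Ψ : State) (n : ℕ) : Sector n → ℂ := fun z => (Ψ : FullSpace) n z

/-! ### The operators

Unbounded operators are given by their graphs: a relation `T Ψ Φ` says that `Ψ` lies in the domain
of `T` and that `Φ = T Ψ`. -/

/-- `Φ = p_j Ψ` with `p = -i ∇_x`, in the sense of weak derivatives in the electron position. -/
def Momentum (j : Fin 3) (Ψ Φ : State) : Prop :=
  ∀ (n : ℕ) (φ : R3 → ℂ), ContDiff ℝ ∞ φ → HasCompactSupport φ →
    ∀ᵐ y ∂(innerMeasure n),
      ∫ x, φ x * comp Φ n (x, y)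
        = Complex.I * ∫ x, fderiv ℝ φ x (EuclideanSpace.single j 1) * comp Ψ n (x, y)

/-- The field energy of `n` photons, `|k₁| + … + |kₙ|`. -/
def energy {n : ℕ} (k : Fin n → Photon) : ℝ := ∑ i, ‖(k i).1‖

/-- `Φ = H_f^{1/2} Ψ`, where `H_f = ∑_λ ∫ |k| a_λ^*(k) a_λ(k) dk`. -/
def SqrtFieldEnergy (Ψ Φ : State) : Prop :=
  ∀ n : ℕ, comp Φ n =ᵐ[sectorMeasure n] fun z => (Real.sqrt (energy z.2.2) : ℂ) * comp Ψ n z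

/-- The `n`-photon component of `∑_λ ∫ f(x; k, λ) a_λ(k) dk Ψ`. -/
def annihilate (f : R3 → Photon → ℂ) (Ψ : State) (n : ℕ) : Sector n → ℂ :=
  fun z => (Real.sqrt (n + 1) : ℂ) *
    ∫ q, f z.1 q * comp Ψ (n + 1) (z.1, z.2.1, Fin.cons q z.2.2) ∂photonMeasure

/-- The `n`-photon component of `∑_λ ∫ f(x; k, λ) a_λ^*(k) dk Ψ`. -/
def create (f : R3 → Photon → ℂ) (Ψ : State) : (n : ℕ) → Sector n → ℂ
  | 0 => fun _ => 0
  | n + 1 => fun z => (Real.sqrt (n + 1) : ℂ)⁻¹ *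
      ∑ i : Fin (n + 1), f z.1 (z.2.2 i) * comp Ψ n (z.1, z.2.1, i.removeNth z.2.2)

/-- The sharp ultraviolet cutoff `χ(|k|)`: one for `|k| ≤ Λ` and zero otherwise. -/
def cutoff (Λ : ℝ) (k : R3) : ℝ := if ‖k‖ ≤ Λ then 1 else 0

/-- The plane wave `e^{i k·x}`. -/
def wave (k x : R3) : ℂ := Complex.exp (Complex.I * (inner ℝ k x : ℝ))

/-- The `j`-th component of `χ(|k|) / (2π |k|^{1/2}) ε_λ(k)`. -/
def potentialCoeff (Λ : ℝ) (ε : Fin 2 → R3 → R3) (j : Fin 3) (q : Photon) : ℂ :=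
  ((cutoff Λ q.1 / (2 * Real.pi * Real.sqrt ‖q.1‖) * ε q.2 q.1 j : ℝ) : ℂ)

/-- The `j`-th component of `χ(|k|) / (2π |k|^{1/2}) (k ∧ i ε_λ(k))`. -/
def magneticCoeff (Λ : ℝ) (ε : Fin 2 → R3 → R3) (j : Fin 3) (q : Photon) : ℂ :=
  Complex.I * ((cutoff Λ q.1 / (2 * Real.pi * Real.sqrt ‖q.1‖) *
    crossProduct (WithLp.ofLp q.1) (WithLp.ofLp (ε q.2 q.1)) j : ℝ) : ℂ)

/-- The `n`-photon component of `A_j(x) Ψ`. -/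
def potentialFun (Λ : ℝ) (ε : Fin 2 → R3 → R3) (j : Fin 3) (Ψ : State) (n : ℕ) :
    Sector n → ℂ :=
  fun z => annihilate (fun x q => potentialCoeff Λ ε j q * wave q.1 x) Ψ n z
    + create (fun x q => potentialCoeff Λ ε j q * wave q.1 (-x)) Ψ n z

/-- The `n`-photon component of `B_j(x) Ψ`. -/
def magneticFun (Λ : ℝ) (ε : Fin 2 → R3 → R3) (j : Fin 3) (Ψ : State) (n : ℕ) :
    Sector n → ℂ :=
  fun z => annihilate (fun x q => magneticCoeff Λ ε j q * wave q.1 x) Ψ n z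
    + create (fun x q => -(magneticCoeff Λ ε j q * wave q.1 (-x))) Ψ n z

/-- The Pauli matrices. -/
def pauli : Fin 3 → Matrix (Fin 2) (Fin 2) ℂ :=
  ![!![0, 1; 1, 0], !![0, -Complex.I; Complex.I, 0], !![1, 0; 0, -1]]

/-- `Φ = A_j(x) Ψ`. -/
def VectorPotential (Λ : ℝ) (ε : Fin 2 → R3 → R3) (j : Fin 3) (Ψ Φ : State) : Prop :=
  ∀ n : ℕ, comp Φ n =ᵐ[sectorMeasure n] potentialFun Λ ε j Ψ n

/-- `Φ = σ·B(x) Ψ`. -/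
def SpinField (Λ : ℝ) (ε : Fin 2 → R3 → R3) (Ψ Φ : State) : Prop :=
  ∀ n : ℕ, comp Φ n =ᵐ[sectorMeasure n] fun z =>
    ∑ j : Fin 3, ∑ t : Fin 2, pauli j z.2.1 t * magneticFun Λ ε j Ψ n (z.1, t, z.2.2)

/-- The vectors `ε_λ(k)`, `λ = 1, 2`, are orthonormal polarization vectors perpendicular to `k`,
each of them either even or odd in `k`. -/
structure IsPolarization (ε : Fin 2 → R3 → R3) : Prop where
  measurable : ∀ i, Measurable (ε i)
  orthonormal : ∀ k, k ≠ 0 → Orthonormal ℝ fun i => ε i k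
  transverse : ∀ i k, k ≠ 0 → inner ℝ k (ε i k) = 0
  parity : ∀ i, (∀ k, k ≠ 0 → ε i (-k) = ε i k) ∨ (∀ k, k ≠ 0 → ε i (-k) = -ε i k)

/-! ### The Pauli–Fierz operator -/

/-- `Ψ` lies in the form domain, and `P j = p_j Ψ`, `A j = A_j(x) Ψ`, `S = σ·B(x) Ψ`,
`F = H_f^{1/2} Ψ`. The form domain is that of `p² + H_f`, since `A_j(x)` and `B_j(x)` are
relatively bounded by `H_f^{1/2}`. -/
structure InFormDomain (Λ : ℝ) (ε : Fin 2 → R3 → R3) (Ψ : State)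
    (P A : Fin 3 → State) (S F : State) : Prop where
  momentum : ∀ j, Momentum j Ψ (P j)
  potential : ∀ j, VectorPotential Λ ε j Ψ (A j)
  spin : SpinField Λ ε Ψ S
  energy : SqrtFieldEnergy Ψ F

/-- The graph of the self-adjoint operator `T = (p + √α A(x))² + √α σ·B(x) + H_f`, which is the
operator associated with its closed, semibounded quadratic form: `Ψ` lies in the domain of `T` and
`w = T Ψ` if and only if `Ψ` lies in the form domain and
`∑_j ⟨(p_j + √α A_j) Φ, (p_j + √α A_j) Ψ⟩ + √α ⟨Φ, σ·B Ψ⟩ + ⟨H_f^{1/2} Φ, H_f^{1/2} Ψ⟩ = ⟨Φ, w⟩`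
for all `Φ` in the form domain. -/
def pauliFierz (α Λ : ℝ) (ε : Fin 2 → R3 → R3) (Ψ w : State) : Prop :=
  ∃ (P A : Fin 3 → State) (S F : State), InFormDomain Λ ε Ψ P A S F ∧
    ∀ (Φ : State) (P' A' : Fin 3 → State) (S' F' : State), InFormDomain Λ ε Φ P' A' S' F' →
      (∑ j, inner ℂ (P' j + (Real.sqrt α : ℂ) • A' j) (P j + (Real.sqrt α : ℂ) • A j))
        + (Real.sqrt α : ℂ) * inner ℂ Φ S + inner ℂ F' F = inner ℂ Φ w

/-- The resolvent set of an unbounded operator with graph `T`: the set of all `z` such that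
`T - z` is a bijection of its domain onto the whole space with a bounded inverse `R`. -/
def resolventSet {E : Type*} [NormedAddCommGroup E] [NormedSpace ℂ E] (T : E → E → Prop) : Set ℂ :=
  {z | ∃ R : E →L[ℂ] E, ∀ u w, T u w ↔ R (w - z • u) = u}

/-- The set of all real numbers in the spectrum of an unbounded operator with graph `T`. -/
def realSpectrum {E : Type*} [NormedAddCommGroup E] [NormedSpace ℂ E] (T : E → E → Prop) : Set ℝ :=
  {t | (t : ℂ) ∉ resolventSet T}

end PauliFierz

end

/-!
The infimum of the spectrum equals the infimum of the quadratic form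
`q(Ψ) = ∑ⱼ ‖(pⱼ + √α Aⱼ)Ψ‖² + √α ⟨Ψ, σ·B Ψ⟩ + ‖H_f^{1/2} Ψ‖²` over unit vectors, and both bounds on it
come from second order perturbation theory around the vacuum and an electron at rest. Normal
ordering (`FieldParts.formValue_eq`) produces the constant `α Λ² / π` from `A²`. A virtual photon with
wave vector `k` costs the energy `|k| + |k|²`, the second term being the recoil, so that `σ·B` lowers
the energy by `α ∫ |b(k)|² / (|k| + |k|²) dk` with the coupling function `b` of `B`; this integral is
`spinShiftEnergy Λ`. The difference of the two is `(2α/π)(Λ - log(1 + Λ))` (`mainTerm_eq`).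

*Lower bound* (`formValue_ge`). The terms of `q` which couple `n` to `n + 1` photons are
estimated in `sector_inequality`. By permutation symmetry the energy of `n + 1` photons is `n + 1` times
that of the first one, and the square of the electron momentum is distributed over the photons in
proportion to their energies. For a fixed first photon all terms form a quadratic polynomial in the
amplitude of the `(n + 1)`-photon component and its momentum, and `quadratic_nonneg` completes the
squares, the amplitude being shifted by its first order value `-√α b(k) / (|k| + |k|²)`.
The interference of `A` with `B` and of `kⱼ` with `B` drops out because it is an odd function of `k`;
all other remainders contain the factor `∫ χ(|k|) / (4π²|k|²) dk = 2Λ/π` and are absorbed in a fraction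
`32 αΛ` of the kinetic and the field energy, at the cost of `O(α² Λ³)`. This needs `αΛ` to be small.
If it is not small, then `q ≥ 0` suffices, because `q(Ψ) = ‖σ·(p + √α A)Ψ‖² + ‖H_f^{1/2} Ψ‖²`
(`FieldParts.pauli_identity`), while the main term is at most `αΛ = O((αΛ)²)`.

*Upper bound* (`exists_formValue_le`). The trial states consist of an electron wave function spread over
a large region and its first order correction with one photon. Only the norm of the correction causes
an error, which is at most `α² Λ³`.

*Spectrum* (`isGLB_realSpectrum_pauliFierz`). The vectors `Ψ` together with `pΨ`, `AΨ`, `σ·BΨ` and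
`H_f^{1/2} Ψ` form a closed subspace of a power of the state space, on which the form is represented by a
bounded symmetric operator. Below its infimum the shifted form is coercive, which gives a bounded
resolvent; at the infimum a bounded resolvent would contradict the Cauchy–Schwarz inequality for
the form.

The operators act on the components of a state by bounded maps: `insL` inserts a photon and includes
the recoil factor `e^{-i k·x}`, `annL` and `creL` are the annihilation and creation operators built from
it, and `spinL` is a spin matrix. The momentum is given by weak derivatives in the electron position
for almost all values of the other variables. The exceptional set may depend on the test function;
`ae_weakMomentum` removes this dependence, and the Fourier transform then shows that the
components of the momentum are symmetric and commute.
-/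

noncomputable section

namespace PauliFierz

/-! ### Weak derivatives of square integrable functions -/

open SchwartzMap FourierTransform LineDeriv Filter Topology

/-- `g = p_j f` with `p = -i∇`, in the sense of weak derivatives, for functions on `ℝ³`. -/
def WeakMomentum (j : Fin 3) (f g : R3 → ℂ) : Prop :=
  ∀ φ : R3 → ℂ, ContDiff ℝ ∞ φ → HasCompactSupport φ →
    ∫ x, φ x * g x = Complex.I * ∫ x, fderiv ℝ φ x (EuclideanSpace.single j 1) * f x

/-- Compactly supported test functions may be replaced by Schwartz functions. -/
theorem WeakMomentum.integral_schwartz {j : Fin 3} {f g : R3 → ℂ} (h : WeakMomentum j f g)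
    (hf : MemLp f 2) (hg : MemLp g 2) (φ : 𝓢(R3, ℂ)) :
    ∫ x, φ x * g x = Complex.I * ∫ x, (∂_{EuclideanSpace.single j (1 : ℝ)} φ) x * f x := by
  obtain ⟨χ⟩ : Nonempty (ContDiffBump (0 : R3)) := inferInstance
  set e : R3 := EuclideanSpace.single j 1 with he
  have hχs : ContDiff ℝ ∞ (fun x => (χ x : ℂ)) :=
    Complex.ofRealCLM.contDiff.comp χ.contDiff
  have hχd : Continuous (fun x => fderiv ℝ (fun x => (χ x : ℂ)) x) :=
    hχs.continuous_fderiv (by simp)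
  have hχc : HasCompactSupport (fun x => (χ x : ℂ)) :=
    χ.hasCompactSupport.comp_left (g := fun t : ℝ => (t : ℂ)) (by simp)
  obtain ⟨C, hC⟩ := (hχc.fderiv (𝕜 := ℝ)).exists_bound_of_continuous hχd
  set r : ℕ → ℝ := fun n => 1 / ((n : ℝ) + 1) with hr
  have hr0 : Tendsto r atTop (𝓝 0) := tendsto_one_div_add_atTop_nhds_zero_nat
  have hrpos : ∀ n, 0 < r n := fun n => by simp only [hr]; positivity
  have hr1 : ∀ n, r n ≤ 1 := fun n => by
    simp only [hr]; rw [div_le_one (by positivity)]; linarith [(Nat.cast_nonneg n : (0 : ℝ) ≤ n)]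
  set Φ : ℕ → R3 → ℂ := fun n x => (χ (r n • x) : ℂ) * φ x with hΦ
  have hsc : ∀ n, ContDiff ℝ ∞ (fun x : R3 => (χ (r n • x) : ℂ)) := fun n =>
    hχs.comp (contDiff_const_smul (r n))
  have hΦs : ∀ n, ContDiff ℝ ∞ (Φ n) := fun n => (hsc n).mul (φ.smooth _)
  have hΦc : ∀ n, HasCompactSupport (Φ n) := fun n => by
    have : HasCompactSupport (fun x : R3 => (χ (r n • x) : ℂ)) :=
      hχc.comp_homeomorph (Homeomorph.smulOfNeZero (r n) (hrpos n).ne')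
    exact this.mul_right
  have hder : ∀ n x, fderiv ℝ (Φ n) x e = (χ (r n • x) : ℂ) * (∂_{e} φ) x
      + r n * fderiv ℝ (fun x => (χ x : ℂ)) (r n • x) e * φ x := by
    intro n x
    have h1 : HasFDerivAt (fun x : R3 => (χ (r n • x) : ℂ))
        ((fderiv ℝ (fun x => (χ x : ℂ)) (r n • x)).comp (r n • ContinuousLinearMap.id ℝ R3)) x := by
      have := ((hχs.differentiable (by simp)) (r n • x)).hasFDerivAt
      exact this.comp x ((hasFDerivAt_id x).const_smul (r n))
    have h2 : HasFDerivAt φ (fderiv ℝ φ x) x := φ.differentiableAt.hasFDerivAt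
    have h3 := (h1.mul h2).fderiv
    have h4 : fderiv ℝ (Φ n) x = _ := h3
    rw [h4]
    simp [lineDerivOp_apply_eq_fderiv]
    ring
  have hχb : ∀ x, ‖(χ x : ℂ)‖ ≤ 1 := fun x => by
    rw [Complex.norm_real, Real.norm_eq_abs, abs_of_nonneg χ.nonneg]; exact χ.le_one
  have hχlim : ∀ x, Tendsto (fun n => (χ (r n • x) : ℂ)) atTop (𝓝 1) := by
    intro x
    have h1 : Tendsto (fun n => r n • x) atTop (𝓝 0) := by simpa using hr0.smul_const x
    have h2 := (hχs.continuous.tendsto 0).comp h1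
    simpa [χ.one_of_mem_closedBall (Metric.mem_closedBall_self χ.rIn_pos.le),
      Function.comp_def] using h2
  have hφ : MemLp φ 2 := φ.memLp 2
  have hdφ : MemLp (∂_{e} φ : 𝓢(R3, ℂ)) 2 := (∂_{e} φ : 𝓢(R3, ℂ)).memLp 2
  have i1 : Integrable (fun x => φ x * g x) := hφ.integrable_mul hg
  have i2 : Integrable (fun x => (∂_{e} φ : 𝓢(R3, ℂ)) x * f x) := hdφ.integrable_mul hf
  have i3 : Integrable (fun x => φ x * f x) := hφ.integrable_mul hf
  have l1 : Tendsto (fun n => ∫ x, Φ n x * g x) atTop (𝓝 (∫ x, φ x * g x)) := by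
    refine tendsto_integral_of_dominated_convergence (fun x => ‖φ x * g x‖) (fun n => ?_) i1.norm
      (fun n => ?_) ?_
    · exact ((hΦs n).continuous.aestronglyMeasurable).mul hg.1
    · refine ae_of_all _ fun x => ?_
      rw [hΦ]
      calc ‖(χ (r n • x) : ℂ) * φ x * g x‖ = ‖(χ (r n • x) : ℂ)‖ * ‖φ x * g x‖ := by
            rw [mul_assoc, norm_mul]
        _ ≤ 1 * ‖φ x * g x‖ := by gcongr; exact hχb _
        _ = _ := one_mul _
    · refine ae_of_all _ fun x => ?_
      have := ((hχlim x).mul_const (φ x)).mul_const (g x)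
      simpa using this
  have l2 : Tendsto (fun n => ∫ x, fderiv ℝ (Φ n) x e * f x) atTop
      (𝓝 (∫ x, (∂_{e} φ : 𝓢(R3, ℂ)) x * f x)) := by
    refine tendsto_integral_of_dominated_convergence
      (fun x => ‖(∂_{e} φ : 𝓢(R3, ℂ)) x * f x‖ + C * ‖e‖ * ‖φ x * f x‖) (fun n => ?_)
      (i2.norm.add (i3.norm.const_mul _)) (fun n => ?_) ?_
    · refine AEStronglyMeasurable.mul ?_ hf.1
      exact (((hΦs n).continuous_fderiv (by simp)).clm_apply
        continuous_const).aestronglyMeasurable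
    · refine ae_of_all _ fun x => ?_
      rw [hder, add_mul]
      refine (norm_add_le _ _).trans (add_le_add ?_ ?_)
      · rw [mul_assoc, norm_mul]
        calc _ ≤ 1 * ‖(∂_{e} φ : 𝓢(R3, ℂ)) x * f x‖ := by gcongr; exact hχb _
          _ = _ := one_mul _
      · rw [mul_assoc, norm_mul, norm_mul, Complex.norm_real, Real.norm_eq_abs,
          abs_of_pos (hrpos n)]
        have h5 : ‖fderiv ℝ (fun x => (χ x : ℂ)) (r n • x) e‖ ≤ C * ‖e‖ :=
          (ContinuousLinearMap.le_opNorm _ _).trans (by gcongr; exact hC _)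
        calc r n * ‖fderiv ℝ (fun x => (χ x : ℂ)) (r n • x) e‖ * ‖φ x * f x‖
            ≤ 1 * (C * ‖e‖) * ‖φ x * f x‖ := by gcongr; exact hr1 n
          _ = _ := by ring
    · refine ae_of_all _ fun x => ?_
      have h1 : Tendsto (fun n => fderiv ℝ (Φ n) x e) atTop (𝓝 ((∂_{e} φ : 𝓢(R3, ℂ)) x)) := by
        simp_rw [hder]
        have h2 := (hχlim x).mul_const ((∂_{e} φ : 𝓢(R3, ℂ)) x)
        have h3 : Tendsto (fun n => (r n : ℂ) * fderiv ℝ (fun x => (χ x : ℂ)) (r n • x) e * φ x)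
            atTop (𝓝 0) := by
          have h4 : Tendsto (fun n => r n • x) atTop (𝓝 0) := by simpa using hr0.smul_const x
          have h5 := ((hχd.clm_apply (continuous_const (y := e))).tendsto 0).comp h4
          have h6 := ((Complex.continuous_ofReal.tendsto 0).comp hr0)
          have := (h6.mul h5).mul_const (φ x)
          simpa using this
        simpa using h2.add h3
      exact h1.mul_const _
  have heq : ∀ n, ∫ x, Φ n x * g x = Complex.I * ∫ x, fderiv ℝ (Φ n) x e * f x :=
    fun n => h _ (hΦs n) (hΦc n)
  exact tendsto_nhds_unique l1 (by simpa [heq] using l2.const_mul Complex.I)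

/-- On the Fourier side `p_j` is multiplication by `2π ξ_j`. -/
theorem WeakMomentum.fourier_ae {j : Fin 3} {f g : Lp (α := R3) ℂ 2 volume}
    (h : WeakMomentum j f g) :
    ∀ᵐ ξ : R3, (𝓕 g : Lp (α := R3) ℂ 2 volume) ξ
      = ((2 * Real.pi * ξ j : ℝ) : ℂ) * (𝓕 f : Lp (α := R3) ℂ 2 volume) ξ := by
  have key : ∀ (F : Lp (α := R3) ℂ 2 volume) (ψ : 𝓢(R3, ℂ)),
      ∫ x, (𝓕 ψ : 𝓢(R3, ℂ)) x * F x = ∫ x, ψ x * (𝓕 F : Lp (α := R3) ℂ 2 volume) x := by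
    intro F ψ
    have := congrArg (fun T => T ψ) (Lp.fourier_toTemperedDistribution_eq F)
    simpa [TemperedDistribution.fourier_apply] using this
  have lf : LocallyIntegrable (fun ξ => (𝓕 f : Lp (α := R3) ℂ 2 volume) ξ) :=
    (Lp.memLp _).locallyIntegrable (by norm_num)
  have lg : LocallyIntegrable (fun ξ => (𝓕 g : Lp (α := R3) ℂ 2 volume) ξ) :=
    (Lp.memLp _).locallyIntegrable (by norm_num)
  have cont : Continuous (fun ξ : R3 => ((2 * Real.pi * ξ j : ℝ) : ℂ)) := by fun_prop
  have lm : LocallyIntegrable (fun ξ : R3 =>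
      ((2 * Real.pi * ξ j : ℝ) : ℂ) * (𝓕 f : Lp (α := R3) ℂ 2 volume) ξ) := by
    rw [MeasureTheory.locallyIntegrable_iff]
    intro k hk
    exact (lf.integrableOn_isCompact hk).continuousOn_mul cont.continuousOn hk
  refine ae_eq_of_integral_contDiff_smul_eq lg lm fun ψ₀ hψ hψc => ?_
  have hs : ContDiff ℝ ∞ (fun x => (ψ₀ x : ℂ)) := Complex.ofRealCLM.contDiff.comp hψ
  have hc : HasCompactSupport (fun x => (ψ₀ x : ℂ)) :=
    hψc.comp_left (g := fun t : ℝ => (t : ℂ)) (by simp)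
  set ψ : 𝓢(R3, ℂ) := hc.toSchwartzMap hs with hψd
  have h1 := h.integral_schwartz (Lp.memLp f) (Lp.memLp g) (𝓕 ψ)
  rw [lineDerivOp_fourier_eq, key, key] at h1
  have hT : (fun x : R3 => inner ℝ x (EuclideanSpace.single j (1 : ℝ))).HasTemperateGrowth :=
    ((innerSL ℝ).flip (EuclideanSpace.single j (1 : ℝ))).hasTemperateGrowth
  calc ∫ x, ψ₀ x • (𝓕 g : Lp (α := R3) ℂ 2 volume) x
      = ∫ x, ψ x * (𝓕 g : Lp (α := R3) ℂ 2 volume) x := by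
        simp [hψd, Complex.real_smul]
    _ = _ := by
        rw [h1, ← integral_const_mul]
        refine integral_congr_ae (ae_of_all _ fun x => ?_)
        have h2 : inner ℝ x (EuclideanSpace.single j (1 : ℝ)) = x j := by
          simp [EuclideanSpace.inner_single_right]
        have h3 : (ψ x : ℂ) = (ψ₀ x : ℂ) := rfl
        simp only [smul_apply, smulLeftCLM_apply_apply hT, h2, h3, Complex.real_smul,
          smul_eq_mul]
        push_cast
        linear_combination (-2 * Real.pi * x j * ψ₀ x
          * (𝓕 f : Lp (α := R3) ℂ 2 volume) x) * Complex.I_sq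

theorem WeakMomentum.congr_ae {j : Fin 3} {f g f' g' : R3 → ℂ} (h : WeakMomentum j f g)
    (hf : f =ᵐ[volume] f') (hg : g =ᵐ[volume] g') : WeakMomentum j f' g' := by
  intro φ h1 h2
  have e1 : ∫ x, φ x * g' x = ∫ x, φ x * g x :=
    integral_congr_ae (hg.mono fun x hx => by simp [hx])
  have e2 : ∫ x, fderiv ℝ φ x (EuclideanSpace.single j 1) * f' x
      = ∫ x, fderiv ℝ φ x (EuclideanSpace.single j 1) * f x :=
    integral_congr_ae (hf.mono fun x hx => by simp [hx])
  rw [e1, e2, h φ h1 h2]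

theorem inner_toLp_eq_integral {α : Type*} [MeasurableSpace α] {μ : Measure α} {f g : α → ℂ}
    (hf : MemLp f 2 μ) (hg : MemLp g 2 μ) :
    inner ℂ (hf.toLp f) (hg.toLp g) = ∫ x, (starRingEnd ℂ) (f x) * g x ∂μ := by
  rw [L2.inner_def]
  refine integral_congr_ae ?_
  filter_upwards [hf.coeFn_toLp, hg.coeFn_toLp] with x h1 h2
  rw [h1, h2, RCLike.inner_apply, mul_comm]

theorem WeakMomentum.exists_fourier {j : Fin 3} {f g : R3 → ℂ} (h : WeakMomentum j f g)
    (hf : MemLp f 2) (hg : MemLp g 2) :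
    ∀ᵐ ξ : R3, (𝓕 (hg.toLp g) : Lp (α := R3) ℂ 2 volume) ξ
      = ((2 * Real.pi * ξ j : ℝ) : ℂ) * (𝓕 (hf.toLp f) : Lp (α := R3) ℂ 2 volume) ξ :=
  (h.congr_ae hf.coeFn_toLp.symm hg.coeFn_toLp.symm).fourier_ae

/-- The momentum operator is symmetric. -/
theorem WeakMomentum.integral_symm {j : Fin 3} {f g f' g' : R3 → ℂ} (h : WeakMomentum j f g)
    (h' : WeakMomentum j f' g') (hf : MemLp f 2) (hg : MemLp g 2) (hf' : MemLp f' 2)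
    (hg' : MemLp g' 2) :
    ∫ x, (starRingEnd ℂ) (f' x) * g x = ∫ x, (starRingEnd ℂ) (g' x) * f x := by
  rw [← inner_toLp_eq_integral hf' hg, ← inner_toLp_eq_integral hg' hf,
    ← Lp.inner_fourier_eq (hf'.toLp f'), ← Lp.inner_fourier_eq (hg'.toLp g'),
    L2.inner_def, L2.inner_def]
  refine integral_congr_ae ?_
  filter_upwards [h.exists_fourier hf hg, h'.exists_fourier hf' hg'] with ξ h1 h2
  rw [h1, h2, RCLike.inner_apply, RCLike.inner_apply, map_mul, Complex.conj_ofReal]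
  ring

/-- Different components of the momentum commute, in the sense of quadratic forms. -/
theorem WeakMomentum.integral_comm {j l : Fin 3} {f gj gl f' gj' gl' : R3 → ℂ}
    (hj : WeakMomentum j f gj) (hl : WeakMomentum l f gl)
    (hj' : WeakMomentum j f' gj') (hl' : WeakMomentum l f' gl') (hf : MemLp f 2)
    (mj : MemLp gj 2) (ml : MemLp gl 2) (hf' : MemLp f' 2) (mj' : MemLp gj' 2)
    (ml' : MemLp gl' 2) :
    ∫ x, (starRingEnd ℂ) (gj' x) * gl x = ∫ x, (starRingEnd ℂ) (gl' x) * gj x := by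
  rw [← inner_toLp_eq_integral mj' ml, ← inner_toLp_eq_integral ml' mj,
    ← Lp.inner_fourier_eq (mj'.toLp gj'), ← Lp.inner_fourier_eq (ml'.toLp gl'),
    L2.inner_def, L2.inner_def]
  refine integral_congr_ae ?_
  filter_upwards [hj.exists_fourier hf mj, hl.exists_fourier hf ml, hj'.exists_fourier hf' mj',
    hl'.exists_fourier hf' ml'] with ξ h1 h2 h3 h4
  rw [h1, h2, h3, h4, RCLike.inner_apply, RCLike.inner_apply, map_mul, map_mul,
    Complex.conj_ofReal, Complex.conj_ofReal]
  ring

theorem memLp_test {φ : R3 → ℂ} (h1 : ContDiff ℝ ∞ φ) (h2 : HasCompactSupport φ) :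
    MemLp φ 2 :=
  h1.continuous.memLp_of_hasCompactSupport h2

theorem memLp_fderiv_test {φ : R3 → ℂ} (h1 : ContDiff ℝ ∞ φ) (h2 : HasCompactSupport φ) (v : R3) :
    MemLp (fun x => fderiv ℝ φ x v) 2 :=
  ((h1.continuous_fderiv (by simp)).clm_apply continuous_const).memLp_of_hasCompactSupport
    (h2.fderiv_apply (𝕜 := ℝ) v)

theorem MemLp.section_ae {Y : Type*} [MeasurableSpace Y] {μ : Measure Y} [SigmaFinite μ]
    {f : R3 × Y → ℂ} (hf : MemLp f 2 ((volume : Measure R3).prod μ)) :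
    ∀ᵐ y ∂μ, MemLp (fun x => f (x, y)) 2 := by
  have h1 := ((memLp_two_iff_integrable_sq_norm hf.1).1 hf).prod_left_ae
  have h2 : ∀ᵐ y ∂μ, AEStronglyMeasurable (fun x => f (x, y)) volume := by
    have h3 : AEStronglyMeasurable (f ∘ Prod.swap) (μ.prod (volume : Measure R3)) :=
      hf.1.prod_swap
    exact h3.prodMk_left
  filter_upwards [h1, h2] with y h3 h4
  exact (memLp_two_iff_integrable_sq_norm h4).2 h3

/-- The exceptional null set in the definition of the momentum may be chosen independently of the
test function, because the test functions form a separable set in the Sobolev norm. -/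
theorem ae_weakMomentum {Y : Type*} [MeasurableSpace Y] {μ : Measure Y} [SigmaFinite μ]
    {j : Fin 3} {f g : R3 × Y → ℂ} (hf : MemLp f 2 ((volume : Measure R3).prod μ))
    (hg : MemLp g 2 ((volume : Measure R3).prod μ))
    (h : ∀ φ : R3 → ℂ, ContDiff ℝ ∞ φ → HasCompactSupport φ → ∀ᵐ y ∂μ,
      ∫ x, φ x * g (x, y)
        = Complex.I * ∫ x, fderiv ℝ φ x (EuclideanSpace.single j 1) * f (x, y)) :
    ∀ᵐ y ∂μ, WeakMomentum j (fun x => f (x, y)) (fun x => g (x, y)) := by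
  let T := {φ : R3 → ℂ // ContDiff ℝ ∞ φ ∧ HasCompactSupport φ}
  let ι : T → Lp (α := R3) ℂ 2 volume × Lp (α := R3) ℂ 2 volume := fun φ =>
    ((memLp_test φ.2.1 φ.2.2).toLp _,
      (memLp_fderiv_test φ.2.1 φ.2.2 (EuclideanSpace.single j 1)).toLp _)
  let _ : TopologicalSpace T := TopologicalSpace.induced ι inferInstance
  have : Fact ((2 : ℝ≥0∞) ≠ ⊤) := ⟨by norm_num⟩
  have : SecondCountableTopology (Lp (α := R3) ℂ 2 volume) := Lp.SecondCountableTopology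
  have : SecondCountableTopology T :=
    TopologicalSpace.secondCountableTopology_induced _ _ ι
  have hι : Continuous ι := continuous_induced_dom
  have : Nonempty T := ⟨⟨0, contDiff_const, HasCompactSupport.zero⟩⟩
  have h' : ∀ᵐ y ∂μ, ∀ n : ℕ, ∫ x, (TopologicalSpace.denseSeq T n).1 x * g (x, y)
      = Complex.I * ∫ x, fderiv ℝ (TopologicalSpace.denseSeq T n).1 x
        (EuclideanSpace.single j 1) * f (x, y) :=
    ae_all_iff.2 fun n => h _ (TopologicalSpace.denseSeq T n).2.1
      (TopologicalSpace.denseSeq T n).2.2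
  filter_upwards [h', MemLp.section_ae hf, MemLp.section_ae hg] with y hy hfy hgy
  have conj_mem : ∀ {u : R3 → ℂ}, MemLp u 2 → MemLp (fun x => (starRingEnd ℂ) (u x)) 2 :=
    fun hu => hu.star
  have e : ∀ (u : R3 → ℂ) (φ : R3 → ℂ) (hu : MemLp u 2) (hφ : MemLp φ 2),
      ∫ x, φ x * u x = inner ℂ ((conj_mem hu).toLp _) (hφ.toLp φ) := by
    intro u φ hu hφ
    rw [inner_toLp_eq_integral]
    simp [mul_comm]
  have c1 : Continuous fun φ : T => ∫ x, φ.1 x * g (x, y) := by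
    have : (fun φ : T => ∫ x, φ.1 x * g (x, y))
        = fun φ => inner ℂ ((conj_mem hgy).toLp _) (ι φ).1 := by
      funext φ; exact e _ _ hgy (memLp_test φ.2.1 φ.2.2)
    rw [this]; exact continuous_const.inner (continuous_fst.comp hι)
  have c2 : Continuous fun φ : T =>
      Complex.I * ∫ x, fderiv ℝ φ.1 x (EuclideanSpace.single j 1) * f (x, y) := by
    have : (fun φ : T => ∫ x, fderiv ℝ φ.1 x (EuclideanSpace.single j 1) * f (x, y))
        = fun φ => inner ℂ ((conj_mem hfy).toLp _) (ι φ).2 := by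
      funext φ; exact e _ _ hfy (memLp_fderiv_test φ.2.1 φ.2.2 _)
    exact continuous_const.mul (by rw [this]; exact continuous_const.inner (continuous_snd.comp hι))
  have := c1.ext_on (TopologicalSpace.denseRange_denseSeq T) c2 (by
    rintro _ ⟨n, rfl⟩; exact hy n)
  intro φ h1 h2
  exact congrFun this ⟨φ, h1, h2⟩

theorem WeakMomentum.add {j : Fin 3} {f g f' g' : R3 → ℂ} (h : WeakMomentum j f g)
    (h' : WeakMomentum j f' g') (hf : MemLp f 2) (hg : MemLp g 2) (hf' : MemLp f' 2)
    (hg' : MemLp g' 2) : WeakMomentum j (fun x => f x + f' x) (fun x => g x + g' x) := by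
  intro φ h1 h2
  have i := memLp_test h1 h2
  have i' := memLp_fderiv_test h1 h2 (EuclideanSpace.single j 1)
  have e1 : ∫ x, φ x * (g x + g' x) = (∫ x, φ x * g x) + ∫ x, φ x * g' x := by
    simp only [mul_add]
    exact integral_add (i.integrable_mul hg) (i.integrable_mul hg')
  have e2 : ∫ x, fderiv ℝ φ x (EuclideanSpace.single j 1) * (f x + f' x)
      = (∫ x, fderiv ℝ φ x (EuclideanSpace.single j 1) * f x)
        + ∫ x, fderiv ℝ φ x (EuclideanSpace.single j 1) * f' x := by
    simp only [mul_add]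
    exact integral_add (i'.integrable_mul hf) (i'.integrable_mul hf')
  rw [e1, e2, h φ h1 h2, h' φ h1 h2]
  ring

theorem WeakMomentum.const_mul {j : Fin 3} {f g : R3 → ℂ} (h : WeakMomentum j f g) (c : ℂ) :
    WeakMomentum j (fun x => c * f x) (fun x => c * g x) := by
  intro φ h1 h2
  simp only [mul_left_comm _ c]
  rw [integral_const_mul, integral_const_mul, h φ h1 h2]
  ring

theorem norm_wave (k x : R3) : ‖wave k x‖ = 1 := by
  rw [wave, mul_comm, Complex.norm_exp_ofReal_mul_I]

theorem contDiff_wave (k : R3) : ContDiff ℝ ∞ (fun x : R3 => wave k (-x)) := by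
  unfold wave
  have : ContDiff ℝ ∞ (fun x : R3 => ((inner ℝ k (-x) : ℝ) : ℂ)) :=
    Complex.ofRealCLM.contDiff.comp (contDiff_const.inner ℝ contDiff_neg)
  exact (contDiff_const.mul this).cexp

theorem continuous_wave : Continuous (fun p : R3 × R3 => wave p.1 p.2) := by
  unfold wave; fun_prop

theorem wave_mul_wave_neg (k x : R3) : wave k x * wave k (-x) = 1 := by
  rw [wave, wave, ← Complex.exp_add, inner_neg_right]
  simp

theorem conj_wave (k x : R3) : (starRingEnd ℂ) (wave k x) = wave k (-x) := by
  rw [wave, wave, ← Complex.exp_conj, inner_neg_right]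
  simp

theorem hasFDerivAt_wave_neg (k x : R3) (j : Fin 3) :
    fderiv ℝ (fun x : R3 => wave k (-x)) x (EuclideanSpace.single j 1)
      = -(Complex.I * k j) * wave k (-x) := by
  have h1 : HasFDerivAt (fun x : R3 => ((inner ℝ k (-x) : ℝ) : ℂ))
      (Complex.ofRealCLM.comp ((innerSL ℝ k).comp (-ContinuousLinearMap.id ℝ R3))) x :=
    (Complex.ofRealCLM.comp ((innerSL ℝ k).comp (-ContinuousLinearMap.id ℝ R3))).hasFDerivAt
  have h2 := ((h1.const_mul Complex.I).cexp).fderiv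
  have h3 : fderiv ℝ (fun x : R3 => wave k (-x)) x = _ := h2
  rw [h3]
  simp [wave, EuclideanSpace.inner_single_right]
  ring

/-- Multiplication by a plane wave shifts the momentum. -/
theorem WeakMomentum.wave_mul {j : Fin 3} {f g : R3 → ℂ} (h : WeakMomentum j f g)
    (hf : MemLp f 2) (hg : MemLp g 2) (k : R3) :
    WeakMomentum j (fun x => wave k (-x) * f x)
      (fun x => wave k (-x) * g x - k j * (wave k (-x) * f x)) := by
  intro φ h1 h2
  have hs : ContDiff ℝ ∞ (fun x => φ x * wave k (-x)) := h1.mul (contDiff_wave k)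
  have hc : HasCompactSupport (fun x => φ x * wave k (-x)) := h2.mul_right
  have key := h _ hs hc
  have hd : ∀ x, fderiv ℝ (fun x => φ x * wave k (-x)) x (EuclideanSpace.single j 1)
      = fderiv ℝ φ x (EuclideanSpace.single j 1) * wave k (-x)
        - Complex.I * k j * (φ x * wave k (-x)) := by
    intro x
    rw [fderiv_fun_mul (h1.differentiable (by simp) x)
      ((contDiff_wave k).differentiable (by simp) x)]
    simp [hasFDerivAt_wave_neg]
    ring
  have m1 : MemLp (fun x => φ x * wave k (-x)) 2 := memLp_test hs hc
  have m2 : MemLp (fun x => fderiv ℝ φ x (EuclideanSpace.single j 1) * wave k (-x)) 2 := by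
    have e := (memLp_fderiv_test hs hc (EuclideanSpace.single j 1)).add
      (m1.const_mul (Complex.I * k j))
    refine e.congr_norm ?_ (ae_of_all _ fun x => ?_)
    · exact ((memLp_fderiv_test h1 h2 _).1).mul (contDiff_wave k).continuous.aestronglyMeasurable
    · simp [hd]
  have i1 : Integrable (fun x => φ x * wave k (-x) * f x) := m1.integrable_mul hf
  have i2 : Integrable (fun x => fderiv ℝ φ x (EuclideanSpace.single j 1) * wave k (-x) * f x) :=
    m2.integrable_mul hf
  have ig : Integrable (fun x => φ x * wave k (-x) * g x) := m1.integrable_mul hg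
  · simp only [hd, sub_mul] at key
    rw [integral_sub i2 (by simpa [mul_assoc] using i1.const_mul (Complex.I * k j))] at key
    have e1 : ∫ x, φ x * (wave k (-x) * g x - k j * (wave k (-x) * f x))
        = (∫ x, φ x * wave k (-x) * g x) - k j * ∫ x, φ x * wave k (-x) * f x := by
      rw [← integral_const_mul, ← integral_sub ig (i1.const_mul _)]
      congr 1; funext x; ring
    rw [e1, key]
    have e2 : ∫ x, Complex.I * k j * (φ x * wave k (-x)) * f x
        = Complex.I * k j * ∫ x, φ x * wave k (-x) * f x := by
      rw [← integral_const_mul]; congr 1; funext x; ring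
    rw [e2]
    simp only [mul_assoc]
    linear_combination (-(k j : ℂ) * ∫ x, φ x * (wave k (-x) * f x)) * Complex.I_sq

/-! ### Splitting off one photon -/

/-- The Hilbert space of wave functions of the electron and `n` distinguishable photons. -/
abbrev SectorSpace (n : ℕ) : Type := Lp ℂ 2 (sectorMeasure n)

instance : SigmaFinite photonMeasure := by unfold photonMeasure; infer_instance

instance (n : ℕ) : SigmaFinite (innerMeasure n) := by unfold innerMeasure; infer_instance

instance (n : ℕ) : SigmaFinite (sectorMeasure n) := by unfold sectorMeasure; infer_instance

theorem measurePreserving_leftComm {α β γ : Type*} [MeasurableSpace α] [MeasurableSpace β]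
    [MeasurableSpace γ] (μ : Measure α) (ν : Measure β) (ρ : Measure γ) [SigmaFinite μ]
    [SigmaFinite ν] [SigmaFinite ρ] :
    MeasurePreserving (fun p : α × β × γ => (p.2.1, p.1, p.2.2)) (μ.prod (ν.prod ρ))
      (ν.prod (μ.prod ρ)) := by
  have h1 := (measurePreserving_prodAssoc μ ν ρ).symm
  have h2 := (Measure.measurePreserving_swap (μ := μ) (ν := ν)).prod (MeasurePreserving.id ρ)
  have h3 := measurePreserving_prodAssoc ν μ ρ
  exact h3.comp (h2.comp h1)

/-- The first photon of a configuration. -/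
def hd {n : ℕ} (z : Sector (n + 1)) : Photon := z.2.2 0

/-- The configuration without its first photon. -/
def tl {n : ℕ} (z : Sector (n + 1)) : Sector n := (z.1, z.2.1, fun i => z.2.2 i.succ)

/-- The configuration with one more photon, put in the first place. -/
def consMap {n : ℕ} (p : Photon × Sector n) : Sector (n + 1) :=
  (p.2.1, p.2.2.1, (Fin.cons p.1 p.2.2.2 : Fin (n + 1) → Photon))

@[simp] theorem hd_consMap {n : ℕ} (p : Photon × Sector n) : hd (consMap p) = p.1 := rfl

@[simp] theorem tl_consMap {n : ℕ} (p : Photon × Sector n) : tl (consMap p) = p.2 := rfl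

@[simp] theorem consMap_hd_tl {n : ℕ} (z : Sector (n + 1)) : consMap (hd z, tl z) = z := by
  refine Prod.ext rfl (Prod.ext rfl ?_)
  exact Fin.cons_self_tail z.2.2

theorem measurable_hd {n : ℕ} : Measurable (hd : Sector (n + 1) → Photon) :=
  (measurable_pi_apply 0).comp (measurable_snd.comp measurable_snd)

theorem measurable_tl {n : ℕ} : Measurable (tl : Sector (n + 1) → Sector n) :=
  measurable_fst.prodMk ((measurable_fst.comp measurable_snd).prodMk
    (measurable_pi_lambda _ fun i => (measurable_pi_apply i.succ).comp
      (measurable_snd.comp measurable_snd)))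

theorem measurable_consMap {n : ℕ} : Measurable (consMap : Photon × Sector n → Sector (n + 1)) := by
  have h : Measurable (fun p : Photon × Sector n =>
      (Fin.cons p.1 p.2.2.2 : Fin (n + 1) → Photon)) := by
    refine measurable_pi_lambda _ fun i => ?_
    refine Fin.cases ?_ (fun i => ?_) i
    · exact measurable_fst
    · exact (measurable_pi_apply i).comp (measurable_snd.comp (measurable_snd.comp measurable_snd))
  exact (measurable_fst.comp measurable_snd).prodMk
    ((measurable_fst.comp (measurable_snd.comp measurable_snd)).prodMk h)

/-- An `(n + 1)`-photon configuration is a photon together with an `n`-photon configuration. -/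
def splitEquiv (n : ℕ) : Sector (n + 1) ≃ᵐ Photon × Sector n where
  toFun z := (hd z, tl z)
  invFun := consMap
  left_inv := consMap_hd_tl
  right_inv _ := rfl
  measurable_toFun := measurable_hd.prodMk measurable_tl
  measurable_invFun := measurable_consMap

theorem measurePreserving_split (n : ℕ) :
    MeasurePreserving (splitEquiv n) (sectorMeasure (n + 1))
      (photonMeasure.prod (sectorMeasure n)) := by
  have h1 := measurePreserving_piFinSuccAbove (fun _ : Fin (n + 1) => photonMeasure) 0
  have h2 := (MeasurePreserving.id (volume : Measure R3)).prod
    ((MeasurePreserving.id (Measure.count : Measure (Fin 2))).prod h1)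
  have h3 := measurePreserving_leftComm (Measure.count : Measure (Fin 2)) photonMeasure
    (Measure.pi fun _ : Fin n => photonMeasure)
  have h4 := (MeasurePreserving.id (volume : Measure R3)).prod h3
  have h5 := measurePreserving_leftComm (volume : Measure R3) photonMeasure (innerMeasure n)
  exact h5.comp (h4.comp h2)

theorem integral_split {n : ℕ} (F : Photon × Sector n → ℂ) :
    ∫ z, F (hd z, tl z) ∂(sectorMeasure (n + 1))
      = ∫ p, F p ∂(photonMeasure.prod (sectorMeasure n)) :=
  (measurePreserving_split n).integral_comp' (f := splitEquiv n) F

theorem quasiMeasurePreserving_tl {n : ℕ} :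
    Measure.QuasiMeasurePreserving (tl : Sector (n + 1) → Sector n) (sectorMeasure (n + 1))
      (sectorMeasure n) :=
  Measure.quasiMeasurePreserving_snd.comp (measurePreserving_split n).quasiMeasurePreserving

theorem quasiMeasurePreserving_hd {n : ℕ} :
    Measure.QuasiMeasurePreserving (hd : Sector (n + 1) → Photon) (sectorMeasure (n + 1))
      photonMeasure :=
  Measure.quasiMeasurePreserving_fst.comp (measurePreserving_split n).quasiMeasurePreserving

theorem measurePreserving_consMap (n : ℕ) :
    MeasurePreserving (consMap : Photon × Sector n → Sector (n + 1))
      (photonMeasure.prod (sectorMeasure n)) (sectorMeasure (n + 1)) :=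
  (measurePreserving_split n).symm

/-! ### Inserting a photon -/

/-- `c(k₁) e^{-i k₁·x} h(…)`: a photon with wave function `c` is put in front, recoil included. -/
def ins {n : ℕ} (c : Photon → ℂ) (h : Sector n → ℂ) : Sector (n + 1) → ℂ :=
  fun z => c (hd z) * wave (hd z).1 (-z.1) * h (tl z)

theorem aestronglyMeasurable_wave {α : Type*} [MeasurableSpace α] {μ : Measure α} {f g : α → R3}
    (hf : Measurable f) (hg : Measurable g) :
    AEStronglyMeasurable (fun a => wave (f a) (g a)) μ :=
  (continuous_wave.measurable.comp (hf.prodMk hg)).aestronglyMeasurable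

theorem memLp_prod_mul {α β : Type*} [MeasurableSpace α] [MeasurableSpace β] {μ : Measure α}
    {ν : Measure β} [SFinite μ] [SFinite ν] {f : α → ℂ} {g : β → ℂ} (hf : MemLp f 2 μ)
    (hg : MemLp g 2 ν) : MemLp (fun p : α × β => f p.1 * g p.2) 2 (μ.prod ν) := by
  have hm : AEStronglyMeasurable (fun p : α × β => f p.1 * g p.2) (μ.prod ν) :=
    (hf.1.comp_quasiMeasurePreserving Measure.quasiMeasurePreserving_fst).mul
      (hg.1.comp_quasiMeasurePreserving Measure.quasiMeasurePreserving_snd)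
  rw [memLp_two_iff_integrable_sq_norm hm]
  have := ((memLp_two_iff_integrable_sq_norm hf.1).1 hf).mul_prod
    ((memLp_two_iff_integrable_sq_norm hg.1).1 hg)
  simpa [mul_pow] using this

theorem memLp_hd_mul_tl {n : ℕ} {c : Photon → ℂ} {h : Sector n → ℂ} (hc : MemLp c 2 photonMeasure)
    (hh : MemLp h 2 (sectorMeasure n)) :
    MemLp (fun z => c (hd z) * h (tl z)) 2 (sectorMeasure (n + 1)) :=
  (memLp_prod_mul hc hh).comp_measurePreserving (measurePreserving_split n)

theorem memLp_ins {n : ℕ} {c : Photon → ℂ} {h : Sector n → ℂ} (hc : MemLp c 2 photonMeasure)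
    (hh : MemLp h 2 (sectorMeasure n)) : MemLp (ins c h) 2 (sectorMeasure (n + 1)) := by
  refine (memLp_hd_mul_tl hc hh).congr_norm ?_ (ae_of_all _ fun z => ?_)
  · refine AEStronglyMeasurable.mul (AEStronglyMeasurable.mul ?_ ?_) ?_
    · exact hc.1.comp_quasiMeasurePreserving quasiMeasurePreserving_hd
    · exact aestronglyMeasurable_wave (measurable_fst.comp measurable_hd) measurable_fst.neg
    · exact hh.1.comp_quasiMeasurePreserving quasiMeasurePreserving_tl
  · simp [ins, norm_wave]

theorem conj_ins_mul_ins {n : ℕ} (c c' : Photon → ℂ) (h h' : Sector n → ℂ) (z : Sector (n + 1)) :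
    (starRingEnd ℂ) (ins c h z) * ins c' h' z
      = ((starRingEnd ℂ) (c (hd z)) * c' (hd z)) * ((starRingEnd ℂ) (h (tl z)) * h' (tl z)) := by
  have := wave_mul_wave_neg (hd z).1 z.1
  simp only [ins, map_mul, conj_wave, neg_neg]
  linear_combination ((starRingEnd ℂ) (c (hd z)) * c' (hd z) * (starRingEnd ℂ) (h (tl z))
    * h' (tl z)) * this

theorem integral_ins {n : ℕ} (c c' : Photon → ℂ) (h h' : Sector n → ℂ) :
    ∫ z, (starRingEnd ℂ) (ins c h z) * ins c' h' z ∂(sectorMeasure (n + 1))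
      = (∫ q, (starRingEnd ℂ) (c q) * c' q ∂photonMeasure)
        * ∫ z, (starRingEnd ℂ) (h z) * h' z ∂(sectorMeasure n) := by
  simp only [conj_ins_mul_ins]
  rw [integral_split fun p => ((starRingEnd ℂ) (c p.1) * c' p.1) *
    ((starRingEnd ℂ) (h p.2) * h' p.2)]
  exact integral_prod_mul (fun q => (starRingEnd ℂ) (c q) * c' q)
    (fun z => (starRingEnd ℂ) (h z) * h' z)

theorem inner_eq_integral {α : Type*} [MeasurableSpace α] {μ : Measure α} (f g : Lp ℂ 2 μ) :
    inner ℂ f g = ∫ x, (starRingEnd ℂ) (f x) * g x ∂μ := by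
  rw [L2.inner_def]
  refine integral_congr_ae (ae_of_all _ fun x => ?_)
  exact (RCLike.inner_apply _ _).trans (mul_comm _ _)

theorem ins_congr {n : ℕ} (c : Photon → ℂ) {h h' : Sector n → ℂ} (e : h =ᵐ[sectorMeasure n] h') :
    ins c h =ᵐ[sectorMeasure (n + 1)] ins c h' := by
  filter_upwards [quasiMeasurePreserving_tl.ae e] with z hz
  simp only [ins]; rw [hz]

/-- `ins` as a bounded operator. -/
def insL {n : ℕ} {c : Photon → ℂ} (hc : MemLp c 2 photonMeasure) :
    SectorSpace n →L[ℂ] SectorSpace (n + 1) :=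
  LinearMap.mkContinuous
    { toFun := fun h => (memLp_ins hc (Lp.memLp h)).toLp (ins c h)
      map_add' := fun h h' => by
        rw [← MemLp.toLp_add, MemLp.toLp_eq_toLp_iff]
        filter_upwards [ins_congr c (Lp.coeFn_add h h')] with z hz
        rw [hz]; simp [ins, mul_add]
      map_smul' := fun a h => by
        rw [RingHom.id_apply, ← MemLp.toLp_const_smul, MemLp.toLp_eq_toLp_iff]
        filter_upwards [ins_congr c (Lp.coeFn_smul a h)] with z hz
        rw [hz]; simp [ins]; ring }
    ‖hc.toLp c‖ (fun h => by
      change ‖(memLp_ins hc (Lp.memLp h)).toLp (ins c h)‖ ≤ _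
      refine le_of_sq_le_sq ?_ (by positivity)
      have h1 : (inner ℂ ((memLp_ins hc (Lp.memLp h)).toLp (ins c h))
          ((memLp_ins hc (Lp.memLp h)).toLp (ins c h)) : ℂ)
          = inner ℂ (hc.toLp c) (hc.toLp c) * inner ℂ h h := by
        rw [inner_toLp_eq_integral, integral_ins, inner_toLp_eq_integral, inner_eq_integral]
      rw [inner_self_eq_norm_sq_to_K, inner_self_eq_norm_sq_to_K, inner_self_eq_norm_sq_to_K] at h1
      rw [mul_pow]
      exact le_of_eq (by exact_mod_cast h1))

theorem coeFn_insL {n : ℕ} {c : Photon → ℂ} (hc : MemLp c 2 photonMeasure) (h : SectorSpace n) :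
    insL hc h =ᵐ[sectorMeasure (n + 1)] ins c h :=
  (memLp_ins hc (Lp.memLp h)).coeFn_toLp

theorem inner_insL_insL {n : ℕ} {c c' : Photon → ℂ} (hc : MemLp c 2 photonMeasure)
    (hc' : MemLp c' 2 photonMeasure) (h h' : SectorSpace n) :
    inner ℂ (insL hc h) (insL hc' h')
      = (∫ q, (starRingEnd ℂ) (c q) * c' q ∂photonMeasure) * inner ℂ h h' := by
  rw [inner_eq_integral h, ← integral_ins]
  exact inner_toLp_eq_integral (memLp_ins hc (Lp.memLp h)) (memLp_ins hc' (Lp.memLp h'))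

/-! ### Annihilation, creation, permutations and spin in a sector -/

theorem ae_ae_consMap {n : ℕ} {p : Sector (n + 1) → Prop} (h : ∀ᵐ z ∂(sectorMeasure (n + 1)), p z) :
    ∀ᵐ z ∂(sectorMeasure n), ∀ᵐ q ∂photonMeasure, p (consMap (q, z)) := by
  have h1 : ∀ᵐ w ∂(photonMeasure.prod (sectorMeasure n)), p (consMap w) :=
    (measurePreserving_consMap n).quasiMeasurePreserving.ae h
  have h2 : ∀ᵐ w ∂((sectorMeasure n).prod photonMeasure), p (consMap w.swap) :=
    (Measure.measurePreserving_swap (μ := sectorMeasure n)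
      (ν := photonMeasure)).quasiMeasurePreserving.ae h1
  exact Measure.ae_ae_of_ae_prod h2

theorem integral_consMap_symm {n : ℕ} {F : Sector (n + 1) → ℂ}
    (hF : Integrable F (sectorMeasure (n + 1))) :
    ∫ z, F z ∂(sectorMeasure (n + 1))
      = ∫ z, ∫ q, F (consMap (q, z)) ∂photonMeasure ∂(sectorMeasure n) := by
  have h1 : Integrable (fun p => F (consMap p)) (photonMeasure.prod (sectorMeasure n)) :=
    (measurePreserving_consMap n).integrable_comp_of_integrable hF
  have h2 := integral_split (n := n) (fun p => F (consMap p))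
  simp only [consMap_hd_tl] at h2
  rw [h2, integral_prod_symm _ h1]

/-- Integrating out the first photon is the adjoint of inserting it. -/
theorem coeFn_adjoint_insL {n : ℕ} {c : Photon → ℂ} (hc : MemLp c 2 photonMeasure)
    (Θ : SectorSpace (n + 1)) :
    (insL hc).adjoint Θ =ᵐ[sectorMeasure n] fun z =>
      ∫ q, (starRingEnd ℂ) (c q) * wave q.1 z.1 * Θ (consMap (q, z)) ∂photonMeasure := by
  have key : ∀ s, MeasurableSet s → ∀ hμ : sectorMeasure n s < ⊤,
      Integrable (fun z => (starRingEnd ℂ) (ins c (s.indicator fun _ => (1 : ℂ)) z) * Θ z)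
        (sectorMeasure (n + 1)) := by
    intro s hs hμ
    have h1 : MemLp (s.indicator fun _ => (1 : ℂ)) 2 (sectorMeasure n) :=
      memLp_indicator_const 2 hs 1 (Or.inr hμ.ne)
    exact (memLp_ins hc h1).star.integrable_mul (Lp.memLp Θ)
  have e : ∀ (s : Set (Sector n)) (q : Photon) (z : Sector n),
      (starRingEnd ℂ) (ins c (s.indicator fun _ => (1 : ℂ)) (consMap (q, z))) * Θ (consMap (q, z))
        = s.indicator (fun _ => (1 : ℂ)) z
          * ((starRingEnd ℂ) (c q) * wave q.1 z.1 * Θ (consMap (q, z))) := by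
    intro s q z
    have h0 : (consMap (q, z)).1 = z.1 := rfl
    simp only [ins, map_mul, conj_wave, hd_consMap, tl_consMap, neg_neg, h0]
    by_cases hz : z ∈ s <;> simp [hz]
  refine ae_eq_of_forall_setIntegral_eq_of_sigmaFinite (fun s hs hμ => ?_) (fun s hs hμ => ?_)
    (fun s hs hμ => ?_)
  · exact integrableOn_Lp_of_measure_ne_top _ (by norm_num) hμ.ne
  · have h1 : Integrable (fun p : Photon × Sector n =>
        (starRingEnd ℂ) (ins c (s.indicator fun _ => (1 : ℂ)) (consMap p)) * Θ (consMap p))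
        (photonMeasure.prod (sectorMeasure n)) :=
      (measurePreserving_consMap n).integrable_comp_of_integrable (key s hs hμ)
    have h2 := h1.integral_prod_right
    simp only [e, integral_const_mul] at h2
    rw [← integrable_indicator_iff hs]
    refine h2.congr (ae_of_all _ fun z => ?_)
    by_cases hz : z ∈ s <;> simp [hz]
  · rw [← L2.inner_indicatorConstLp_one (𝕜 := ℂ) hs hμ.ne, ContinuousLinearMap.adjoint_inner_right]
    have h3 : insL hc (indicatorConstLp 2 hs hμ.ne (1 : ℂ))
        =ᵐ[sectorMeasure (n + 1)] ins c (s.indicator fun _ => (1 : ℂ)) :=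
      (coeFn_insL hc _).trans (ins_congr c indicatorConstLp_coeFn)
    have h4 : (inner ℂ (insL hc (indicatorConstLp 2 hs hμ.ne (1 : ℂ))) Θ : ℂ)
        = ∫ z, (starRingEnd ℂ) (ins c (s.indicator fun _ => (1 : ℂ)) z) * Θ z
          ∂(sectorMeasure (n + 1)) := by
      rw [inner_eq_integral]
      refine integral_congr_ae ?_
      filter_upwards [h3] with z hz
      rw [hz]
    rw [h4, integral_consMap_symm (key s hs hμ), ← integral_indicator hs]
    refine integral_congr_ae (ae_of_all _ fun z => ?_)
    simp only [e, integral_const_mul]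
    by_cases hz : z ∈ s <;> simp [hz]

/-- Permutation of the photons of a configuration. -/
def permMap {n : ℕ} (τ : Equiv.Perm (Fin n)) (z : Sector n) : Sector n :=
  (z.1, z.2.1, z.2.2 ∘ τ)

/-- Permutation of the photons as an operator. -/
def permL {n : ℕ} (τ : Equiv.Perm (Fin n)) : SectorSpace n →ₗᵢ[ℂ] SectorSpace n :=
  Lp.compMeasurePreservingₗᵢ ℂ (permMap τ) (measurePreserving_perm n τ)

theorem coeFn_permL {n : ℕ} (τ : Equiv.Perm (Fin n)) (h : SectorSpace n) :
    permL τ h =ᵐ[sectorMeasure n] fun z => h (permMap τ z) :=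
  Lp.coeFn_compMeasurePreserving h (measurePreserving_perm n τ)

theorem permL_permL {n : ℕ} (τ σ : Equiv.Perm (Fin n)) (h : SectorSpace n) :
    permL τ (permL σ h) = permL (τ * σ) h := by
  refine Lp.ext ?_
  filter_upwards [coeFn_permL τ (permL σ h), coeFn_permL (τ * σ) h,
    (measurePreserving_perm n τ).quasiMeasurePreserving.ae (coeFn_permL σ h)] with z h1 h2 h3
  rw [h1, h2]
  exact h3

theorem permL_one {n : ℕ} (h : SectorSpace n) : permL 1 h = h := by
  refine Lp.ext ?_
  filter_upwards [coeFn_permL 1 h] with z h1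
  rw [h1]; rfl

theorem inner_permL {n : ℕ} (τ : Equiv.Perm (Fin n)) (h h' : SectorSpace n) :
    inner ℂ (permL τ h) (permL τ h') = inner ℂ h h' := (permL τ).inner_map_map h h'

/-- The wave function is symmetric under permutations of the photons. -/
def IsSym {n : ℕ} (h : SectorSpace n) : Prop := ∀ τ, permL τ h = h

theorem State.isSym (Ψ : State) (n : ℕ) : IsSym ((Ψ : FullSpace) n) := by
  intro τ
  refine Lp.ext ?_
  filter_upwards [coeFn_permL τ ((Ψ : FullSpace) n), Ψ.2 n τ] with z h1 h2
  rw [h1]; exact h2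

/-- A permutation of `n + 1` photons which keeps the first one permutes the others. -/
theorem exists_tail_perm {n : ℕ} {σ : Equiv.Perm (Fin (n + 1))} (h : σ 0 = 0) :
    ∃ σ' : Equiv.Perm (Fin n), ∀ i : Fin n, σ i.succ = (σ' i).succ := by
  obtain ⟨⟨p, e⟩, rfl⟩ := Equiv.Perm.decomposeFin.symm.surjective σ
  have hp : p = 0 := by simpa using h
  subst hp
  exact ⟨e, fun i => by simp⟩

theorem permL_insL_of_fix {n : ℕ} {c : Photon → ℂ} (hc : MemLp c 2 photonMeasure)
    {h : SectorSpace n} {σ : Equiv.Perm (Fin (n + 1))} {σ' : Equiv.Perm (Fin n)} (h0 : σ 0 = 0)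
    (hσ : ∀ i : Fin n, σ i.succ = (σ' i).succ) :
    permL σ (insL hc h) = insL hc (permL σ' h) := by
  refine Lp.ext ?_
  filter_upwards [coeFn_permL σ (insL hc h), coeFn_insL hc (permL σ' h),
    (measurePreserving_perm (n + 1) σ).quasiMeasurePreserving.ae (coeFn_insL hc h),
    ins_congr c (coeFn_permL σ' h)] with z h1 h2 h3 h4
  rw [h1, h2, h4]
  refine h3.trans ?_
  have e1 : hd (permMap σ z) = hd z := by simp [hd, permMap, h0]
  have e2 : tl (permMap σ z) = permMap σ' (tl z) := by
    simp only [tl, permMap, Function.comp_def, hσ]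
  change ins c h (permMap σ z) = _
  simp only [ins, e1, e2]
  rfl

theorem IsSym.permL_insL {n : ℕ} {c : Photon → ℂ} (hc : MemLp c 2 photonMeasure)
    {h : SectorSpace n} (hs : IsSym h) {σ : Equiv.Perm (Fin (n + 1))} (h0 : σ 0 = 0) :
    permL σ (insL hc h) = insL hc h := by
  obtain ⟨σ', hσ⟩ := exists_tail_perm h0
  rw [permL_insL_of_fix hc h0 hσ, hs]

theorem IsSym.permL_insL_eq {n : ℕ} {c : Photon → ℂ} (hc : MemLp c 2 photonMeasure)
    {h : SectorSpace n} (hs : IsSym h) {σ τ : Equiv.Perm (Fin (n + 1))} (h0 : σ 0 = τ 0) :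
    permL σ (insL hc h) = permL τ (insL hc h) := by
  have : σ = τ * (τ⁻¹ * σ) := by group
  rw [this, ← permL_permL, hs.permL_insL hc (by simp [h0])]

/-- The annihilation operator of the photon wave function `c`, recoil included. -/
def annL {n : ℕ} {c : Photon → ℂ} (hc : MemLp c 2 photonMeasure) :
    SectorSpace (n + 1) →L[ℂ] SectorSpace n :=
  (Real.sqrt (n + 1) : ℂ) • (insL hc).adjoint

/-- The creation operator of the photon wave function `c`, recoil included. -/
def creL {n : ℕ} {c : Photon → ℂ} (hc : MemLp c 2 photonMeasure) :
    SectorSpace n →L[ℂ] SectorSpace (n + 1) :=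
  (Real.sqrt (n + 1) : ℂ)⁻¹ • ∑ i : Fin (n + 1),
    (permL i.cycleRange.symm).toContinuousLinearMap ∘L insL hc

theorem creL_apply {n : ℕ} {c : Photon → ℂ} (hc : MemLp c 2 photonMeasure) (h : SectorSpace n) :
    creL hc h = (Real.sqrt (n + 1) : ℂ)⁻¹ • ∑ i : Fin (n + 1),
      permL i.cycleRange.symm (insL hc h) := by
  simp [creL]

theorem sqrt_succ_ne_zero (n : ℕ) : (Real.sqrt (n + 1) : ℂ) ≠ 0 := by
  have : 0 < Real.sqrt ((n : ℝ) + 1) := Real.sqrt_pos.2 (by positivity)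
  exact_mod_cast this.ne'

theorem sqrt_succ_mul_self (n : ℕ) : (Real.sqrt (n + 1) : ℂ) * Real.sqrt (n + 1) = n + 1 := by
  rw [← Complex.ofReal_mul, Real.mul_self_sqrt (by positivity)]; simp

theorem coeFn_annL {n : ℕ} {c : Photon → ℂ} (hc : MemLp c 2 photonMeasure)
    (Θ : SectorSpace (n + 1)) :
    annL hc Θ =ᵐ[sectorMeasure n] fun z => (Real.sqrt (n + 1) : ℂ) *
      ∫ q, (starRingEnd ℂ) (c q) * wave q.1 z.1 * Θ (consMap (q, z)) ∂photonMeasure := by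
  have h1 := Lp.coeFn_smul (Real.sqrt (n + 1) : ℂ) ((insL hc).adjoint Θ)
  filter_upwards [h1, coeFn_adjoint_insL hc Θ] with z h2 h3
  have h4 : annL hc Θ = (Real.sqrt (n + 1) : ℂ) • (insL hc).adjoint Θ := rfl
  rw [h4, h2, Pi.smul_apply, h3, smul_eq_mul]

theorem coeFn_sum {α ι : Type*} [MeasurableSpace α] {μ : Measure α} (s : Finset ι)
    (f : ι → Lp ℂ 2 μ) : (∑ i ∈ s, f i : Lp ℂ 2 μ) =ᵐ[μ] fun z => ∑ i ∈ s, f i z := by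
  classical
  induction s using Finset.induction_on with
  | empty =>
    filter_upwards [Lp.coeFn_zero ℂ 2 μ] with z hz
    simpa using hz
  | insert a s ha ih =>
    rw [Finset.sum_insert ha]
    filter_upwards [Lp.coeFn_add (f a) (∑ i ∈ s, f i), ih] with z h1 h2
    rw [h1, Pi.add_apply, h2, Finset.sum_insert ha]

theorem hd_permMap_cycle {n : ℕ} (i : Fin (n + 1)) (z : Sector (n + 1)) :
    hd (permMap i.cycleRange.symm z) = z.2.2 i := by
  simp [hd, permMap]

theorem tl_permMap_cycle {n : ℕ} (i : Fin (n + 1)) (z : Sector (n + 1)) :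
    tl (permMap i.cycleRange.symm z) = (z.1, z.2.1, i.removeNth z.2.2) := by
  simp only [tl, permMap, Function.comp_def, Fin.cycleRange_symm_succ]
  rfl

theorem coeFn_creL {n : ℕ} {c : Photon → ℂ} (hc : MemLp c 2 photonMeasure) (h : SectorSpace n) :
    creL hc h =ᵐ[sectorMeasure (n + 1)] fun z => (Real.sqrt (n + 1) : ℂ)⁻¹ *
      ∑ i : Fin (n + 1), c (z.2.2 i) * wave (z.2.2 i).1 (-z.1)
        * h (z.1, z.2.1, i.removeNth z.2.2) := by
  rw [creL_apply]
  have h1 : ∀ i : Fin (n + 1), permL i.cycleRange.symm (insL hc h) =ᵐ[sectorMeasure (n + 1)]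
      fun z => c (z.2.2 i) * wave (z.2.2 i).1 (-z.1) * h (z.1, z.2.1, i.removeNth z.2.2) := by
    intro i
    filter_upwards [coeFn_permL i.cycleRange.symm (insL hc h),
      (measurePreserving_perm (n + 1) i.cycleRange.symm).quasiMeasurePreserving.ae
        (coeFn_insL hc h)] with z h2 h3
    rw [h2]
    refine h3.trans ?_
    change ins c h (permMap i.cycleRange.symm z) = _
    simp only [ins, hd_permMap_cycle, tl_permMap_cycle]
    rfl
  filter_upwards [Lp.coeFn_smul (Real.sqrt (n + 1) : ℂ)⁻¹
    (∑ i : Fin (n + 1), permL i.cycleRange.symm (insL hc h)),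
    coeFn_sum Finset.univ (fun i : Fin (n + 1) => permL i.cycleRange.symm (insL hc h)),
    ae_all_iff.2 h1] with z h2 h3 h4
  rw [h2, Pi.smul_apply, h3, smul_eq_mul]
  simp only [h4]

/-- Creation and annihilation operators are adjoint to each other on symmetric wave functions. -/
theorem IsSym.inner_creL {n : ℕ} {c : Photon → ℂ} (hc : MemLp c 2 photonMeasure)
    (h : SectorSpace n) {Θ : SectorSpace (n + 1)} (hΘ : IsSym Θ) :
    inner ℂ (creL hc h) Θ = inner ℂ h (annL hc Θ) := by
  have h1 : ∀ i : Fin (n + 1), inner ℂ (permL i.cycleRange.symm (insL hc h)) Θ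
      = inner ℂ (insL hc h) Θ := by
    intro i
    conv_lhs => rw [← hΘ i.cycleRange.symm]
    exact inner_permL _ _ _
  rw [creL_apply, inner_smul_left, sum_inner, Finset.sum_congr rfl fun i _ => h1 i,
    Finset.sum_const, Finset.card_univ, Fintype.card_fin, annL, smul_apply,
    inner_smul_right, ContinuousLinearMap.adjoint_inner_right, nsmul_eq_mul, map_inv₀,
    Complex.conj_ofReal, ← mul_assoc]
  congr 1
  rw [inv_mul_eq_iff_eq_mul₀ (sqrt_succ_ne_zero n), sqrt_succ_mul_self]
  push_cast; rfl

theorem inner_insL_eq {n : ℕ} {c : Photon → ℂ} (hc : MemLp c 2 photonMeasure)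
    (h : SectorSpace n) (Θ : SectorSpace (n + 1)) :
    (Real.sqrt (n + 1) : ℂ) * inner ℂ (insL hc h) Θ = inner ℂ h (annL hc Θ) := by
  rw [annL, smul_apply, inner_smul_right,
    ContinuousLinearMap.adjoint_inner_right]

theorem isSym_creL {n : ℕ} {c : Photon → ℂ} (hc : MemLp c 2 photonMeasure) {h : SectorSpace n}
    (hs : IsSym h) : IsSym (creL hc h) := by
  intro τ
  rw [creL_apply, map_smul, map_sum]
  congr 1
  simp only [permL_permL]
  rw [← Equiv.sum_comp τ (fun i => permL i.cycleRange.symm (insL hc h))]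
  refine Finset.sum_congr rfl fun i _ => hs.permL_insL_eq hc ?_
  simp

theorem inner_permL_left {n : ℕ} (τ : Equiv.Perm (Fin n)) (h h' : SectorSpace n) :
    inner ℂ (permL τ h) h' = inner ℂ h (permL τ⁻¹ h') := by
  rw [← inner_permL τ h, permL_permL, mul_inv_cancel, permL_one]

theorem isSym_annL {n : ℕ} {c : Photon → ℂ} (hc : MemLp c 2 photonMeasure)
    {Θ : SectorSpace (n + 1)} (hs : IsSym Θ) : IsSym (annL hc Θ) := by
  intro τ
  refine ext_inner_left ℂ fun h => ?_
  set σ : Equiv.Perm (Fin (n + 1)) := Equiv.Perm.decomposeFin.symm (0, τ⁻¹)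
  have e : permL σ (insL hc h) = insL hc (permL τ⁻¹ h) :=
    permL_insL_of_fix hc (by simp [σ]) (fun i => by simp [σ])
  have e2 : inner ℂ h (permL τ (annL hc Θ))
      = inner ℂ (permL τ⁻¹ h) (annL hc Θ) := by
    rw [inner_permL_left, inv_inv]
  rw [e2, ← inner_insL_eq, ← inner_insL_eq, ← e, inner_permL_left, hs]

/-- The operators annihilating two photons commute. -/
theorem IsSym.annL_comm {n : ℕ} {c c' : Photon → ℂ} (hc : MemLp c 2 photonMeasure)
    (hc' : MemLp c' 2 photonMeasure) {Θ : SectorSpace (n + 2)} (hs : IsSym Θ) :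
    annL hc (annL hc' Θ) = annL hc' (annL hc Θ) := by
  refine ext_inner_left ℂ fun h => ?_
  rw [← inner_insL_eq hc h (annL hc' Θ), ← inner_insL_eq hc' h (annL hc Θ)]
  congr 1
  have e1 := inner_insL_eq hc' (insL hc h) Θ
  have e2 := inner_insL_eq hc (insL hc' h) Θ
  rw [← e1, ← e2]
  congr 1
  have e3 : permL (Equiv.swap 0 1) (insL hc' (insL hc h)) = insL hc (insL hc' h) := by
    refine Lp.ext ?_
    filter_upwards [coeFn_permL (Equiv.swap 0 1) (insL hc' (insL hc h)),
      (measurePreserving_perm (n + 2) (Equiv.swap 0 1)).quasiMeasurePreserving.ae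
        ((coeFn_insL hc' (insL hc h)).trans (ins_congr c' (coeFn_insL hc h))),
      (coeFn_insL hc (insL hc' h)).trans (ins_congr c (coeFn_insL hc' h))] with z h1 h2 h3
    rw [h1, h3]
    refine h2.trans ?_
    have a1 : ∀ i : Fin n, (Equiv.swap (0 : Fin (n + 2)) 1) i.succ.succ = i.succ.succ := fun i =>
      Equiv.swap_apply_of_ne_of_ne (Fin.succ_ne_zero _) (by
        rw [← Fin.succ_zero_eq_one]; exact fun h => Fin.succ_ne_zero _ (Fin.succ_injective _ h))
    simp only [ins, hd, tl, Function.comp_def, a1]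
    simp
    ring
  rw [← e3, inner_permL_left, hs]

/-- The canonical commutation relations on the vacuum. -/
theorem inner_creL_creL_zero {c c' : Photon → ℂ} (hc : MemLp c 2 photonMeasure)
    (hc' : MemLp c' 2 photonMeasure) (h h' : SectorSpace 0) :
    inner ℂ (creL hc h) (creL hc' h')
      = (∫ q, (starRingEnd ℂ) (c q) * c' q ∂photonMeasure) * inner ℂ h h' := by
  rw [← inner_insL_insL hc hc', creL_apply, creL_apply]
  simp [Fin.cycleRange_zero]

/-- Removing a photon commutes with inserting another one. -/
theorem adjoint_insL_swap {m : ℕ} {c c' : Photon → ℂ} (hc : MemLp c 2 photonMeasure)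
    (hc' : MemLp c' 2 photonMeasure) (h : SectorSpace (m + 1)) :
    (insL hc).adjoint (permL (Equiv.swap 0 1) (insL hc' h)) = insL hc' ((insL hc).adjoint h) := by
  refine Lp.ext ?_
  have h1 : permL (Equiv.swap 0 1) (insL hc' h) =ᵐ[sectorMeasure (m + 2)] fun z =>
      ins c' h (permMap (Equiv.swap 0 1) z) := by
    filter_upwards [coeFn_permL (Equiv.swap 0 1) (insL hc' h),
      (measurePreserving_perm (m + 2) (Equiv.swap 0 1)).quasiMeasurePreserving.ae
        (coeFn_insL hc' h)] with z h1 h2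
    rw [h1]; exact h2
  filter_upwards [coeFn_adjoint_insL hc (permL (Equiv.swap 0 1) (insL hc' h)),
    coeFn_insL hc' ((insL hc).adjoint h), ins_congr c' (coeFn_adjoint_insL hc h),
    ae_ae_consMap h1] with z h2 h3 h4 h5
  rw [h2, h3, h4]
  simp only [ins]
  rw [← integral_const_mul]
  refine integral_congr_ae ?_
  filter_upwards [h5] with q h6
  rw [h6]
  have a1 : ∀ i : Fin m, (Equiv.swap (0 : Fin (m + 2)) 1) i.succ.succ = i.succ.succ := fun i =>
    Equiv.swap_apply_of_ne_of_ne (Fin.succ_ne_zero _) (by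
      rw [← Fin.succ_zero_eq_one]; exact fun h => Fin.succ_ne_zero _ (Fin.succ_injective _ h))
  have e1 : hd (permMap (Equiv.swap 0 1) (consMap (q, z))) = hd z := by
    change (Fin.cons q z.2.2 : Fin (m + 2) → Photon) (Equiv.swap 0 1 0) = z.2.2 0
    rw [Equiv.swap_apply_left]
    rfl
  have e2 : tl (permMap (Equiv.swap 0 1) (consMap (q, z))) = consMap (q, tl z) := by
    refine Prod.ext rfl (Prod.ext rfl (funext fun i => ?_))
    refine Fin.cases ?_ (fun i => ?_) i
    · simp [tl, permMap, consMap]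
    · simp only [tl, permMap, consMap, Function.comp_def, a1]
      simp
  have e3 : (permMap (Equiv.swap 0 1) (consMap (q, z))).1 = z.1 := rfl
  have e4 : (tl z).1 = z.1 := rfl
  simp only [ins, e1, e2, e3, e4]
  ring

/-- The canonical commutation relations. -/
theorem inner_creL_creL_succ {m : ℕ} {c c' : Photon → ℂ} (hc : MemLp c 2 photonMeasure)
    (hc' : MemLp c' 2 photonMeasure) {h h' : SectorSpace (m + 1)} (hs : IsSym h) (hs' : IsSym h') :
    inner ℂ (creL hc h) (creL hc' h')
      = (∫ q, (starRingEnd ℂ) (c q) * c' q ∂photonMeasure) * inner ℂ h h'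
        + inner ℂ (annL hc' h) (annL hc h') := by
  have e0 : ∀ i : Fin (m + 1), inner ℂ (insL hc h)
      (permL (i.succ.cycleRange.symm) (insL hc' h'))
      = inner ℂ (insL hc h) (permL (Equiv.swap 0 1) (insL hc' h')) := by
    intro i
    set σ : Equiv.Perm (Fin (m + 2)) := Equiv.Perm.decomposeFin.symm (0, Equiv.swap 0 i)
    have e1 : permL (i.succ.cycleRange.symm) (insL hc' h')
        = permL σ (permL (Equiv.swap 0 1) (insL hc' h')) := by
      rw [permL_permL]
      refine hs'.permL_insL_eq hc' ?_
      have e2 : σ (Fin.succ 0) = i.succ := by simp [σ]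
      rw [Equiv.Perm.mul_apply, Equiv.swap_apply_left, Fin.cycleRange_symm_zero]
      exact e2.symm
    rw [e1]
    conv_lhs => rw [← hs.permL_insL hc (σ := σ) (by simp [σ])]
    exact inner_permL _ _ _
  have e2 : inner ℂ (creL hc h) (creL hc' h')
      = ∑ i : Fin (m + 2), inner ℂ (insL hc h) (permL i.cycleRange.symm (insL hc' h')) := by
    rw [(isSym_creL hc' hs').inner_creL, ← inner_insL_eq, creL_apply, inner_smul_right,
      ← mul_assoc, mul_inv_cancel₀ (sqrt_succ_ne_zero (m + 1)), one_mul, inner_sum]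
  rw [e2, Fin.sum_univ_succ, Finset.sum_congr rfl fun i _ => e0 i, Finset.sum_const,
    Finset.card_univ, Fintype.card_fin]
  congr 1
  · rw [← inner_insL_insL hc hc']
    have e3 : (Fin.cycleRange (0 : Fin (m + 2))).symm = 1 := by
      rw [Fin.cycleRange_zero]; rfl
    rw [e3, permL_one]
  · rw [← ContinuousLinearMap.adjoint_inner_right, adjoint_insL_swap, annL, annL, smul_apply,
      smul_apply, inner_smul_left, inner_smul_right, Complex.conj_ofReal, ← mul_assoc,
      sqrt_succ_mul_self, ContinuousLinearMap.adjoint_inner_left, nsmul_eq_mul]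
    push_cast; rfl

/-! ### Spin matrices -/

theorem measurePreserving_count_equiv {α : Type*} [MeasurableSpace α] [DiscreteMeasurableSpace α]
    (e : α ≃ α) : MeasurePreserving e (Measure.count : Measure α) Measure.count := by
  refine ⟨Measurable.of_discrete, ?_⟩
  ext s hs
  rw [Measure.map_apply Measurable.of_discrete hs, Measure.count_apply hs,
    Measure.count_apply (MeasurableSet.of_discrete), Set.encard_preimage_of_bijective e.bijective]

/-- Addition of `d` to the spin index. -/
def spinShift {n : ℕ} (d : Fin 2) (z : Sector n) : Sector n := (z.1, z.2.1 + d, z.2.2)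

theorem measurePreserving_spinShift {n : ℕ} (d : Fin 2) :
    MeasurePreserving (spinShift d) (sectorMeasure n) (sectorMeasure n) :=
  (MeasurePreserving.id volume).prod
    ((measurePreserving_count_equiv (Equiv.addRight d)).prod (MeasurePreserving.id _))

/-- A spin matrix applied to a wave function. -/
def spinF {n : ℕ} (M : Matrix (Fin 2) (Fin 2) ℂ) (h : Sector n → ℂ) : Sector n → ℂ :=
  fun z => ∑ t : Fin 2, M z.2.1 t * h (z.1, t, z.2.2)

theorem spinF_eq_shift {n : ℕ} (M : Matrix (Fin 2) (Fin 2) ℂ) (h : Sector n → ℂ) (z : Sector n) :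
    spinF M h z = ∑ d : Fin 2, M z.2.1 (z.2.1 + d) * h (spinShift d z) :=
  (Equiv.sum_comp (Equiv.addLeft z.2.1) fun t => M z.2.1 t * h (z.1, t, z.2.2)).symm

theorem ae_forall_spin {n : ℕ} {p : Sector n → Prop} (h : ∀ᵐ z ∂(sectorMeasure n), p z) :
    ∀ᵐ z ∂(sectorMeasure n), ∀ t : Fin 2, p (z.1, t, z.2.2) := by
  have h1 : ∀ᵐ z ∂(sectorMeasure n), ∀ d : Fin 2, p (spinShift d z) :=
    ae_all_iff.2 fun d => (measurePreserving_spinShift d).quasiMeasurePreserving.ae h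
  filter_upwards [h1] with z hz t
  have := hz (t - z.2.1)
  simpa [spinShift] using this

theorem spinF_congr {n : ℕ} (M : Matrix (Fin 2) (Fin 2) ℂ) {h h' : Sector n → ℂ}
    (e : h =ᵐ[sectorMeasure n] h') : spinF M h =ᵐ[sectorMeasure n] spinF M h' := by
  filter_upwards [ae_forall_spin e] with z hz
  simp only [spinF, hz]

theorem memLp_spin_term {n : ℕ} (M : Matrix (Fin 2) (Fin 2) ℂ) (d : Fin 2) {h : Sector n → ℂ}
    (hh : MemLp h 2 (sectorMeasure n)) :
    MemLp (fun z => M z.2.1 (z.2.1 + d) * h (spinShift d z)) 2 (sectorMeasure n) := by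
  have h1 := hh.comp_measurePreserving (measurePreserving_spinShift d)
  have hm : Measurable (fun z : Sector n => M z.2.1 (z.2.1 + d)) :=
    (Measurable.of_discrete (f := fun s : Fin 2 => M s (s + d))).comp
      (measurable_fst.comp measurable_snd)
  refine h1.of_le_mul (c := ∑ s : Fin 2, ‖M s (s + d)‖) (hm.aestronglyMeasurable.mul h1.1)
    (ae_of_all _ fun z => ?_)
  rw [norm_mul]
  gcongr
  · exact Finset.single_le_sum (f := fun s : Fin 2 => ‖M s (s + d)‖)
      (fun _ _ => norm_nonneg _) (Finset.mem_univ z.2.1)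
  · rfl

theorem memLp_spinF {n : ℕ} (M : Matrix (Fin 2) (Fin 2) ℂ) {h : Sector n → ℂ}
    (hh : MemLp h 2 (sectorMeasure n)) : MemLp (spinF M h) 2 (sectorMeasure n) := by
  have : spinF M h = fun z => ∑ d : Fin 2, M z.2.1 (z.2.1 + d) * h (spinShift d z) :=
    funext fun z => spinF_eq_shift M h z
  rw [this]
  exact memLp_finsetSum _ fun d _ => memLp_spin_term M d hh

/-- A spin matrix as a bounded operator. -/
def spinL {n : ℕ} (M : Matrix (Fin 2) (Fin 2) ℂ) : SectorSpace n →L[ℂ] SectorSpace n :=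
  LinearMap.mkContinuous
    { toFun := fun h => (memLp_spinF M (Lp.memLp h)).toLp (spinF M h)
      map_add' := fun h h' => by
        rw [← MemLp.toLp_add, MemLp.toLp_eq_toLp_iff]
        filter_upwards [spinF_congr M (Lp.coeFn_add h h')] with z hz
        rw [hz]; simp [spinF, mul_add]; ring
      map_smul' := fun a h => by
        rw [RingHom.id_apply, ← MemLp.toLp_const_smul, MemLp.toLp_eq_toLp_iff]
        filter_upwards [spinF_congr M (Lp.coeFn_smul a h)] with z hz
        rw [hz]; simp [spinF]; ring }
    (∑ d : Fin 2, ∑ s : Fin 2, ‖M s (s + d)‖) (fun h => by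
      change ‖(memLp_spinF M (Lp.memLp h)).toLp (spinF M h)‖ ≤ _
      have e : (memLp_spinF M (Lp.memLp h)).toLp (spinF M h)
          = ∑ d : Fin 2, (memLp_spin_term M d (Lp.memLp h)).toLp _ := by
        refine Lp.ext ?_
        filter_upwards [(memLp_spinF M (Lp.memLp h)).coeFn_toLp,
          coeFn_sum Finset.univ (fun d : Fin 2 => (memLp_spin_term M d (Lp.memLp h)).toLp _),
          ae_all_iff.2 fun d => (memLp_spin_term M d (Lp.memLp h)).coeFn_toLp] with z h1 h2 h3
        rw [h1, h2, spinF_eq_shift]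
        exact Finset.sum_congr rfl fun d _ => (h3 d).symm
      rw [e, Finset.sum_mul]
      refine (norm_sum_le _ _).trans (Finset.sum_le_sum fun d _ => ?_)
      have h1 := Lp.norm_compMeasurePreserving h (measurePreserving_spinShift (n := n) d)
      rw [← h1]
      refine Lp.norm_le_mul_norm_of_ae_le_mul ?_
      filter_upwards [(memLp_spin_term M d (Lp.memLp h)).coeFn_toLp,
        Lp.coeFn_compMeasurePreserving h (measurePreserving_spinShift (n := n) d)] with z h2 h3
      rw [h2, h3, norm_mul]
      gcongr
      · exact Finset.single_le_sum (f := fun s : Fin 2 => ‖M s (s + d)‖)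
          (fun _ _ => norm_nonneg _) (Finset.mem_univ z.2.1)
      · rfl)

theorem coeFn_spinL {n : ℕ} (M : Matrix (Fin 2) (Fin 2) ℂ) (h : SectorSpace n) :
    spinL M h =ᵐ[sectorMeasure n] spinF M h :=
  (memLp_spinF M (Lp.memLp h)).coeFn_toLp

theorem spinL_spinL {n : ℕ} (M N : Matrix (Fin 2) (Fin 2) ℂ) (h : SectorSpace n) :
    spinL M (spinL N h) = spinL (M * N) h := by
  refine Lp.ext ?_
  filter_upwards [(coeFn_spinL M (spinL N h)).trans (spinF_congr M (coeFn_spinL N h)),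
    coeFn_spinL (M * N) h] with z h1 h2
  rw [h1, h2]
  simp only [spinF, Matrix.mul_apply, Fin.sum_univ_two]
  ring

theorem spinL_one {n : ℕ} (h : SectorSpace n) : spinL 1 h = h := by
  refine Lp.ext ?_
  filter_upwards [coeFn_spinL 1 h] with z h1
  rw [h1]
  simp [spinF, Matrix.one_apply]

theorem spinL_matrix_smul {n : ℕ} (a : ℂ) (M : Matrix (Fin 2) (Fin 2) ℂ) (h : SectorSpace n) :
    spinL (a • M) h = a • spinL M h := by
  refine Lp.ext ?_
  filter_upwards [coeFn_spinL (a • M) h, coeFn_spinL M h, Lp.coeFn_smul a (spinL M h)]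
    with z h1 h2 h3
  rw [h1, h3, Pi.smul_apply, h2]
  simp only [spinF, Matrix.smul_apply, Fin.sum_univ_two, smul_eq_mul]
  ring

/-- Rearrangement of the variables with the spin in front. -/
theorem integral_spin {n : ℕ} {F : Sector n → ℂ} (hF : Integrable F (sectorMeasure n)) :
    ∫ z, F z ∂(sectorMeasure n)
      = ∫ w : R3 × (Fin n → Photon), ∑ s : Fin 2, F (w.1, s, w.2)
        ∂((volume : Measure R3).prod (Measure.pi fun _ : Fin n => photonMeasure)) := by
  have h1 := measurePreserving_leftComm (Measure.count : Measure (Fin 2)) (volume : Measure R3)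
    (Measure.pi fun _ : Fin n => photonMeasure)
  have h2 : Integrable (fun p : Fin 2 × R3 × (Fin n → Photon) => F (p.2.1, p.1, p.2.2))
      ((Measure.count : Measure (Fin 2)).prod ((volume : Measure R3).prod
        (Measure.pi fun _ : Fin n => photonMeasure))) :=
    h1.integrable_comp_of_integrable hF
  have h3 : ∫ z, F z ∂(sectorMeasure n)
      = ∫ p : Fin 2 × R3 × (Fin n → Photon), F (p.2.1, p.1, p.2.2)
        ∂((Measure.count : Measure (Fin 2)).prod ((volume : Measure R3).prod
        (Measure.pi fun _ : Fin n => photonMeasure))) := by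
    have h4 : Measure.map (fun p : Fin 2 × R3 × (Fin n → Photon) => (p.2.1, p.1, p.2.2))
      ((Measure.count : Measure (Fin 2)).prod ((volume : Measure R3).prod
        (Measure.pi fun _ : Fin n => photonMeasure))) = sectorMeasure n := h1.map_eq
    rw [← h4, integral_map h1.measurable.aemeasurable]
    rw [h4]; exact hF.1
  have h5 : ∀ s : Fin 2, Integrable (fun w : R3 × (Fin n → Photon) => F (w.1, s, w.2))
      ((volume : Measure R3).prod (Measure.pi fun _ : Fin n => photonMeasure)) := by
    intro s
    have h6 := h2.prod_right_ae
    rw [ae_iff, Measure.count_eq_zero_iff] at h6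
    by_contra h7
    exact (h6 ▸ (show s ∈ {a | _} from h7) : s ∈ (∅ : Set (Fin 2)))
  rw [h3, integral_prod _ h2, integral_finsetSum _ fun s _ => h5 s, integral_count]

theorem integral_spin_congr {n : ℕ} {F G : Sector n → ℂ} (hF : Integrable F (sectorMeasure n))
    (hG : Integrable G (sectorMeasure n))
    (h : ∀ x k, ∑ s : Fin 2, F (x, s, k) = ∑ s : Fin 2, G (x, s, k)) :
    ∫ z, F z ∂(sectorMeasure n) = ∫ z, G z ∂(sectorMeasure n) := by
  rw [integral_spin hF, integral_spin hG]
  simp only [h]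

theorem inner_spinL {n : ℕ} (M : Matrix (Fin 2) (Fin 2) ℂ) (h h' : SectorSpace n) :
    inner ℂ (spinL M h) h' = inner ℂ h (spinL M.conjTranspose h') := by
  have e1 : inner ℂ (spinL M h) h'
      = ∫ z, (starRingEnd ℂ) (spinF M h z) * h' z ∂(sectorMeasure n) := by
    rw [inner_eq_integral]
    refine integral_congr_ae ?_
    filter_upwards [coeFn_spinL M h] with z hz
    rw [hz]
  have e2 : inner ℂ h (spinL M.conjTranspose h')
      = ∫ z, (starRingEnd ℂ) (h z) * spinF M.conjTranspose h' z ∂(sectorMeasure n) := by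
    rw [inner_eq_integral]
    refine integral_congr_ae ?_
    filter_upwards [coeFn_spinL M.conjTranspose h'] with z hz
    rw [hz]
  rw [e1, e2]
  refine integral_spin_congr ((memLp_spinF M (Lp.memLp h)).star.integrable_mul (Lp.memLp h'))
    ((Lp.memLp h).star.integrable_mul (memLp_spinF _ (Lp.memLp h'))) fun x k => ?_
  simp only [spinF, Fin.sum_univ_two, Matrix.conjTranspose_apply, map_add, map_mul,
    RCLike.star_def]
  ring

theorem spinL_insL {n : ℕ} (M : Matrix (Fin 2) (Fin 2) ℂ) {c : Photon → ℂ}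
    (hc : MemLp c 2 photonMeasure) (h : SectorSpace n) :
    spinL M (insL hc h) = insL hc (spinL M h) := by
  refine Lp.ext ?_
  filter_upwards [(coeFn_spinL M (insL hc h)).trans (spinF_congr M (coeFn_insL hc h)),
    (coeFn_insL hc (spinL M h)).trans (ins_congr c (coeFn_spinL M h))] with z h1 h2
  rw [h1, h2]
  simp only [spinF, ins, hd, tl, Fin.sum_univ_two]
  ring

theorem spinL_permL {n : ℕ} (M : Matrix (Fin 2) (Fin 2) ℂ) (τ : Equiv.Perm (Fin n))
    (h : SectorSpace n) : spinL M (permL τ h) = permL τ (spinL M h) := by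
  refine Lp.ext ?_
  filter_upwards [(coeFn_spinL M (permL τ h)).trans (spinF_congr M (coeFn_permL τ h)),
    coeFn_permL τ (spinL M h),
    (measurePreserving_perm n τ).quasiMeasurePreserving.ae (coeFn_spinL M h)] with z h1 h2 h3
  rw [h1, h2]
  exact h3.symm

theorem IsSym.spinL {n : ℕ} (M : Matrix (Fin 2) (Fin 2) ℂ) {h : SectorSpace n} (hs : IsSym h) :
    IsSym (spinL M h) := fun τ => by rw [← spinL_permL, hs]

theorem spinL_creL {n : ℕ} (M : Matrix (Fin 2) (Fin 2) ℂ) {c : Photon → ℂ}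
    (hc : MemLp c 2 photonMeasure) (h : SectorSpace n) :
    spinL M (creL hc h) = creL hc (spinL M h) := by
  simp only [creL_apply, map_smul, map_sum, spinL_permL, spinL_insL]

theorem spinL_annL {n : ℕ} (M : Matrix (Fin 2) (Fin 2) ℂ) {c : Photon → ℂ}
    (hc : MemLp c 2 photonMeasure) (h : SectorSpace (n + 1)) :
    spinL M (annL hc h) = annL hc (spinL M h) := by
  refine ext_inner_left ℂ fun u => ?_
  have h1 := inner_spinL M.conjTranspose u (annL hc h)
  rw [Matrix.conjTranspose_conjTranspose] at h1
  rw [← h1, ← inner_insL_eq, ← inner_insL_eq, ← spinL_insL, inner_spinL,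
    Matrix.conjTranspose_conjTranspose]

/-! ### The momentum in a sector -/

/-- `g = p_j h` in a sector. -/
def IsMom {n : ℕ} (j : Fin 3) (h g : SectorSpace n) : Prop :=
  ∀ᵐ y ∂(innerMeasure n), WeakMomentum j (fun x => h (x, y)) (fun x => g (x, y))

theorem Momentum.isMom {j : Fin 3} {Ψ Φ : State} (h : Momentum j Ψ Φ) (n : ℕ) :
    IsMom j ((Ψ : FullSpace) n) ((Φ : FullSpace) n) :=
  ae_weakMomentum (Lp.memLp _) (Lp.memLp _) (h n)

theorem memLp_section {n : ℕ} (h : SectorSpace n) :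
    ∀ᵐ y ∂(innerMeasure n), MemLp (fun x => h (x, y)) 2 :=
  MemLp.section_ae (Lp.memLp h)

theorem ae_section {n : ℕ} {p : Sector n → Prop} (h : ∀ᵐ z ∂(sectorMeasure n), p z) :
    ∀ᵐ y ∂(innerMeasure n), ∀ᵐ x : R3, p (x, y) := by
  have h2 : ∀ᵐ w ∂((innerMeasure n).prod (volume : Measure R3)), p w.swap :=
    (Measure.measurePreserving_swap (μ := innerMeasure n)
      (ν := (volume : Measure R3))).quasiMeasurePreserving.ae h
  exact Measure.ae_ae_of_ae_prod h2

theorem inner_eq_integral_sections {n : ℕ} (h g : SectorSpace n) :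
    inner ℂ h g = ∫ y, (∫ x : R3, (starRingEnd ℂ) (h (x, y)) * g (x, y)) ∂(innerMeasure n) := by
  rw [inner_eq_integral]
  exact integral_prod_symm _ ((Lp.memLp h).star.integrable_mul (Lp.memLp g))

/-- The momentum is symmetric. -/
theorem IsMom.inner_symm {n : ℕ} {j : Fin 3} {h g h' g' : SectorSpace n} (hm : IsMom j h g)
    (hm' : IsMom j h' g') : inner ℂ h' g = inner ℂ g' h := by
  rw [inner_eq_integral_sections, inner_eq_integral_sections]
  refine integral_congr_ae ?_
  filter_upwards [hm, hm', memLp_section h, memLp_section g, memLp_section h', memLp_section g']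
    with y h1 h2 h3 h4 h5 h6
  exact h1.integral_symm h2 h3 h4 h5 h6

theorem IsMom.inner_comm {n : ℕ} {j l : Fin 3} {h gj gl h' gj' gl' : SectorSpace n}
    (hj : IsMom j h gj) (hl : IsMom l h gl) (hj' : IsMom j h' gj') (hl' : IsMom l h' gl') :
    inner ℂ gj' gl = inner ℂ gl' gj := by
  rw [inner_eq_integral_sections, inner_eq_integral_sections]
  refine integral_congr_ae ?_
  filter_upwards [hj, hl, hj', hl', memLp_section h, memLp_section gj, memLp_section gl,
    memLp_section h', memLp_section gj', memLp_section gl']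
    with y h1 h2 h3 h4 h5 h6 h7 h8 h9 h10
  exact h1.integral_comm h2 h3 h4 h5 h6 h7 h8 h9 h10

/-- Inserting a photon transfers its momentum to the electron. -/
theorem IsMom.insL {n : ℕ} {j : Fin 3} {h g : SectorSpace n} (hm : IsMom j h g) {c : Photon → ℂ}
    (hc : MemLp c 2 photonMeasure) (hkc : MemLp (fun q => (q.1 j : ℂ) * c q) 2 photonMeasure) :
    IsMom j (insL hc h) (insL hc g - insL hkc h) := by
  have hq : Measure.QuasiMeasurePreserving
      (fun y : Inner (n + 1) => ((y.1, fun i => y.2 i.succ) : Inner n))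
      (innerMeasure (n + 1)) (innerMeasure n) := by
    have h1 := measurePreserving_piFinSuccAbove (fun _ : Fin (n + 1) => photonMeasure) 0
    have h2 := (MeasurePreserving.id (Measure.count : Measure (Fin 2))).prod h1
    have h3 := measurePreserving_leftComm (Measure.count : Measure (Fin 2)) photonMeasure
      (Measure.pi fun _ : Fin n => photonMeasure)
    exact Measure.quasiMeasurePreserving_snd.comp (h3.comp h2).quasiMeasurePreserving
  filter_upwards [hq.ae hm, hq.ae (memLp_section h), hq.ae (memLp_section g),
    ae_section (coeFn_insL hc h), ae_section (coeFn_insL hc g), ae_section (coeFn_insL hkc h),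
    ae_section (Lp.coeFn_sub (PauliFierz.insL hc g) (PauliFierz.insL hkc h))]
    with y h1 h2 h3 h4 h5 h6 h7
  refine ((h1.wave_mul h2 h3 (y.2 0).1).const_mul (c (y.2 0))).congr_ae ?_ ?_
  · filter_upwards [h4] with x hx
    rw [hx]
    simp only [ins, hd, tl]
    ring
  · filter_upwards [h5, h6, h7] with x h8 h9 h10
    rw [h10, Pi.sub_apply, h8, h9]
    simp only [ins, hd, tl]
    ring

theorem IsMom.spinL {n : ℕ} {j : Fin 3} {h g : SectorSpace n} (hm : IsMom j h g)
    (M : Matrix (Fin 2) (Fin 2) ℂ) : IsMom j (spinL M h) (spinL M g) := by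
  have hq : ∀ {p : Inner n → Prop}, (∀ᵐ y ∂(innerMeasure n), p y) →
      ∀ᵐ y ∂(innerMeasure n), ∀ t : Fin 2, p (t, y.2) := by
    intro p hp
    have h1 : ∀ᵐ y ∂(innerMeasure n), ∀ d : Fin 2, p (y.1 + d, y.2) :=
      ae_all_iff.2 fun d => ((measurePreserving_count_equiv (Equiv.addRight d)).prod
        (MeasurePreserving.id _)).quasiMeasurePreserving.ae hp
    filter_upwards [h1] with y hy t
    simpa using hy (t - y.1)
  filter_upwards [hq hm, hq (memLp_section h), hq (memLp_section g),
    ae_section (coeFn_spinL M h), ae_section (coeFn_spinL M g)] with y h1 h2 h3 h4 h5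
  have h6 := (((h1 0).const_mul (M y.1 0))).add ((h1 1).const_mul (M y.1 1))
    ((h2 0).const_mul _) ((h3 0).const_mul _) ((h2 1).const_mul _) ((h3 1).const_mul _)
  refine h6.congr_ae ?_ ?_
  · filter_upwards [h4] with x hx
    rw [hx]; simp [spinF, Fin.sum_univ_two]
  · filter_upwards [h5] with x hx
    rw [hx]; simp [spinF, Fin.sum_univ_two]

theorem IsMom.add {n : ℕ} {j : Fin 3} {h g h' g' : SectorSpace n} (hm : IsMom j h g)
    (hm' : IsMom j h' g') : IsMom j (h + h') (g + g') := by
  filter_upwards [hm, hm', memLp_section h, memLp_section g, memLp_section h', memLp_section g',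
    ae_section (Lp.coeFn_add h h'), ae_section (Lp.coeFn_add g g')]
    with y h1 h2 h3 h4 h5 h6 h7 h8
  refine (h1.add h2 h3 h4 h5 h6).congr_ae ?_ ?_
  · filter_upwards [h7] with x hx; rw [hx]; rfl
  · filter_upwards [h8] with x hx; rw [hx]; rfl

theorem IsMom.zero {n : ℕ} {j : Fin 3} : IsMom j (0 : SectorSpace n) 0 := by
  filter_upwards [ae_section (Lp.coeFn_zero ℂ 2 (sectorMeasure n))] with y h1 φ _ _
  have e : ∀ (u : R3 → ℂ), ∫ x, u x * (0 : SectorSpace n) (x, y) = 0 := by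
    intro u
    rw [integral_eq_zero_of_ae]
    filter_upwards [h1] with x hx
    rw [hx]; simp
  rw [e, e, mul_zero]

theorem IsMom.smul {n : ℕ} {j : Fin 3} {h g : SectorSpace n} (hm : IsMom j h g) (a : ℂ) :
    IsMom j (a • h) (a • g) := by
  filter_upwards [hm, ae_section (Lp.coeFn_smul a h), ae_section (Lp.coeFn_smul a g)]
    with y h1 h7 h8
  refine (h1.const_mul a).congr_ae ?_ ?_
  · filter_upwards [h7] with x hx; rw [hx]; rfl
  · filter_upwards [h8] with x hx; rw [hx]; rfl

/-- Commutation of the momentum with the annihilation operator. -/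
theorem IsMom.inner_annL {n : ℕ} {j : Fin 3} {h g : SectorSpace n} {Θ Θ' : SectorSpace (n + 1)}
    (hm : IsMom j h g) (hΘ : IsMom j Θ Θ') {c : Photon → ℂ} (hc : MemLp c 2 photonMeasure)
    (hkc : MemLp (fun q => (q.1 j : ℂ) * c q) 2 photonMeasure) :
    inner ℂ h (annL hc Θ') = inner ℂ g (annL hc Θ) - inner ℂ h (annL hkc Θ) := by
  rw [← inner_insL_eq, ← inner_insL_eq, ← inner_insL_eq, hΘ.inner_symm (hm.insL hc hkc),
    inner_sub_left]
  ring

/-! ### Integrals over photon wave vectors -/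

theorem integrable_photon_of_fst {F : R3 → ℝ} (hF : Integrable F) :
    Integrable (fun q : Photon => F q.1) photonMeasure :=
  hF.comp_fst (Measure.count : Measure (Fin 2))

theorem integral_photon_fst (F : R3 → ℝ) :
    ∫ q : Photon, F q.1 ∂photonMeasure = 2 * ∫ k : R3, F k := by
  have h := integral_fun_fst (μ := (volume : Measure R3)) (ν := (Measure.count : Measure (Fin 2))) F
  have h2 : (Measure.count : Measure (Fin 2)).real Set.univ = 2 := by
    simp [Measure.real, Measure.count_apply]
  rw [h2] at h
  exact h

/-- Functions which are odd in the wave vector have vanishing integral. -/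
theorem integral_photon_odd {F : Photon → ℂ} (h : ∀ k l, k ≠ 0 → F (-k, l) = -F (k, l)) :
    ∫ q, F q ∂photonMeasure = 0 := by
  have h1 : MeasurePreserving (fun q : Photon => ((-q.1, q.2) : Photon)) photonMeasure
      photonMeasure :=
    (Measure.measurePreserving_neg (volume : Measure R3)).prod (MeasurePreserving.id _)
  have h2 : MeasurableEmbedding (fun q : Photon => ((-q.1, q.2) : Photon)) :=
    ((MeasurableEquiv.neg R3).prodCongr (MeasurableEquiv.refl (Fin 2))).measurableEmbedding
  have h3 := h1.integral_comp h2 F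
  have h4 : ∀ᵐ q ∂photonMeasure, F (-q.1, q.2) = -F q := by
    have h5 : ∀ᵐ k : R3, k ≠ 0 := by simp [ae_iff]
    have h6 : ∀ᵐ q ∂photonMeasure, q.1 ≠ 0 :=
      (Measure.quasiMeasurePreserving_fst (μ := (volume : Measure R3))
        (ν := (Measure.count : Measure (Fin 2)))).ae h5
    filter_upwards [h6] with q hq
    exact h q.1 q.2 hq
  rw [integral_congr_ae h4, integral_neg] at h3
  exact self_eq_neg.1 h3.symm

theorem integral_radial {Λ : ℝ} (hΛ : 0 < Λ) {f φ : ℝ → ℝ} (hφ : ContinuousOn φ (Set.Icc 0 Λ))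
    (h : ∀ r, 0 < r → r ≤ Λ → r ^ 2 * f r = φ r) :
    Integrable (fun k : R3 => cutoff Λ k * f ‖k‖)
      ∧ ∫ k : R3, cutoff Λ k * f ‖k‖ = 4 * Real.pi * ∫ r in (0 : ℝ)..Λ, φ r := by
  set F : ℝ → ℝ := fun r => (if r ≤ Λ then 1 else 0) * f r with hF
  have e1 : (fun k : R3 => cutoff Λ k * f ‖k‖) = fun k : R3 => F ‖k‖ := by
    funext k; simp [hF, cutoff]
  have hd : Module.finrank ℝ R3 = 3 := by simp
  have e2 : Set.EqOn (fun r => r ^ (Module.finrank ℝ R3 - 1) • F r)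
      ((Set.Ioc 0 Λ).indicator φ) (Set.Ioi 0) := by
    intro r hr
    simp only [hd, hF]
    by_cases hr' : r ≤ Λ
    · rw [Set.indicator_of_mem (Set.mem_Ioc.2 ⟨hr, hr'⟩), if_pos hr', one_mul, smul_eq_mul]
      exact h r hr hr'
    · rw [Set.indicator_of_notMem (fun h' => hr' h'.2), if_neg hr']; simp
  have i1 : IntegrableOn φ (Set.Ioc 0 Λ) :=
    (hφ.integrableOn_compact isCompact_Icc).mono_set Set.Ioc_subset_Icc_self
  have hv : (volume : Measure R3).real (Metric.ball 0 1) = Real.pi * 4 / 3 := by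
    rw [Measure.real, EuclideanSpace.volume_ball_fin_three]
    simp only [ENNReal.ofReal_one, one_pow, one_mul]
    exact ENNReal.toReal_ofReal (by positivity)
  rw [e1]
  constructor
  · rw [integrable_fun_norm_addHaar, integrableOn_congr_fun e2 measurableSet_Ioi,
      integrableOn_indicator_iff measurableSet_Ioc]
    exact i1.mono_set Set.inter_subset_left
  · rw [integral_fun_norm_addHaar, setIntegral_congr_fun measurableSet_Ioi e2,
      setIntegral_indicator measurableSet_Ioc, hv, hd,
      Set.inter_eq_right.2 Set.Ioc_subset_Ioi_self, ← intervalIntegral.integral_of_le hΛ.le]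
    simp only [nsmul_eq_mul, smul_eq_mul]
    push_cast; ring

/-- The real `j`-th component of the coupling function of the vector potential. -/
def potCoeff (Λ : ℝ) (ε : Fin 2 → R3 → R3) (j : Fin 3) (q : Photon) : ℝ :=
  cutoff Λ q.1 / (2 * Real.pi * Real.sqrt ‖q.1‖) * ε q.2 q.1 j

/-- The `j`-th component of the coupling function of the magnetic field, without the factor `i`. -/
def magCoeff (Λ : ℝ) (ε : Fin 2 → R3 → R3) (j : Fin 3) (q : Photon) : ℝ :=
  cutoff Λ q.1 / (2 * Real.pi * Real.sqrt ‖q.1‖) *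
    crossProduct (WithLp.ofLp q.1) (WithLp.ofLp (ε q.2 q.1)) j

/-- The infrared weight `χ(|k|) / (4π²|k|²)`, which dominates all error terms. -/
def irWeight (Λ : ℝ) (q : Photon) : ℝ := cutoff Λ q.1 * (1 / (4 * Real.pi ^ 2) * (1 / ‖q.1‖ ^ 2))

/-- The energy denominator `1 / (|k| + |k|²)`. -/
def denom (q : Photon) : ℝ := 1 / (‖q.1‖ + ‖q.1‖ ^ 2)

theorem cutoff_sq (Λ : ℝ) (k : R3) : cutoff Λ k ^ 2 = cutoff Λ k := by
  unfold cutoff; split_ifs <;> norm_num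

theorem cutoff_nonneg (Λ : ℝ) (k : R3) : 0 ≤ cutoff Λ k := by
  unfold cutoff; split_ifs <;> norm_num

theorem cutoff_neg (Λ : ℝ) (k : R3) : cutoff Λ (-k) = cutoff Λ k := by
  unfold cutoff; rw [norm_neg]

theorem sum_potCoeff_sq {Λ : ℝ} {ε : Fin 2 → R3 → R3} (hε : IsPolarization ε) (q : Photon) :
    ∑ j, potCoeff Λ ε j q ^ 2 = cutoff Λ q.1 * (1 / (4 * Real.pi ^ 2) * (1 / ‖q.1‖)) := by
  rcases eq_or_ne q.1 0 with h0 | h0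
  · simp [potCoeff, h0]
  have h1 : ∑ j, (ε q.2 q.1 j) ^ 2 = 1 := by
    rw [← EuclideanSpace.real_norm_sq_eq, (hε.orthonormal q.1 h0).1 q.2, one_pow]
  have h2 : ∀ j, potCoeff Λ ε j q ^ 2
      = (cutoff Λ q.1 / (2 * Real.pi * Real.sqrt ‖q.1‖)) ^ 2 * (ε q.2 q.1 j) ^ 2 := fun j => by
    rw [potCoeff, mul_pow]
  simp only [h2]
  rw [← Finset.mul_sum, h1, div_pow, cutoff_sq, mul_pow, Real.sq_sqrt (norm_nonneg _)]
  have := norm_ne_zero_iff.2 h0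
  field_simp
  ring

theorem sum_magCoeff_sq {Λ : ℝ} {ε : Fin 2 → R3 → R3} (hε : IsPolarization ε) (q : Photon) :
    ∑ j, magCoeff Λ ε j q ^ 2 = cutoff Λ q.1 * (1 / (4 * Real.pi ^ 2) * ‖q.1‖) := by
  rcases eq_or_ne q.1 0 with h0 | h0
  · simp [magCoeff, h0]
  have h1 : ∑ j, (ε q.2 q.1 j) ^ 2 = 1 := by
    rw [← EuclideanSpace.real_norm_sq_eq, (hε.orthonormal q.1 h0).1 q.2, one_pow]
  have h3 : ∑ j, (q.1 j) ^ 2 = ‖q.1‖ ^ 2 := (EuclideanSpace.real_norm_sq_eq q.1).symm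
  have h4 : ∑ j, q.1 j * ε q.2 q.1 j = 0 := by
    have := hε.transverse q.2 q.1 h0
    rw [PiLp.inner_apply] at this
    simpa [mul_comm] using this
  have h5 : ∑ j, (crossProduct (WithLp.ofLp q.1) (WithLp.ofLp (ε q.2 q.1)) j) ^ 2
      = ‖q.1‖ ^ 2 := by
    rw [cross_apply]
    simp only [Fin.sum_univ_three, Matrix.cons_val] at h1 h3 h4 ⊢
    linear_combination h3 + (q.1 0 ^ 2 + q.1 1 ^ 2 + q.1 2 ^ 2) * h1
      - (q.1 0 * ε q.2 q.1 0 + q.1 1 * ε q.2 q.1 1 + q.1 2 * ε q.2 q.1 2) * h4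
  have h2 : ∀ j, magCoeff Λ ε j q ^ 2
      = (cutoff Λ q.1 / (2 * Real.pi * Real.sqrt ‖q.1‖)) ^ 2
        * (crossProduct (WithLp.ofLp q.1) (WithLp.ofLp (ε q.2 q.1)) j) ^ 2 := fun j => by
    rw [magCoeff, mul_pow]
  simp only [h2]
  rw [← Finset.mul_sum, h5, div_pow, cutoff_sq, mul_pow, Real.sq_sqrt (norm_nonneg _)]
  have := norm_ne_zero_iff.2 h0
  field_simp
  ring

/-- The vector potential is transversal. -/
theorem sum_mul_potCoeff {Λ : ℝ} {ε : Fin 2 → R3 → R3} (hε : IsPolarization ε) (q : Photon) :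
    ∑ j, q.1 j * potCoeff Λ ε j q = 0 := by
  rcases eq_or_ne q.1 0 with h0 | h0
  · simp [potCoeff, h0]
  have := hε.transverse q.2 q.1 h0
  rw [PiLp.inner_apply] at this
  have h4 : ∑ j, q.1 j * ε q.2 q.1 j = 0 := by simpa [mul_comm] using this
  calc ∑ j, q.1 j * potCoeff Λ ε j q
      = cutoff Λ q.1 / (2 * Real.pi * Real.sqrt ‖q.1‖) * ∑ j, q.1 j * ε q.2 q.1 j := by
        rw [Finset.mul_sum]
        exact Finset.sum_congr rfl fun j _ => by rw [potCoeff]; ring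
    _ = 0 := by rw [h4, mul_zero]

/-- The magnetic field is the curl of the vector potential. -/
theorem magCoeff_eq (Λ : ℝ) (ε : Fin 2 → R3 → R3) (q : Photon) :
    magCoeff Λ ε 0 q = q.1 1 * potCoeff Λ ε 2 q - q.1 2 * potCoeff Λ ε 1 q ∧
    magCoeff Λ ε 1 q = q.1 2 * potCoeff Λ ε 0 q - q.1 0 * potCoeff Λ ε 2 q ∧
    magCoeff Λ ε 2 q = q.1 0 * potCoeff Λ ε 1 q - q.1 1 * potCoeff Λ ε 0 q := by
  simp only [magCoeff, potCoeff, cross_apply, Matrix.cons_val]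
  refine ⟨?_, ?_, ?_⟩ <;> ring

theorem potCoeff_neg {Λ : ℝ} {ε : Fin 2 → R3 → R3} (hε : IsPolarization ε) (l : Fin 2) :
    ∃ s : ℝ, s ^ 2 = 1 ∧ ∀ k, k ≠ 0 → ∀ j, potCoeff Λ ε j (-k, l) = s * potCoeff Λ ε j (k, l) ∧
      magCoeff Λ ε j (-k, l) = -s * magCoeff Λ ε j (k, l) := by
  have key : ∀ s : ℝ, (∀ k, k ≠ 0 → ε l (-k) = s • ε l k) → ∀ k, k ≠ 0 → ∀ j,
      potCoeff Λ ε j (-k, l) = s * potCoeff Λ ε j (k, l) ∧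
      magCoeff Λ ε j (-k, l) = -s * magCoeff Λ ε j (k, l) := by
    intro s hs k hk j
    constructor
    · simp only [potCoeff, hs k hk, cutoff_neg, norm_neg, PiLp.smul_apply, smul_eq_mul]; ring
    · simp only [magCoeff, hs k hk, cutoff_neg, norm_neg, WithLp.ofLp_neg, WithLp.ofLp_smul,
        map_neg, map_smul, LinearMap.neg_apply, Pi.neg_apply, Pi.smul_apply, smul_eq_mul]; ring
  rcases hε.parity l with h | h
  · exact ⟨1, by norm_num, key 1 fun k hk => by rw [h k hk, one_smul]⟩
  · exact ⟨-1, by norm_num, key (-1) fun k hk => by rw [h k hk, neg_one_smul]⟩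

theorem measurable_cutoff (Λ : ℝ) : Measurable (cutoff Λ) :=
  Measurable.ite (measurableSet_le measurable_norm measurable_const) measurable_const
    measurable_const

theorem measurable_polarization {ε : Fin 2 → R3 → R3} (hε : IsPolarization ε) :
    Measurable (fun q : Photon => ε q.2 q.1) :=
  measurable_from_prod_countable_left fun l => hε.measurable l

theorem measurable_potCoeff {Λ : ℝ} {ε : Fin 2 → R3 → R3} (hε : IsPolarization ε) (j : Fin 3) :
    Measurable (potCoeff Λ ε j) := by
  have h1 := measurable_polarization hε
  have h2 : Measurable (fun q : Photon => ε q.2 q.1 j) :=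
    (EuclideanSpace.proj (𝕜 := ℝ) j).continuous.measurable.comp h1
  have h3 : Measurable (fun q : Photon => cutoff Λ q.1) := (measurable_cutoff Λ).comp measurable_fst
  exact (h3.div ((measurable_fst.norm.sqrt).const_mul _)).mul h2

theorem measurable_coord (j : Fin 3) : Measurable (fun q : Photon => q.1 j) :=
  (EuclideanSpace.proj (𝕜 := ℝ) j).continuous.measurable.comp measurable_fst

theorem measurable_magCoeff {Λ : ℝ} {ε : Fin 2 → R3 → R3} (hε : IsPolarization ε) (j : Fin 3) :
    Measurable (magCoeff Λ ε j) := by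
  have h := fun a b : Fin 3 => (measurable_coord a).mul (measurable_potCoeff (Λ := Λ) hε b)
  have e := fun q => magCoeff_eq Λ ε q
  fin_cases j
  · exact (funext fun q => (e q).1 : magCoeff Λ ε 0 = _) ▸ (h 1 2).sub (h 2 1)
  · exact (funext fun q => (e q).2.1 : magCoeff Λ ε 1 = _) ▸ (h 2 0).sub (h 0 2)
  · exact (funext fun q => (e q).2.2 : magCoeff Λ ε 2 = _) ▸ (h 0 1).sub (h 1 0)

theorem irWeight_nonneg (Λ : ℝ) (q : Photon) : 0 ≤ irWeight Λ q := by
  have := cutoff_nonneg Λ q.1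
  unfold irWeight; positivity

theorem measurable_denom : Measurable denom := by
  unfold denom
  exact measurable_const.div (measurable_fst.norm.add (measurable_fst.norm.pow_const 2))

theorem denom_nonneg (q : Photon) : 0 ≤ denom q := by unfold denom; positivity

theorem integrable_irWeight {Λ : ℝ} (hΛ : 0 < Λ) : Integrable (irWeight Λ) photonMeasure :=
  integrable_photon_of_fst (F := fun k => cutoff Λ k * (1 / (4 * Real.pi ^ 2) * (1 / ‖k‖ ^ 2)))
    (integral_radial hΛ (f := fun r => 1 / (4 * Real.pi ^ 2) * (1 / r ^ 2))
      (φ := fun _ => 1 / (4 * Real.pi ^ 2)) continuousOn_const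
      fun r hr _ => by field_simp).1

theorem integral_irWeight {Λ : ℝ} (hΛ : 0 < Λ) :
    ∫ q, irWeight Λ q ∂photonMeasure = 2 * Λ / Real.pi := by
  have h := (integral_radial hΛ (f := fun r => 1 / (4 * Real.pi ^ 2) * (1 / r ^ 2))
      (φ := fun _ => 1 / (4 * Real.pi ^ 2)) continuousOn_const
      fun r hr _ => by field_simp).2
  have h2 := integral_photon_fst fun k => cutoff Λ k * (1 / (4 * Real.pi ^ 2) * (1 / ‖k‖ ^ 2))
  rw [h] at h2
  refine h2.trans ?_
  have := Real.pi_pos.ne'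
  simp only [intervalIntegral.integral_const, sub_zero, smul_eq_mul]
  field_simp

/-- The vacuum expectation value of `A(x)²`. -/
theorem integral_sum_potCoeff_sq {Λ : ℝ} (hΛ : 0 < Λ) {ε : Fin 2 → R3 → R3}
    (hε : IsPolarization ε) : ∫ q, ∑ j, potCoeff Λ ε j q ^ 2 ∂photonMeasure = Λ ^ 2 / Real.pi := by
  simp only [sum_potCoeff_sq hε]
  have h := (integral_radial hΛ (f := fun r => 1 / (4 * Real.pi ^ 2) * (1 / r))
      (φ := fun r => 1 / (4 * Real.pi ^ 2) * r) (by fun_prop)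
      fun r hr _ => by field_simp).2
  have h2 := integral_photon_fst fun k => cutoff Λ k * (1 / (4 * Real.pi ^ 2) * (1 / ‖k‖))
  rw [h] at h2
  refine h2.trans ?_
  have := Real.pi_pos.ne'
  rw [intervalIntegral.integral_const_mul, integral_id]
  field_simp
  ring

/-- The second order contribution of `σ·B(x)` to the ground state energy, over `-α`. -/
def spinShiftEnergy (Λ : ℝ) : ℝ := 2 / Real.pi * (Λ ^ 2 / 2 - Λ + Real.log (1 + Λ))


theorem integral_denom_magCoeff {Λ : ℝ} (hΛ : 0 < Λ) {ε : Fin 2 → R3 → R3}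
    (hε : IsPolarization ε) :
    Integrable (fun q => denom q * ∑ j, magCoeff Λ ε j q ^ 2) photonMeasure ∧
    ∫ q, denom q * ∑ j, magCoeff Λ ε j q ^ 2 ∂photonMeasure = spinShiftEnergy Λ := by
  have e : ∀ q : Photon, denom q * ∑ j, magCoeff Λ ε j q ^ 2
      = cutoff Λ q.1 * (1 / (4 * Real.pi ^ 2) * (‖q.1‖ / (‖q.1‖ + ‖q.1‖ ^ 2))) := by
    intro q; rw [sum_magCoeff_sq hε, denom]; ring
  simp only [e]
  obtain ⟨h1, h⟩ := integral_radial hΛ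
      (f := fun r => 1 / (4 * Real.pi ^ 2) * (r / (r + r ^ 2)))
      (φ := fun r => 1 / (4 * Real.pi ^ 2) * (r ^ 2 / (1 + r)))
      (by
        refine ContinuousOn.mul continuousOn_const (ContinuousOn.div (by fun_prop) (by fun_prop) ?_)
        intro x hx; have := hx.1; positivity)
      fun r hr _ => by field_simp
  refine ⟨integrable_photon_of_fst h1, ?_⟩
  have h2 := integral_photon_fst fun k =>
    cutoff Λ k * (1 / (4 * Real.pi ^ 2) * (‖k‖ / (‖k‖ + ‖k‖ ^ 2)))
  rw [h] at h2
  refine h2.trans ?_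
  have h3 : ∫ r in (0 : ℝ)..Λ, r ^ 2 / (1 + r) = Λ ^ 2 / 2 - Λ + Real.log (1 + Λ) := by
    have h4 : ∀ r ∈ Set.uIcc 0 Λ, HasDerivAt (fun r : ℝ => r ^ 2 / 2 - r + Real.log (1 + r))
        (r ^ 2 / (1 + r)) r := by
      intro r hr
      rw [Set.uIcc_of_le hΛ.le] at hr
      have h5 : (1 + r) ≠ 0 := by have := hr.1; positivity
      have h6 := ((((hasDerivAt_id r).pow 2).div_const 2).sub (hasDerivAt_id r)).add
        (((hasDerivAt_id r).const_add 1).log h5)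
      refine h6.congr_deriv ?_
      simp only [id, Nat.cast_ofNat]
      field_simp
      ring
    rw [intervalIntegral.integral_eq_sub_of_hasDerivAt h4]
    · simp
    · refine ContinuousOn.intervalIntegrable ?_
      rw [Set.uIcc_of_le hΛ.le]
      refine ContinuousOn.div (by fun_prop) (by fun_prop) ?_
      intro x hx; have := hx.1; positivity
  have := Real.pi_pos.ne'
  rw [intervalIntegral.integral_const_mul, h3, spinShiftEnergy]
  field_simp

theorem cutoff_mul_le {Λ : ℝ} (k : R3) {a b : ℝ} (h : ‖k‖ ≤ Λ → a ≤ b) :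
    cutoff Λ k * a ≤ cutoff Λ k * b := by
  unfold cutoff
  split_ifs with h1
  · simpa using h h1
  · simp

theorem potCoeff_sq_le {Λ : ℝ} {ε : Fin 2 → R3 → R3} (hε : IsPolarization ε) (j : Fin 3)
    (q : Photon) : potCoeff Λ ε j q ^ 2 ≤ ‖q.1‖ * irWeight Λ q := by
  have h1 : potCoeff Λ ε j q ^ 2 ≤ ∑ j, potCoeff Λ ε j q ^ 2 :=
    Finset.single_le_sum (f := fun j => potCoeff Λ ε j q ^ 2) (fun _ _ => sq_nonneg _)
      (Finset.mem_univ j)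
  refine h1.trans (le_of_eq ?_)
  rw [sum_potCoeff_sq hε, irWeight]
  rcases eq_or_ne ‖q.1‖ 0 with h0 | h0
  · simp [h0]
  · field_simp

theorem sum_magCoeff_sq_eq {Λ : ℝ} {ε : Fin 2 → R3 → R3} (hε : IsPolarization ε) (q : Photon) :
    ∑ j, magCoeff Λ ε j q ^ 2 = ‖q.1‖ ^ 3 * irWeight Λ q := by
  rw [sum_magCoeff_sq hε, irWeight]
  rcases eq_or_ne ‖q.1‖ 0 with h0 | h0
  · simp [h0]
  · field_simp

theorem magCoeff_sq_le {Λ : ℝ} {ε : Fin 2 → R3 → R3} (hε : IsPolarization ε) (j : Fin 3)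
    (q : Photon) : magCoeff Λ ε j q ^ 2 ≤ ‖q.1‖ ^ 3 * irWeight Λ q := by
  have h1 : magCoeff Λ ε j q ^ 2 ≤ ∑ j, magCoeff Λ ε j q ^ 2 :=
    Finset.single_le_sum (f := fun j => magCoeff Λ ε j q ^ 2) (fun _ _ => sq_nonneg _)
      (Finset.mem_univ j)
  exact h1.trans (sum_magCoeff_sq_eq hε q).le

theorem norm_mul_irWeight_le {Λ : ℝ} (n : ℕ) (q : Photon) :
    ‖q.1‖ ^ n * irWeight Λ q ≤ Λ ^ n * irWeight Λ q := by
  have h : 0 ≤ 1 / (4 * Real.pi ^ 2) * (1 / ‖q.1‖ ^ 2) := by positivity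
  have := cutoff_mul_le q.1 (Λ := Λ)
    (a := ‖q.1‖ ^ n * (1 / (4 * Real.pi ^ 2) * (1 / ‖q.1‖ ^ 2)))
    (b := Λ ^ n * (1 / (4 * Real.pi ^ 2) * (1 / ‖q.1‖ ^ 2))) (fun h1 => by gcongr)
  unfold irWeight
  linarith

theorem memLp_of_sq_le {Λ : ℝ} (hΛ : 0 < Λ) {f : Photon → ℝ} (hf : Measurable f) (C : ℝ)
    (h : ∀ q, f q ^ 2 ≤ C * irWeight Λ q) : MemLp (fun q => (f q : ℂ)) 2 photonMeasure := by
  have hm : AEStronglyMeasurable (fun q => (f q : ℂ)) photonMeasure :=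
    (Complex.measurable_ofReal.comp hf).aestronglyMeasurable
  rw [memLp_two_iff_integrable_sq_norm hm]
  refine ((integrable_irWeight hΛ).const_mul C).mono' (hm.norm.pow 2) (ae_of_all _ fun q => ?_)
  rw [Complex.norm_real, Real.norm_eq_abs, Real.norm_eq_abs, abs_of_nonneg (by positivity), sq_abs]
  exact h q

theorem coord_sq_le (k : R3) (j : Fin 3) : k j ^ 2 ≤ ‖k‖ ^ 2 := by
  rw [EuclideanSpace.real_norm_sq_eq]
  exact Finset.single_le_sum (f := fun j => k j ^ 2) (fun _ _ => sq_nonneg _) (Finset.mem_univ j)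

theorem norm_mul_denom_le (q : Photon) : ‖q.1‖ * denom q ≤ 1 := by
  unfold denom
  rcases eq_or_lt_of_le (norm_nonneg q.1) with h0 | h0
  · rw [← h0]; simp
  · rw [mul_one_div, div_le_one (by positivity)]
    nlinarith

theorem norm_sq_mul_denom_le (q : Photon) : ‖q.1‖ ^ 2 * denom q ≤ 1 := by
  unfold denom
  rcases eq_or_lt_of_le (norm_nonneg q.1) with h0 | h0
  · rw [← h0]; simp
  · rw [mul_one_div, div_le_one (by positivity)]
    nlinarith

theorem magneticCoeff_eq (Λ : ℝ) (ε : Fin 2 → R3 → R3) (j : Fin 3) (q : Photon) :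
    magneticCoeff Λ ε j q = Complex.I * (magCoeff Λ ε j q : ℂ) := rfl

theorem memLp_potCoeff {Λ : ℝ} (hΛ : 0 < Λ) {ε : Fin 2 → R3 → R3} (hε : IsPolarization ε)
    (j : Fin 3) : MemLp (fun q => (potCoeff Λ ε j q : ℂ)) 2 photonMeasure :=
  memLp_of_sq_le hΛ (measurable_potCoeff hε j) Λ fun q => by
    have h := norm_mul_irWeight_le (Λ := Λ) 1 q
    rw [pow_one, pow_one] at h
    exact (potCoeff_sq_le hε j q).trans h

theorem memLp_coord_potCoeff {Λ : ℝ} (hΛ : 0 < Λ) {ε : Fin 2 → R3 → R3} (hε : IsPolarization ε)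
    (l j : Fin 3) : MemLp (fun q => (q.1 l : ℂ) * (potCoeff Λ ε j q : ℂ)) 2 photonMeasure := by
  have := memLp_of_sq_le hΛ ((measurable_coord l).mul (measurable_potCoeff (Λ := Λ) hε j)) (Λ ^ 3)
    fun q => by
      simp only [Pi.mul_apply, mul_pow]
      calc q.1 l ^ 2 * potCoeff Λ ε j q ^ 2 ≤ ‖q.1‖ ^ 2 * (‖q.1‖ * irWeight Λ q) :=
            mul_le_mul (coord_sq_le _ _) (potCoeff_sq_le hε j q) (sq_nonneg _) (by positivity)
        _ = ‖q.1‖ ^ 3 * irWeight Λ q := by ring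
        _ ≤ _ := norm_mul_irWeight_le (Λ := Λ) 3 q
  simpa using this

/-- Square integrability of the magnetic coupling function times a weight of size at most `C`. -/
theorem memLp_weight_magCoeff {Λ : ℝ} (hΛ : 0 < Λ) {ε : Fin 2 → R3 → R3} (hε : IsPolarization ε)
    (j : Fin 3) {w : Photon → ℝ} (hw : Measurable w) {C : ℝ}
    (h : ∀ q, w q ^ 2 * ‖q.1‖ ^ 2 ≤ C) :
    MemLp (fun q => ((w q * magCoeff Λ ε j q : ℝ) : ℂ)) 2 photonMeasure :=
  memLp_of_sq_le hΛ (hw.mul (measurable_magCoeff (Λ := Λ) hε j)) (C * Λ) fun q => by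
      have h0 := irWeight_nonneg Λ q
      have hC : 0 ≤ C := le_trans (by positivity) (h q)
      have h1 := norm_mul_irWeight_le (Λ := Λ) 1 q
      rw [pow_one, pow_one] at h1
      simp only [mul_pow]
      calc w q ^ 2 * magCoeff Λ ε j q ^ 2 ≤ w q ^ 2 * (‖q.1‖ ^ 3 * irWeight Λ q) :=
            mul_le_mul_of_nonneg_left (magCoeff_sq_le hε j q) (sq_nonneg _)
        _ = (w q ^ 2 * ‖q.1‖ ^ 2) * (‖q.1‖ * irWeight Λ q) := by ring
        _ ≤ C * (Λ * irWeight Λ q) := mul_le_mul (h q) h1 (by positivity) hC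
        _ = _ := by ring

theorem memLp_magCoeff {Λ : ℝ} (hΛ : 0 < Λ) {ε : Fin 2 → R3 → R3} (hε : IsPolarization ε)
    (j : Fin 3) : MemLp (fun q => (magCoeff Λ ε j q : ℂ)) 2 photonMeasure :=
  memLp_of_sq_le hΛ (measurable_magCoeff hε j) (Λ ^ 3) fun q =>
    (magCoeff_sq_le hε j q).trans (norm_mul_irWeight_le (Λ := Λ) 3 q)

/-- The square of the denominator, in the second order correction of the norm. -/
theorem denom_sq_mul_magCoeff_le {Λ : ℝ} {ε : Fin 2 → R3 → R3} (hε : IsPolarization ε)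
    (q : Photon) : denom q ^ 2 * (‖q.1‖ + 1) * ∑ j, magCoeff Λ ε j q ^ 2 ≤ irWeight Λ q := by
  rw [sum_magCoeff_sq_eq hε]
  have h0 := irWeight_nonneg Λ q
  have h1 := norm_mul_denom_le q
  have h2 := denom_nonneg q
  have h3 := norm_nonneg q.1
  have h4 : denom q * (‖q.1‖ + ‖q.1‖ ^ 2) ≤ 1 := by
    unfold denom
    rcases eq_or_lt_of_le h3 with h0 | h0
    · rw [← h0]; simp
    · rw [one_div, inv_mul_cancel₀ (by positivity)]
  have h5 : denom q ^ 2 * (‖q.1‖ + 1) * ‖q.1‖ ^ 3 ≤ 1 := by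
    have : denom q ^ 2 * (‖q.1‖ + 1) * ‖q.1‖ ^ 3
      = (denom q * (‖q.1‖ + ‖q.1‖ ^ 2)) * (‖q.1‖ ^ 2 * denom q) := by ring
    rw [this]
    exact mul_le_one₀ h4 (by positivity) (norm_sq_mul_denom_le q)
  calc _ = (denom q ^ 2 * (‖q.1‖ + 1) * ‖q.1‖ ^ 3) * irWeight Λ q := by ring
    _ ≤ 1 * irWeight Λ q := mul_le_mul_of_nonneg_right h5 h0
    _ = _ := one_mul _

/-- Radial averages of `A_j B_m` vanish. -/
theorem integral_potCoeff_mul_magCoeff (Λ : ℝ) {ε : Fin 2 → R3 → R3} (hε : IsPolarization ε)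
    (j m : Fin 3) (ρ : ℝ → ℝ) :
    ∫ q : Photon, ((ρ ‖q.1‖ * (potCoeff Λ ε j q * magCoeff Λ ε m q) : ℝ) : ℂ) ∂photonMeasure
      = 0 := by
  refine integral_photon_odd fun k l hk => ?_
  obtain ⟨s, hs, h⟩ := potCoeff_neg (Λ := Λ) hε l
  rw [(h k hk j).1, (h k hk m).2, norm_neg, ← Complex.ofReal_neg]
  congr 1
  linear_combination (-(ρ ‖k‖ * potCoeff Λ ε j (k, l) * magCoeff Λ ε m (k, l))) * hs

/-- Radial averages of `k_j |B|²` vanish. -/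
theorem integral_coord_mul_magCoeff_sq (Λ : ℝ) {ε : Fin 2 → R3 → R3} (hε : IsPolarization ε)
    (j : Fin 3) (ρ : ℝ → ℝ) :
    ∫ q : Photon, ((ρ ‖q.1‖ * (q.1 j * ∑ m, magCoeff Λ ε m q ^ 2) : ℝ) : ℂ) ∂photonMeasure
      = 0 := by
  refine integral_photon_odd fun k l hk => ?_
  simp only [sum_magCoeff_sq hε, norm_neg, cutoff_neg, PiLp.neg_apply]
  push_cast; ring

/-! ### States and their components -/

/-- The `n`-photon component of a state, as a vector. -/
def sec (Ψ : State) (n : ℕ) : SectorSpace n := (Ψ : FullSpace) n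

theorem isSym_sec (Ψ : State) (n : ℕ) : IsSym (sec Ψ n) := State.isSym Ψ n

/-- Of the two instances which provide this inner product, the one of the inner product space. -/
instance instInnerState : _root_.Inner ℂ State := InnerProductSpace.toInner

theorem state_inner_smul_right (Ψ Φ : State) (a : ℂ) :
    inner ℂ Ψ (a • Φ) = a * inner ℂ Ψ Φ := inner_smul_right Ψ Φ a

theorem state_inner_smul_left (Ψ Φ : State) (a : ℂ) :
    inner ℂ (a • Ψ) Φ = (starRingEnd ℂ) a * inner ℂ Ψ Φ := inner_smul_left Ψ Φ a

theorem state_inner_conj_symm (Ψ Φ : State) :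
    (starRingEnd ℂ) (inner ℂ Φ Ψ) = inner ℂ Ψ Φ := inner_conj_symm Ψ Φ

theorem hasSum_inner_sec (Ψ Φ : State) :
    HasSum (fun n => inner ℂ (sec Ψ n) (sec Φ n)) (inner ℂ Ψ Φ) :=
  lp.hasSum_inner (Ψ : FullSpace) (Φ : FullSpace)

theorem hasSum_re_inner_sec (Ψ Φ : State) :
    HasSum (fun n => (inner ℂ (sec Ψ n) (sec Φ n) : ℂ).re) (inner ℂ Ψ Φ : ℂ).re :=
  Complex.hasSum_re (hasSum_inner_sec Ψ Φ)

theorem inner_self_eq_ofReal {E : Type*} [NormedAddCommGroup E] [InnerProductSpace ℂ E] (v : E) :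
    (inner ℂ v v : ℂ) = ((‖v‖ ^ 2 : ℝ) : ℂ) := by
  rw [inner_self_eq_norm_sq_to_K]; simp

theorem state_inner_self (Ψ : State) : inner ℂ Ψ Ψ = ((‖Ψ‖ ^ 2 : ℝ) : ℂ) := inner_self_eq_ofReal Ψ

theorem hasSum_norm_sq_sec (Ψ : State) : HasSum (fun n => ‖sec Ψ n‖ ^ 2) (‖Ψ‖ ^ 2) := by
  have h := hasSum_re_inner_sec Ψ Ψ
  rw [state_inner_self, Complex.ofReal_re] at h
  simpa only [inner_self_eq_ofReal, Complex.ofReal_re] using h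

theorem Momentum.sec {j : Fin 3} {Ψ Φ : State} (h : Momentum j Ψ Φ) (n : ℕ) :
    IsMom j (sec Ψ n) (sec Φ n) := h.isMom n

/-- The annihilation operator between components of a state. -/
def annS {c : Photon → ℂ} (hc : MemLp c 2 photonMeasure) (Ψ : State) (n : ℕ) : SectorSpace n :=
  annL hc (sec Ψ (n + 1))

/-- The creation operator between components of a state. -/
def creS {c : Photon → ℂ} (hc : MemLp c 2 photonMeasure) (Ψ : State) : (n : ℕ) → SectorSpace n
  | 0 => 0
  | n + 1 => creL hc (sec Ψ n)

theorem coeFn_annS {c : Photon → ℂ} (hc : MemLp c 2 photonMeasure) (Ψ : State) (n : ℕ) :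
    annS hc Ψ n =ᵐ[sectorMeasure n]
      annihilate (fun x q => (starRingEnd ℂ) (c q) * wave q.1 x) Ψ n :=
  coeFn_annL hc (sec Ψ (n + 1))

theorem coeFn_creS {c : Photon → ℂ} (hc : MemLp c 2 photonMeasure) (Ψ : State) (n : ℕ) :
    creS hc Ψ n =ᵐ[sectorMeasure n] create (fun x q => c q * wave q.1 (-x)) Ψ n := by
  cases n with
  | zero => exact Lp.coeFn_zero ℂ 2 _
  | succ n => exact coeFn_creL hc (sec Ψ n)

/-- The coupling function which creates photons in `A_j(x)`. -/
def potC (Λ : ℝ) (ε : Fin 2 → R3 → R3) (j : Fin 3) (q : Photon) : ℂ := (potCoeff Λ ε j q : ℂ)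

/-- The coupling function which creates photons in `B_j(x)`. -/
def magC (Λ : ℝ) (ε : Fin 2 → R3 → R3) (j : Fin 3) (q : Photon) : ℂ :=
  -Complex.I * (magCoeff Λ ε j q : ℂ)

section Fields

variable {Λ : ℝ} {ε : Fin 2 → R3 → R3}

theorem memLp_potC (hΛ : 0 < Λ) (hε : IsPolarization ε) (j : Fin 3) :
    MemLp (potC Λ ε j) 2 photonMeasure := memLp_potCoeff hΛ hε j

theorem memLp_magC (hΛ : 0 < Λ) (hε : IsPolarization ε) (j : Fin 3) :
    MemLp (magC Λ ε j) 2 photonMeasure := (memLp_magCoeff hΛ hε j).const_mul _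

theorem vectorPotential_iff (hΛ : 0 < Λ) (hε : IsPolarization ε) (j : Fin 3) (Ψ Φ : State) :
    VectorPotential Λ ε j Ψ Φ ↔
      ∀ n, sec Φ n = annS (memLp_potC hΛ hε j) Ψ n + creS (memLp_potC hΛ hε j) Ψ n := by
  refine forall_congr' fun n => ?_
  have e : (annS (memLp_potC hΛ hε j) Ψ n + creS (memLp_potC hΛ hε j) Ψ n : SectorSpace n)
      =ᵐ[sectorMeasure n] potentialFun Λ ε j Ψ n := by
    filter_upwards [Lp.coeFn_add (annS (memLp_potC hΛ hε j) Ψ n) (creS (memLp_potC hΛ hε j) Ψ n),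
      coeFn_annS (memLp_potC hΛ hε j) Ψ n, coeFn_creS (memLp_potC hΛ hε j) Ψ n] with z h1 h2 h3
    rw [h1, Pi.add_apply, h2, h3]
    simp only [potC, Complex.conj_ofReal]
    rfl
  exact ⟨fun h => Lp.ext (h.trans e.symm), fun h => by rw [← h] at e; exact e⟩

/-- The part of `σ·B(x)` which annihilates photons. -/
def spinAnn (hΛ : 0 < Λ) (hε : IsPolarization ε) (Ψ : State) (n : ℕ) : SectorSpace n :=
  ∑ j, spinL (pauli j) (annS (memLp_magC hΛ hε j) Ψ n)

/-- The part of `σ·B(x)` which creates photons. -/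
def spinCre (hΛ : 0 < Λ) (hε : IsPolarization ε) (Ψ : State) (n : ℕ) : SectorSpace n :=
  ∑ j, spinL (pauli j) (creS (memLp_magC hΛ hε j) Ψ n)

theorem spinField_iff (hΛ : 0 < Λ) (hε : IsPolarization ε) (Ψ Φ : State) :
    SpinField Λ ε Ψ Φ ↔ ∀ n, sec Φ n = spinAnn hΛ hε Ψ n + spinCre hΛ hε Ψ n := by
  refine forall_congr' fun n => ?_
  have e1 : ∀ j, (annS (memLp_magC hΛ hε j) Ψ n + creS (memLp_magC hΛ hε j) Ψ n : SectorSpace n)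
      =ᵐ[sectorMeasure n] magneticFun Λ ε j Ψ n := by
    intro j
    filter_upwards [Lp.coeFn_add (annS (memLp_magC hΛ hε j) Ψ n) (creS (memLp_magC hΛ hε j) Ψ n),
      coeFn_annS (memLp_magC hΛ hε j) Ψ n, coeFn_creS (memLp_magC hΛ hε j) Ψ n] with z h1 h2 h3
    rw [h1, Pi.add_apply, h2, h3]
    have e2 : ∀ q, (starRingEnd ℂ) (magC Λ ε j q) = magneticCoeff Λ ε j q := fun q => by
      simp [magC, magneticCoeff_eq]
    have e3 : ∀ q x, magC Λ ε j q * wave q.1 (-x) = -(magneticCoeff Λ ε j q * wave q.1 (-x)) :=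
      fun q x => by rw [magC, magneticCoeff_eq]; ring
    simp only [e2, e3]
    rfl
  have e : (spinAnn hΛ hε Ψ n + spinCre hΛ hε Ψ n : SectorSpace n) =ᵐ[sectorMeasure n] fun z =>
      ∑ j : Fin 3, ∑ t : Fin 2, pauli j z.2.1 t * magneticFun Λ ε j Ψ n (z.1, t, z.2.2) := by
    have e4 : spinAnn hΛ hε Ψ n + spinCre hΛ hε Ψ n = ∑ j, spinL (pauli j)
        (annS (memLp_magC hΛ hε j) Ψ n + creS (memLp_magC hΛ hε j) Ψ n) := by
      simp only [spinAnn, spinCre, map_add, Finset.sum_add_distrib]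
    rw [e4]
    have e5 := fun j => (coeFn_spinL (pauli j) (annS (memLp_magC hΛ hε j) Ψ n
      + creS (memLp_magC hΛ hε j) Ψ n)).trans (spinF_congr (pauli j) (e1 j))
    filter_upwards [coeFn_sum Finset.univ fun j => spinL (pauli j)
        (annS (memLp_magC hΛ hε j) Ψ n + creS (memLp_magC hΛ hε j) Ψ n), ae_all_iff.2 e5]
      with z h1 h2
    rw [h1]
    exact Finset.sum_congr rfl fun j _ => h2 j
  exact ⟨fun h => Lp.ext (h.trans e.symm), fun h => by rw [← h] at e; exact e⟩

end Fields

/-! ### The field energy -/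

/-- `g` is the square root of the field energy applied to `h`. -/
def IsSqrtEnergy {n : ℕ} (h g : SectorSpace n) : Prop :=
  g =ᵐ[sectorMeasure n] fun z => (Real.sqrt (energy z.2.2) : ℂ) * h z

theorem SqrtFieldEnergy.sec {Ψ Φ : State} (h : SqrtFieldEnergy Ψ Φ) (n : ℕ) :
    IsSqrtEnergy (sec Ψ n) (sec Φ n) := h n

theorem energy_nonneg {n : ℕ} (k : Fin n → Photon) : 0 ≤ energy k :=
  Finset.sum_nonneg fun _ _ => norm_nonneg _

theorem measurable_norm_photon {n : ℕ} (i : Fin n) :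
    Measurable (fun z : Sector n => ‖(z.2.2 i).1‖) :=
  (measurable_fst.comp ((measurable_pi_apply i).comp (measurable_snd.comp measurable_snd))).norm

theorem measurable_energy {n : ℕ} : Measurable (fun z : Sector n => energy z.2.2) := by
  unfold energy
  exact Finset.measurable_sum _ fun i _ => measurable_norm_photon i

theorem energy_succ {n : ℕ} (z : Sector (n + 1)) :
    energy z.2.2 = ‖(hd z).1‖ + energy (tl z).2.2 := by
  simp [energy, Fin.sum_univ_succ, hd, tl]

theorem norm_hd_le_energy {n : ℕ} (z : Sector (n + 1)) : ‖(hd z).1‖ ≤ energy z.2.2 := by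
  rw [energy_succ]; linarith [energy_nonneg (tl z).2.2]

theorem norm_sq_eq_integral {n : ℕ} (h : SectorSpace n) :
    ‖h‖ ^ 2 = ∫ z, ‖h z‖ ^ 2 ∂(sectorMeasure n) := by
  have h1 := inner_eq_integral h h
  rw [inner_self_eq_ofReal] at h1
  have h2 : ∀ z, (starRingEnd ℂ) (h z) * h z = ((‖h z‖ ^ 2 : ℝ) : ℂ) := fun z => by
    rw [mul_comm, Complex.mul_conj, Complex.normSq_eq_norm_sq]
  simp only [h2, integral_complex_ofReal] at h1
  exact_mod_cast h1

theorem integrable_norm_sq {n : ℕ} (h : SectorSpace n) :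
    Integrable (fun z => ‖h z‖ ^ 2) (sectorMeasure n) :=
  (memLp_two_iff_integrable_sq_norm (Lp.memLp h).1).1 (Lp.memLp h)

theorem IsSqrtEnergy.norm_sq_ae {n : ℕ} {h g : SectorSpace n} (hg : IsSqrtEnergy h g) :
    (fun z => ‖g z‖ ^ 2) =ᵐ[sectorMeasure n] fun z => energy z.2.2 * ‖h z‖ ^ 2 := by
  filter_upwards [hg] with z hz
  rw [hz, norm_mul, mul_pow, Complex.norm_real, Real.norm_eq_abs, sq_abs,
    Real.sq_sqrt (energy_nonneg _)]

theorem IsSqrtEnergy.integrable {n : ℕ} {h g : SectorSpace n} (hg : IsSqrtEnergy h g) :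
    Integrable (fun z => energy z.2.2 * ‖h z‖ ^ 2) (sectorMeasure n) :=
  (integrable_norm_sq g).congr hg.norm_sq_ae

theorem IsSqrtEnergy.norm_sq {n : ℕ} {h g : SectorSpace n} (hg : IsSqrtEnergy h g) :
    ‖g‖ ^ 2 = ∫ z, energy z.2.2 * ‖h z‖ ^ 2 ∂(sectorMeasure n) := by
  rw [norm_sq_eq_integral]; exact integral_congr_ae hg.norm_sq_ae

theorem integral_comp_of_measurePreserving {α : Type*} [MeasurableSpace α] {μ : Measure α}
    {f : α → α} (hf : MeasurePreserving f μ μ) {F : α → ℝ} (hF : AEStronglyMeasurable F μ) :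
    ∫ z, F (f z) ∂μ = ∫ z, F z ∂μ := by
  rw [← hf.map_eq] at hF
  rw [← integral_map hf.measurable.aemeasurable hF, hf.map_eq]

/-- By symmetry, a weight of the first photon can be replaced by the same weight of any other. -/
theorem IsSym.integral_weight {n : ℕ} {h : SectorSpace (n + 1)} (hs : IsSym h)
    {ρ : ℝ → ℝ → ℝ} (hρ : Measurable (Function.uncurry ρ)) (i : Fin (n + 1)) :
    ∫ z, ρ ‖(z.2.2 i).1‖ (energy z.2.2) * ‖h z‖ ^ 2 ∂(sectorMeasure (n + 1))
      = ∫ z, ρ ‖(hd z).1‖ (energy z.2.2) * ‖h z‖ ^ 2 ∂(sectorMeasure (n + 1)) := by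
  set τ : Equiv.Perm (Fin (n + 1)) := Equiv.swap 0 i
  have hp := measurePreserving_perm (n + 1) τ
  have hm : AEStronglyMeasurable
      (fun z : Sector (n + 1) => ρ ‖(hd z).1‖ (energy z.2.2) * ‖h z‖ ^ 2)
      (sectorMeasure (n + 1)) := by
    refine AEStronglyMeasurable.mul ?_ ((Lp.memLp h).1.norm.pow 2)
    exact (hρ.comp ((measurable_fst.comp measurable_hd).norm.prodMk
      measurable_energy)).aestronglyMeasurable
  rw [← integral_comp_of_measurePreserving hp hm]
  refine integral_congr_ae ?_
  have h1 := coeFn_permL τ h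
  rw [hs τ] at h1
  filter_upwards [h1] with z hz
  have e1 : energy (z.2.2 ∘ τ) = energy z.2.2 := Equiv.sum_comp τ fun i => ‖(z.2.2 i).1‖
  have e2 : h (z.1, z.2.1, z.2.2 ∘ τ) = h z := hz.symm
  simp only [hd, Function.comp_apply, τ, Equiv.swap_apply_left] at *
  rw [e1, e2]

theorem integrable_weight {n : ℕ} {h : SectorSpace n} {w v : Sector n → ℝ} (hw : Measurable w)
    (h0 : ∀ z, 0 ≤ w z) (hle : ∀ z, w z ≤ v z)
    (hi : Integrable (fun z => v z * ‖h z‖ ^ 2) (sectorMeasure n)) :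
    Integrable (fun z => w z * ‖h z‖ ^ 2) (sectorMeasure n) := by
  refine hi.mono' (hw.aestronglyMeasurable.mul ((Lp.memLp h).1.norm.pow 2))
    (ae_of_all _ fun z => ?_)
  rw [Real.norm_eq_abs, abs_of_nonneg (mul_nonneg (h0 z) (sq_nonneg _))]
  exact mul_le_mul_of_nonneg_right (hle z) (sq_nonneg _)

/-- The energy of `n + 1` photons is `n + 1` times that of the first photon. -/
theorem IsSym.integral_energy {n : ℕ} {h g : SectorSpace (n + 1)} (hs : IsSym h)
    (hg : IsSqrtEnergy h g) :
    ((n : ℝ) + 1) * ∫ z, ‖(hd z).1‖ * ‖h z‖ ^ 2 ∂(sectorMeasure (n + 1)) = ‖g‖ ^ 2 := by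
  have hi : ∀ i : Fin (n + 1), Integrable (fun z => ‖(z.2.2 i).1‖ * ‖h z‖ ^ 2)
      (sectorMeasure (n + 1)) := fun i =>
    integrable_weight (measurable_norm_photon i) (fun _ => norm_nonneg _)
      (fun z => Finset.single_le_sum (f := fun i => ‖(z.2.2 i).1‖) (fun _ _ => norm_nonneg _)
        (Finset.mem_univ i)) hg.integrable
  rw [hg.norm_sq]
  simp only [energy, Finset.sum_mul]
  rw [integral_finsetSum _ fun i _ => hi i, Finset.sum_congr rfl fun i _ =>
    hs.integral_weight (ρ := fun a _ => a) measurable_fst i]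
  simp

/-- The photons share the momentum energy in proportion to their own energies. -/
theorem IsSym.integral_energy_ratio_le {n : ℕ} {h : SectorSpace (n + 1)} (hs : IsSym h) :
    ((n : ℝ) + 1) * ∫ z, ‖(hd z).1‖ / energy z.2.2 * ‖h z‖ ^ 2 ∂(sectorMeasure (n + 1))
      ≤ ‖h‖ ^ 2 := by
  have hle : ∀ (z : Sector (n + 1)) i, ‖(z.2.2 i).1‖ ≤ energy z.2.2 := fun z i =>
    Finset.single_le_sum (f := fun i => ‖(z.2.2 i).1‖) (fun _ _ => norm_nonneg _)
        (Finset.mem_univ i)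
  have hi : ∀ i : Fin (n + 1), Integrable (fun z => ‖(z.2.2 i).1‖ / energy z.2.2 * ‖h z‖ ^ 2)
      (sectorMeasure (n + 1)) := fun i =>
    integrable_weight (v := fun _ => 1) ((measurable_norm_photon i).div measurable_energy)
      (fun z => div_nonneg (norm_nonneg _) (energy_nonneg _))
      (fun z => div_le_one_of_le₀ (hle z i) (energy_nonneg _))
      (by simpa using integrable_norm_sq h)
  have e : ((n : ℝ) + 1) * ∫ z, ‖(hd z).1‖ / energy z.2.2 * ‖h z‖ ^ 2 ∂(sectorMeasure (n + 1))
      = ∫ z, ∑ i, ‖(z.2.2 i).1‖ / energy z.2.2 * ‖h z‖ ^ 2 ∂(sectorMeasure (n + 1)) := by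
    rw [integral_finsetSum _ fun i _ => hi i, Finset.sum_congr rfl fun i _ =>
      hs.integral_weight (ρ := fun a b => a / b) (measurable_fst.div measurable_snd) i]
    simp
  rw [e, norm_sq_eq_integral]
  refine integral_mono (integrable_finsetSum _ fun i _ => hi i) (integrable_norm_sq h) fun z => ?_
  simp only [← Finset.sum_mul, ← Finset.sum_div]
  exact mul_le_of_le_one_left (sq_nonneg _) (div_self_le_one _)

/-! ### Relative bounds -/

/-- The annihilation operator is bounded by the square root of the field energy. -/
theorem IsSym.norm_annL_sq_le {n : ℕ} {c c' : Photon → ℂ} (hc : MemLp c 2 photonMeasure)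
    (hc' : MemLp c' 2 photonMeasure) (hcc : ∀ q, c q = Real.sqrt ‖q.1‖ * c' q)
    {h g : SectorSpace (n + 1)} (hs : IsSym h) (hg : IsSqrtEnergy h g) :
    ‖annL hc h‖ ^ 2 ≤ (∫ q, ‖c' q‖ ^ 2 ∂photonMeasure) * ‖g‖ ^ 2 := by
  set f : Sector (n + 1) → ℂ := fun z => (Real.sqrt ‖(hd z).1‖ : ℂ) * h z
  have hm : AEStronglyMeasurable f (sectorMeasure (n + 1)) :=
    ((Complex.measurable_ofReal.comp
      (measurable_fst.comp measurable_hd).norm.sqrt).aestronglyMeasurable).mul (Lp.memLp h).1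
  have hf2 : ∀ z, ‖f z‖ ^ 2 = ‖(hd z).1‖ * ‖h z‖ ^ 2 := fun z => by
    rw [norm_mul, mul_pow, Complex.norm_real, Real.norm_eq_abs, sq_abs,
      Real.sq_sqrt (norm_nonneg _)]
  have hf : MemLp f 2 (sectorMeasure (n + 1)) := by
    rw [memLp_two_iff_integrable_sq_norm hm]
    simp only [hf2]
    exact integrable_weight (measurable_fst.comp measurable_hd).norm (fun _ => norm_nonneg _)
      norm_hd_le_energy hg.integrable
  have e1 : ((n : ℝ) + 1) * ‖hf.toLp f‖ ^ 2 = ‖g‖ ^ 2 := by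
    rw [← hs.integral_energy hg, norm_sq_eq_integral]
    congr 1
    refine integral_congr_ae ?_
    filter_upwards [hf.coeFn_toLp] with z hz
    rw [hz, hf2]
  have e2 : ∀ u : SectorSpace n, inner ℂ (insL hc u) h = inner ℂ (insL hc' u) (hf.toLp f) := by
    intro u
    rw [inner_eq_integral, inner_eq_integral]
    refine integral_congr_ae ?_
    filter_upwards [hf.coeFn_toLp, coeFn_insL hc u, coeFn_insL hc' u] with z h1 h2 h3
    rw [h1, h2, h3]
    simp only [ins, hcc, f, map_mul, Complex.conj_ofReal]
    ring
  set I := ∫ q, ‖c' q‖ ^ 2 ∂photonMeasure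
  have e3 : ∀ u : SectorSpace n, ‖insL hc' u‖ ^ 2 = I * ‖u‖ ^ 2 := by
    intro u
    have h1 := inner_insL_insL hc' hc' u u
    have h2 : ∀ q, (starRingEnd ℂ) (c' q) * c' q = ((‖c' q‖ ^ 2 : ℝ) : ℂ) := fun z => by
      rw [mul_comm, Complex.mul_conj, Complex.normSq_eq_norm_sq]
    simp only [h2, integral_complex_ofReal, inner_self_eq_ofReal] at h1
    exact_mod_cast h1
  -- the norm is tested against the vector itself
  set v := annL hc h
  have e4 : ‖v‖ ^ 2 ≤ Real.sqrt (n + 1) * (‖insL hc' v‖ * ‖hf.toLp f‖) := by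
    have h1 : (inner ℂ v v : ℂ) = (Real.sqrt (n + 1) : ℂ) * inner ℂ (insL hc' v) (hf.toLp f) := by
      rw [← e2]; exact (inner_insL_eq hc v h).symm
    have h2 : ‖v‖ ^ 2 = ‖(inner ℂ v v : ℂ)‖ := by
      rw [inner_self_eq_ofReal]; simp
    rw [h2, h1, norm_mul, Complex.norm_real, Real.norm_eq_abs, abs_of_nonneg (Real.sqrt_nonneg _)]
    exact mul_le_mul_of_nonneg_left (norm_inner_le_norm _ _) (Real.sqrt_nonneg _)
  have e5 : (‖v‖ ^ 2) ^ 2 ≤ I * ‖g‖ ^ 2 * ‖v‖ ^ 2 := by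
    calc (‖v‖ ^ 2) ^ 2 ≤ (Real.sqrt (n + 1) * (‖insL hc' v‖ * ‖hf.toLp f‖)) ^ 2 := by gcongr
      _ = (n + 1) * (‖insL hc' v‖ ^ 2 * ‖hf.toLp f‖ ^ 2) := by
          rw [mul_pow, mul_pow, Real.sq_sqrt (by positivity)]
      _ = I * ‖g‖ ^ 2 * ‖v‖ ^ 2 := by rw [e3, ← e1]; ring
  rcases eq_or_lt_of_le (sq_nonneg ‖v‖) with h0 | h0
  · rw [← h0]
    exact mul_nonneg (integral_nonneg fun _ => sq_nonneg _) (sq_nonneg _)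
  · rw [sq (‖v‖ ^ 2)] at e5
    exact le_of_mul_le_mul_right e5 h0

theorem isSym_creS {c : Photon → ℂ} (hc : MemLp c 2 photonMeasure) (Ψ : State) (n : ℕ) :
    IsSym (creS hc Ψ n) := by
  cases n with
  | zero => intro τ; exact map_zero _
  | succ n => exact isSym_creL hc (isSym_sec Ψ n)

/-- The canonical commutation relations. -/
theorem inner_creS_one {c c' : Photon → ℂ} (hc : MemLp c 2 photonMeasure)
    (hc' : MemLp c' 2 photonMeasure) (Ψ Φ : State) :
    inner ℂ (creS hc Ψ 1) (creS hc' Φ 1)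
      = (∫ q, (starRingEnd ℂ) (c q) * c' q ∂photonMeasure) * inner ℂ (sec Ψ 0) (sec Φ 0) :=
  inner_creL_creL_zero hc hc' _ _

theorem inner_creS_add_two {c c' : Photon → ℂ} (hc : MemLp c 2 photonMeasure)
    (hc' : MemLp c' 2 photonMeasure) (Ψ Φ : State) (n : ℕ) :
    inner ℂ (creS hc Ψ (n + 2)) (creS hc' Φ (n + 2))
      = (∫ q, (starRingEnd ℂ) (c q) * c' q ∂photonMeasure) * inner ℂ (sec Ψ (n + 1)) (sec Φ (n + 1))
        + inner ℂ (annS hc' Ψ n) (annS hc Φ n) :=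
  inner_creL_creL_succ hc hc' (isSym_sec Ψ (n + 1)) (isSym_sec Φ (n + 1))

/-! ### Operators on states -/

/-- The state with given symmetric components. -/
def mkState (f : ∀ n, SectorSpace n) (hs : ∀ n, IsSym (f n)) (hf : Summable fun n => ‖f n‖ ^ 2) :
    State :=
  ⟨⟨f, memℓp_gen (by simpa using hf)⟩, fun n τ => by
    have h := coeFn_permL τ (f n)
    rw [hs n τ] at h
    filter_upwards [h] with z hz
    exact hz.symm⟩

@[simp] theorem sec_mkState (f : ∀ n, SectorSpace n) (hs : ∀ n, IsSym (f n))
    (hf : Summable fun n => ‖f n‖ ^ 2) (n : ℕ) : sec (mkState f hs hf) n = f n := rfl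

theorem State.ext_sec {Ψ Φ : State} (h : ∀ n, sec Ψ n = sec Φ n) : Ψ = Φ :=
  Subtype.ext (lp.ext (funext h))

theorem sec_add (Ψ Φ : State) (n : ℕ) : sec (Ψ + Φ) n = sec Ψ n + sec Φ n := rfl

theorem sec_smul (a : ℂ) (Ψ : State) (n : ℕ) : sec (a • Ψ) n = a • sec Ψ n := rfl

theorem sec_zero (n : ℕ) : sec (0 : State) n = 0 := rfl

theorem sec_sum {ι : Type*} (s : Finset ι) (Ψ : ι → State) (n : ℕ) :
    sec (∑ i ∈ s, Ψ i) n = ∑ i ∈ s, sec (Ψ i) n := by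
  classical
  induction s using Finset.induction_on with
  | empty => simp [sec_zero]
  | insert a s ha ih => rw [Finset.sum_insert ha, Finset.sum_insert ha, sec_add, ih]

theorem pauli_conjTranspose (m : Fin 3) : (pauli m).conjTranspose = pauli m := by
  ext s t
  fin_cases m <;> fin_cases s <;> fin_cases t <;> simp [pauli]

theorem pauli_mul_self (m : Fin 3) : pauli m * pauli m = 1 := by
  ext s t
  fin_cases m <;> fin_cases s <;> fin_cases t <;> simp [pauli, Matrix.mul_apply]

theorem pauli_mul : pauli 0 * pauli 1 = Complex.I • pauli 2
    ∧ pauli 1 * pauli 0 = -Complex.I • pauli 2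
    ∧ pauli 1 * pauli 2 = Complex.I • pauli 0 ∧ pauli 2 * pauli 1 = -Complex.I • pauli 0
    ∧ pauli 2 * pauli 0 = Complex.I • pauli 1 ∧ pauli 0 * pauli 2 = -Complex.I • pauli 1 := by
  refine ⟨?_, ?_, ?_, ?_, ?_, ?_⟩ <;> ext s t <;> fin_cases s <;> fin_cases t <;>
    simp [pauli, Matrix.mul_apply]

theorem inner_spinL_pauli {n : ℕ} (m : Fin 3) (h h' : SectorSpace n) :
    inner ℂ (spinL (pauli m) h) h' = inner ℂ h (spinL (pauli m) h') := by
  rw [inner_spinL, pauli_conjTranspose]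

theorem norm_spinL_pauli {n : ℕ} (m : Fin 3) (h : SectorSpace n) :
    ‖spinL (pauli m) h‖ = ‖h‖ := by
  have e : inner ℂ (spinL (pauli m) h) (spinL (pauli m) h) = inner ℂ h h := by
    rw [inner_spinL_pauli, spinL_spinL, pauli_mul_self, spinL_one]
  rw [inner_self_eq_ofReal, inner_self_eq_ofReal] at e
  have e2 : ‖spinL (pauli m) h‖ ^ 2 = ‖h‖ ^ 2 := by exact_mod_cast e
  exact (sq_eq_sq₀ (norm_nonneg _) (norm_nonneg _)).1 e2

/-- The Pauli matrix `σ_m` as an operator on states. -/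
def sigma (m : Fin 3) : State →ₗ[ℂ] State where
  toFun Ψ := mkState (fun n => spinL (pauli m) (sec Ψ n)) (fun n => (isSym_sec Ψ n).spinL _)
    (by simpa only [norm_spinL_pauli] using (hasSum_norm_sq_sec Ψ).summable)
  map_add' Ψ Φ := State.ext_sec fun n => by simp [sec_add]
  map_smul' a Ψ := State.ext_sec fun n => by simp [sec_smul]

theorem sec_sigma (m : Fin 3) (Ψ : State) (n : ℕ) :
    sec (sigma m Ψ) n = spinL (pauli m) (sec Ψ n) := rfl

theorem sigma_smul (m : Fin 3) (a : ℂ) (Ψ : State) : sigma m (a • Ψ) = a • sigma m Ψ :=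
  (sigma m).map_smul a Ψ

theorem inner_sigma (m : Fin 3) (Ψ Φ : State) :
    inner ℂ (sigma m Ψ) Φ = inner ℂ Ψ (sigma m Φ) := by
  refine (hasSum_inner_sec (sigma m Ψ) Φ).unique ?_
  convert hasSum_inner_sec Ψ (sigma m Φ) using 2 with n
  exact inner_spinL_pauli m _ _

theorem sigma_mul_self (m : Fin 3) (Ψ : State) : sigma m (sigma m Ψ) = Ψ :=
  State.ext_sec fun n => by
    rw [sec_sigma, sec_sigma, spinL_spinL, pauli_mul_self, spinL_one]

theorem sigma_sigma {j l m : Fin 3} {a : ℂ} (h : pauli j * pauli l = a • pauli m) (Ψ : State) :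
    sigma j (sigma l Ψ) = a • sigma m Ψ :=
  State.ext_sec fun n => by
    rw [sec_smul, sec_sigma, sec_sigma, sec_sigma, spinL_spinL, h, spinL_matrix_smul]

/-- A weak momentum of each component is the momentum of the state. -/
theorem momentum_iff {j : Fin 3} {Ψ Φ : State} :
    Momentum j Ψ Φ ↔ ∀ n, IsMom j (sec Ψ n) (sec Φ n) :=
  ⟨fun h n => h.sec n, fun h n φ hφ hc => (h n).mono fun _ hy => hy φ hφ hc⟩

theorem Momentum.sigma {j : Fin 3} {Ψ Φ : State} (h : Momentum j Ψ Φ) (m : Fin 3) :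
    Momentum j (sigma m Ψ) (sigma m Φ) :=
  momentum_iff.2 fun n => (h.sec n).spinL _

theorem Momentum.inner_comm {j l : Fin 3} {Ψ Pj Pl Ψ' Pj' Pl' : State} (hj : Momentum j Ψ Pj)
    (hl : Momentum l Ψ Pl) (hj' : Momentum j Ψ' Pj') (hl' : Momentum l Ψ' Pl') :
    inner ℂ Pj' Pl = inner ℂ Pl' Pj := by
  refine (hasSum_inner_sec Pj' Pl).unique ?_
  convert hasSum_inner_sec Pl' Pj using 2 with n
  exact (hj.sec n).inner_comm (hl.sec n) (hj'.sec n) (hl'.sec n)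

/-- `D` is obtained from `Ψ` by annihilating a photon. -/
def IsAnn {c : Photon → ℂ} (hc : MemLp c 2 photonMeasure) (Ψ D : State) : Prop :=
  ∀ n, sec D n = annS hc Ψ n

/-- `C` is obtained from `Ψ` by creating a photon. -/
def IsCre {c : Photon → ℂ} (hc : MemLp c 2 photonMeasure) (Ψ C : State) : Prop :=
  ∀ n, sec C n = creS hc Ψ n

section AnnCre

variable {c c' : Photon → ℂ} {hc : MemLp c 2 photonMeasure} {hc' : MemLp c' 2 photonMeasure}

theorem isSym_annS (hc : MemLp c 2 photonMeasure) (Ψ : State) (n : ℕ) : IsSym (annS hc Ψ n) :=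
  isSym_annL hc (isSym_sec Ψ (n + 1))

theorem exists_isAnn (hc : MemLp c 2 photonMeasure) (hc' : MemLp c' 2 photonMeasure)
    (hcc : ∀ q, c q = Real.sqrt ‖q.1‖ * c' q) {Ψ F : State} (hF : SqrtFieldEnergy Ψ F) :
    ∃ D, IsAnn hc Ψ D ∧ ‖D‖ ^ 2 ≤ (∫ q, ‖c' q‖ ^ 2 ∂photonMeasure) * ‖F‖ ^ 2 := by
  set I := ∫ q, ‖c' q‖ ^ 2 ∂photonMeasure
  have hI : 0 ≤ I := integral_nonneg fun _ => sq_nonneg _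
  have h1 : ∀ n, ‖annS hc Ψ n‖ ^ 2 ≤ I * ‖sec F (n + 1)‖ ^ 2 := fun n =>
    (isSym_sec Ψ (n + 1)).norm_annL_sq_le hc hc' hcc (hF.sec (n + 1))
  have h2 := hasSum_norm_sq_sec F
  have h3 : Summable fun n => I * ‖sec F (n + 1)‖ ^ 2 :=
    ((summable_nat_add_iff 1).2 h2.summable).mul_left I
  have h4 : Summable fun n => ‖annS hc Ψ n‖ ^ 2 :=
    Summable.of_nonneg_of_le (fun _ => sq_nonneg _) h1 h3
  refine ⟨mkState (annS hc Ψ) (isSym_annS hc Ψ) h4, fun n => rfl, ?_⟩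
  rw [← (hasSum_norm_sq_sec _).tsum_eq]
  simp only [sec_mkState]
  refine (h4.tsum_le_tsum h1 h3).trans ?_
  rw [tsum_mul_left]
  refine mul_le_mul_of_nonneg_left ?_ hI
  rw [← h2.tsum_eq, h2.summable.tsum_eq_zero_add]
  have := sq_nonneg ‖sec F 0‖
  linarith

theorem hasSum_of_eq {f g : ℕ → ℂ} {a : ℂ} (h : ∀ n, f n = g n) (hg : HasSum g a) : HasSum f a :=
  (funext h : f = g) ▸ hg

theorem hasSum_succ_of_zero {f : ℕ → ℂ} {a : ℂ} (h : HasSum f a) (h0 : f 0 = 0) :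
    HasSum (fun n => f (n + 1)) a := by
  have := (hasSum_nat_add_iff' (f := f) 1).2 h
  simpa [h0] using this

theorem IsCre.sec_zero {Ψ C : State} (h : IsCre hc Ψ C) : sec C 0 = 0 := h 0

theorem IsCre.sec_succ {Ψ C : State} (h : IsCre hc Ψ C) (n : ℕ) :
    sec C (n + 1) = creL hc (sec Ψ n) := h (n + 1)

theorem exists_isCre (hc : MemLp c 2 photonMeasure) {Ψ D : State} (hD : IsAnn hc Ψ D) :
    ∃ C, IsCre hc Ψ C := by
  set I : ℂ := ∫ q, (starRingEnd ℂ) (c q) * c q ∂photonMeasure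
  have h1 : Summable fun n => I * inner ℂ (sec Ψ (n + 1)) (sec Ψ (n + 1))
      + inner ℂ (sec D n) (sec D n) :=
    (((summable_nat_add_iff 1).2 (hasSum_inner_sec Ψ Ψ).summable).mul_left I).add
      (hasSum_inner_sec D D).summable
  have h2 : ∀ n, I * inner ℂ (sec Ψ (n + 1)) (sec Ψ (n + 1)) + inner ℂ (sec D n) (sec D n)
      = ((‖creS hc Ψ (n + 2)‖ ^ 2 : ℝ) : ℂ) := by
    intro n
    rw [← inner_self_eq_ofReal, inner_creS_add_two, hD n]
  have h3 : Summable fun n => ‖creS hc Ψ (n + 2)‖ ^ 2 := by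
    have := Complex.hasSum_re h1.hasSum
    simp only [h2, Complex.ofReal_re] at this
    exact this.summable
  exact ⟨mkState (creS hc Ψ) (isSym_creS hc Ψ) ((summable_nat_add_iff 2).1 h3), fun n => rfl⟩

/-- Creation is adjoint to annihilation. -/
theorem IsCre.inner_left {Ψ C Φ D : State} (hC : IsCre hc Ψ C) (hD : IsAnn hc Φ D) :
    inner ℂ C Φ = inner ℂ Ψ D := by
  refine (hasSum_succ_of_zero (hasSum_inner_sec C Φ) ?_).unique ?_
  · rw [hC.sec_zero, inner_zero_left]
  · refine hasSum_of_eq (fun n => ?_) (hasSum_inner_sec Ψ D)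
    rw [hC.sec_succ, hD n]
    exact IsSym.inner_creL hc (sec Ψ n) (isSym_sec Φ (n + 1))

/-- The canonical commutation relations. -/
theorem IsCre.inner_isCre {Ψ C Φ C' D D' : State} (hC : IsCre hc Ψ C) (hC' : IsCre hc' Φ C')
    (hD' : IsAnn hc' Ψ D') (hD : IsAnn hc Φ D) :
    inner ℂ C C' = (∫ q, (starRingEnd ℂ) (c q) * c' q ∂photonMeasure) * inner ℂ Ψ Φ
      + inner ℂ D' D := by
  set I : ℂ := ∫ q, (starRingEnd ℂ) (c q) * c' q ∂photonMeasure
  have h1 := hasSum_succ_of_zero (hasSum_inner_sec C C') (by rw [hC.sec_zero, inner_zero_left])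
  have h2 := (hasSum_nat_add_iff' 1).2 h1
  have h3 := ((hasSum_nat_add_iff' 1).2 (hasSum_inner_sec Ψ Φ)).mul_left I
  have h4 := h2.unique (f := fun n => inner ℂ (sec C (n + 2)) (sec C' (n + 2))) (by
    refine hasSum_of_eq (fun n => ?_) (h3.add (hasSum_inner_sec D' D))
    rw [hC (n + 2), hC' (n + 2), hD' n, hD n]
    exact inner_creS_add_two hc hc' Ψ Φ n)
  have h5 : inner ℂ (sec C 1) (sec C' 1) = I * inner ℂ (sec Ψ 0) (sec Φ 0) := by
    rw [hC 1, hC' 1]; exact inner_creS_one hc hc' Ψ Φ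
  simp only [Finset.sum_range_one, h5] at h4
  linear_combination h4

theorem IsAnn.inner_isCre_comm {Ψ Φ C C' D D' : State} (hD : IsAnn hc Ψ D) (hC' : IsCre hc' Φ C')
    (hD' : IsAnn hc' Ψ D') (hC : IsCre hc Φ C) : inner ℂ C' D = inner ℂ C D' := by
  refine (hasSum_succ_of_zero (hasSum_inner_sec C' D)
    (by rw [hC'.sec_zero, inner_zero_left])).unique ?_
  refine hasSum_of_eq (fun n => ?_)
    (hasSum_succ_of_zero (hasSum_inner_sec C D') (by rw [hC.sec_zero, inner_zero_left]))
  have h := isSym_sec Ψ (n + 2)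
  rw [hC.sec_succ, hC'.sec_succ, hD (n + 1), hD' (n + 1), annS, annS,
    IsSym.inner_creL _ _ (isSym_annL _ h), IsSym.inner_creL _ _ (isSym_annL _ h), h.annL_comm]

/-- Commutation of the momentum with the fields. -/
theorem IsCre.inner_momentum {j : Fin 3} {hkc : MemLp (fun q => (q.1 j : ℂ) * c q) 2 photonMeasure}
    {Ψ P Φ P' C D Dk : State} (hC : IsCre hc Φ C) (hP : Momentum j Ψ P) (hP' : Momentum j Φ P')
    (hD : IsAnn hc Ψ D) (hDk : IsAnn hkc Ψ Dk) :
    inner ℂ C P = inner ℂ P' D - inner ℂ Φ Dk := by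
  refine (hasSum_succ_of_zero (hasSum_inner_sec C P)
    (by rw [hC.sec_zero, inner_zero_left])).unique ?_
  refine hasSum_of_eq (fun n => ?_) ((hasSum_inner_sec P' D).sub (hasSum_inner_sec Φ Dk))
  rw [hC.sec_succ, hD n, hDk n, IsSym.inner_creL _ _ (isSym_sec P (n + 1))]
  exact (hP'.sec n).inner_annL (hP.sec (n + 1)) hc hkc

theorem IsAnn.sigma {Ψ D : State} (hD : IsAnn hc Ψ D) (m : Fin 3) :
    IsAnn hc (sigma m Ψ) (sigma m D) := fun n => by
  rw [sec_sigma, hD n]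
  exact spinL_annL _ hc _

theorem IsCre.sigma {Ψ C : State} (hC : IsCre hc Ψ C) (m : Fin 3) :
    IsCre hc (sigma m Ψ) (sigma m C) := fun n => by
  rw [sec_sigma, hC n]
  cases n with
  | zero => exact map_zero _
  | succ n => exact spinL_creL _ hc _

theorem insL_eq_sum {ι : Type*} [Fintype ι] {n : ℕ} {c₀ : Photon → ℂ} {c : ι → Photon → ℂ}
    (hc₀ : MemLp c₀ 2 photonMeasure) (hc : ∀ i, MemLp (c i) 2 photonMeasure) (a : ι → ℂ)
    (h : ∀ q, c₀ q = ∑ i, a i * c i q) (f : SectorSpace n) :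
    insL hc₀ f = ∑ i, a i • insL (hc i) f := by
  refine Lp.ext ?_
  filter_upwards [coeFn_insL hc₀ f, coeFn_sum Finset.univ fun i => a i • insL (hc i) f,
    ae_all_iff.2 fun i => coeFn_insL (hc i) f, ae_all_iff.2 fun i =>
      Lp.coeFn_smul (a i) (insL (hc i) f)] with z h1 h2 h3 h4
  rw [h1, h2]
  simp only [h4, Pi.smul_apply, h3, ins, h, Finset.sum_mul, smul_eq_mul]
  exact Finset.sum_congr rfl fun i _ => by ring

theorem annL_eq_sum {ι : Type*} [Fintype ι] {n : ℕ} {c₀ : Photon → ℂ} {c : ι → Photon → ℂ}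
    (hc₀ : MemLp c₀ 2 photonMeasure) (hc : ∀ i, MemLp (c i) 2 photonMeasure) (a : ι → ℂ)
    (h : ∀ q, c₀ q = ∑ i, a i * c i q) (f : SectorSpace (n + 1)) :
    annL hc₀ f = ∑ i, (starRingEnd ℂ) (a i) • annL (hc i) f := by
  refine ext_inner_left ℂ fun u => ?_
  rw [← inner_insL_eq, insL_eq_sum hc₀ hc a h, sum_inner, inner_sum, Finset.mul_sum]
  refine Finset.sum_congr rfl fun i _ => ?_
  rw [inner_smul_left, inner_smul_right, ← inner_insL_eq]
  ring

theorem isAnn_sum {ι : Type*} [Fintype ι] {c₀ : Photon → ℂ} {c : ι → Photon → ℂ}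
    (hc₀ : MemLp c₀ 2 photonMeasure) {hc : ∀ i, MemLp (c i) 2 photonMeasure} (a : ι → ℂ)
    (h : ∀ q, c₀ q = ∑ i, a i * c i q) {Ψ : State} {D : ι → State}
    (hD : ∀ i, IsAnn (hc i) Ψ (D i)) :
    IsAnn hc₀ Ψ (∑ i, (starRingEnd ℂ) (a i) • D i) := fun n => by
  rw [sec_sum, annS, annL_eq_sum hc₀ hc a h]
  exact Finset.sum_congr rfl fun i _ => by rw [sec_smul, hD i n]; rfl

theorem IsAnn.unique {Ψ D D' : State} (h : IsAnn hc Ψ D) (h' : IsAnn hc Ψ D') : D = D' :=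
  State.ext_sec fun n => by rw [h n, h' n]

end AnnCre

/-! ### The quadratic form -/

section Form

variable {Λ : ℝ} {ε : Fin 2 → R3 → R3}

theorem exists_isAnn_of_sq_le (hΛ : 0 < Λ) {f : Photon → ℝ} (hf : Measurable f) {K : ℝ}
    (hK : ∀ q, f q ^ 2 ≤ K * (‖q.1‖ * irWeight Λ q)) {c : Photon → ℂ}
    (hc : MemLp c 2 photonMeasure) {a : ℂ} (hcf : ∀ q, c q = a * (f q : ℂ)) {Ψ F : State}
    (hF : SqrtFieldEnergy Ψ F) :
    ∃ D, IsAnn hc Ψ D ∧ ‖D‖ ^ 2 ≤ ‖a‖ ^ 2 * (K * (2 * Λ / Real.pi)) * ‖F‖ ^ 2 := by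
  set f' : Photon → ℝ := fun q => f q / Real.sqrt ‖q.1‖
  have hf' : Measurable f' := hf.div measurable_fst.norm.sqrt
  have h0 : ∀ q : Photon, f q = Real.sqrt ‖q.1‖ * f' q := by
    intro q
    rcases eq_or_ne ‖q.1‖ 0 with h | h
    · have := hK q
      rw [h, zero_mul, mul_zero] at this
      have h2 : f q = 0 := pow_eq_zero_iff two_ne_zero |>.1 (le_antisymm this (sq_nonneg _))
      simp [f', h, h2]
    · have : Real.sqrt ‖q.1‖ ≠ 0 := (Real.sqrt_ne_zero (norm_nonneg _)).2 h
      simp only [f']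
      field_simp
  have h1 : ∀ q : Photon, f' q ^ 2 ≤ K * irWeight Λ q := by
    intro q
    rcases eq_or_lt_of_le (norm_nonneg q.1) with h | h
    · simp [f', irWeight, ← h]
    · have h2 := hK q
      simp only [f', div_pow, Real.sq_sqrt (norm_nonneg q.1)]
      rw [div_le_iff₀ h]
      linarith
  have hm := memLp_of_sq_le hΛ hf' K h1
  obtain ⟨D, hD, hle⟩ := exists_isAnn hc (hm.const_mul a) (fun q => by
    rw [hcf, h0]; push_cast; ring) hF
  refine ⟨D, hD, hle.trans (mul_le_mul_of_nonneg_right ?_ (sq_nonneg _))⟩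
  have e : ∀ q, ‖a * (f' q : ℂ)‖ ^ 2 = ‖a‖ ^ 2 * f' q ^ 2 := fun q => by
    rw [norm_mul, mul_pow, Complex.norm_real, Real.norm_eq_abs, sq_abs]
  simp only [e]
  rw [integral_const_mul, ← integral_irWeight hΛ, ← integral_const_mul K]
  refine mul_le_mul_of_nonneg_left ?_ (sq_nonneg ‖a‖)
  refine integral_mono_of_nonneg (ae_of_all _ fun q => (sq_nonneg (f' q) : (0:ℝ) ≤ _))
    ((integrable_irWeight hΛ).const_mul K) (ae_of_all _ h1)

theorem norm_pow_three_mul_irWeight_le (q : Photon) :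
    ‖q.1‖ ^ 3 * irWeight Λ q ≤ Λ ^ 2 * (‖q.1‖ * irWeight Λ q) := by
  have := mul_le_mul_of_nonneg_left (norm_mul_irWeight_le (Λ := Λ) 2 q) (norm_nonneg q.1)
  linarith

/-- The states obtained from `Ψ` by the annihilation and creation parts of the fields. -/
structure FieldParts (hΛ : 0 < Λ) (hε : IsPolarization ε) (Ψ : State)
    (D C Db Cb : Fin 3 → State) (K : Fin 3 → Fin 3 → State) : Prop where
  annA : ∀ j, IsAnn (memLp_potC hΛ hε j) Ψ (D j)
  creA : ∀ j, IsCre (memLp_potC hΛ hε j) Ψ (C j)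
  annB : ∀ j, IsAnn (memLp_magC hΛ hε j) Ψ (Db j)
  creB : ∀ j, IsCre (memLp_magC hΛ hε j) Ψ (Cb j)
  annK : ∀ l j, IsAnn (c := fun q => (q.1 l : ℂ) * potC Λ ε j q) (memLp_coord_potCoeff hΛ hε l j)
    Ψ (K l j)

theorem exists_fieldParts (hΛ : 0 < Λ) (hε : IsPolarization ε) {Ψ F : State}
    (hF : SqrtFieldEnergy Ψ F) :
    ∃ D C Db Cb K, FieldParts hΛ hε Ψ D C Db Cb K ∧
      (∀ j, ‖D j‖ ^ 2 ≤ 2 * Λ / Real.pi * ‖F‖ ^ 2) ∧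
      (∀ j, ‖Db j‖ ^ 2 ≤ Λ ^ 2 * (2 * Λ / Real.pi) * ‖F‖ ^ 2) := by
  have h1 := fun j => exists_isAnn_of_sq_le hΛ (measurable_potCoeff (Λ := Λ) hε j) (K := 1)
    (fun q => by rw [one_mul]; exact potCoeff_sq_le hε j q) (memLp_potC hΛ hε j) (a := 1)
    (fun q => (one_mul _).symm) hF
  have h2 := fun j => exists_isAnn_of_sq_le hΛ (measurable_magCoeff (Λ := Λ) hε j) (K := Λ ^ 2)
    (fun q => (magCoeff_sq_le hε j q).trans (norm_pow_three_mul_irWeight_le q))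
    (memLp_magC hΛ hε j) (a := -Complex.I) (fun q => rfl) hF
  have h3 := fun l j => exists_isAnn_of_sq_le hΛ
    ((measurable_coord l).mul (measurable_potCoeff (Λ := Λ) hε j)) (K := Λ ^ 2)
    (fun q => by
      simp only [Pi.mul_apply, mul_pow]
      refine le_trans ?_ (norm_pow_three_mul_irWeight_le q)
      calc q.1 l ^ 2 * potCoeff Λ ε j q ^ 2 ≤ ‖q.1‖ ^ 2 * (‖q.1‖ * irWeight Λ q) :=
            mul_le_mul (coord_sq_le _ _) (potCoeff_sq_le hε j q) (sq_nonneg _) (by positivity)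
        _ = ‖q.1‖ ^ 3 * irWeight Λ q := by ring)
    (memLp_coord_potCoeff hΛ hε l j) (a := 1) (fun q => by simp) hF
  choose D hD hDle using h1
  choose Db hDb hDble using h2
  choose K hK _ using h3
  choose C hC using fun j => exists_isCre _ (hD j)
  choose Cb hCb using fun j => exists_isCre _ (hDb j)
  refine ⟨D, C, Db, Cb, K, ⟨hD, hC, hDb, hCb, hK⟩, fun j => ?_, fun j => ?_⟩
  · simpa using hDle j
  · simpa using hDble j

variable {hΛ : 0 < Λ} {hε : IsPolarization ε} {Ψ : State} {D C Db Cb : Fin 3 → State}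
  {K : Fin 3 → Fin 3 → State}

theorem FieldParts.potential_eq (h : FieldParts hΛ hε Ψ D C Db Cb K) {j : Fin 3} {A : State}
    (hA : VectorPotential Λ ε j Ψ A) : A = D j + C j :=
  State.ext_sec fun n => by
    rw [(vectorPotential_iff hΛ hε j Ψ A).1 hA n, sec_add, h.annA j n, h.creA j n]

theorem FieldParts.spin_eq (h : FieldParts hΛ hε Ψ D C Db Cb K) {S : State}
    (hS : SpinField Λ ε Ψ S) : S = ∑ m, sigma m (Db m + Cb m) :=
  State.ext_sec fun n => by
    rw [(spinField_iff hΛ hε Ψ S).1 hS n, sec_sum, spinAnn, spinCre, ← Finset.sum_add_distrib]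
    refine Finset.sum_congr rfl fun m _ => ?_
    rw [sec_sigma, sec_add, map_add, h.annB m n, h.creB m n]

theorem FieldParts.potential (h : FieldParts hΛ hε Ψ D C Db Cb K) (j : Fin 3) :
    VectorPotential Λ ε j Ψ (D j + C j) :=
  (vectorPotential_iff hΛ hε j Ψ _).2 fun n => by rw [sec_add, h.annA j n, h.creA j n]

theorem FieldParts.spin (h : FieldParts hΛ hε Ψ D C Db Cb K) :
    SpinField Λ ε Ψ (∑ m, sigma m (Db m + Cb m)) :=
  (spinField_iff hΛ hε Ψ _).2 fun n => by
    rw [sec_sum, spinAnn, spinCre, ← Finset.sum_add_distrib]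
    refine Finset.sum_congr rfl fun m _ => ?_
    rw [sec_sigma, sec_add, map_add, h.annB m n, h.creB m n]

theorem integral_conj_potC_mul (j l : Fin 3) :
    ∫ q, (starRingEnd ℂ) (potC Λ ε j q) * potC Λ ε l q ∂photonMeasure
      = ((∫ q, potCoeff Λ ε j q * potCoeff Λ ε l q ∂photonMeasure : ℝ) : ℂ) := by
  rw [← integral_complex_ofReal]
  simp [potC]

theorem FieldParts.norm_creA_sq (h : FieldParts hΛ hε Ψ D C Db Cb K) (j : Fin 3) :
    ‖C j‖ ^ 2 = (∫ q, potCoeff Λ ε j q ^ 2 ∂photonMeasure) * ‖Ψ‖ ^ 2 + ‖D j‖ ^ 2 := by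
  have h1 := (h.creA j).inner_isCre (h.creA j) (h.annA j) (h.annA j)
  rw [integral_conj_potC_mul, state_inner_self, state_inner_self,
    state_inner_self] at h1
  simp only [← sq] at h1
  exact_mod_cast h1

theorem FieldParts.sum_norm_creA_sq (h : FieldParts hΛ hε Ψ D C Db Cb K) :
    ∑ j, ‖C j‖ ^ 2 = Λ ^ 2 / Real.pi * ‖Ψ‖ ^ 2 + ∑ j, ‖D j‖ ^ 2 := by
  simp only [h.norm_creA_sq, Finset.sum_add_distrib, ← Finset.sum_mul]
  rw [← integral_sum_potCoeff_sq hΛ hε, integral_finsetSum]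
  intro j _
  have h1 := (memLp_two_iff_integrable_sq_norm (memLp_potC hΛ hε j).1).1 (memLp_potC hΛ hε j)
  simpa [potC] using h1

theorem FieldParts.norm_creB_sq (h : FieldParts hΛ hε Ψ D C Db Cb K) (j : Fin 3) :
    ‖Cb j‖ ^ 2 = (∫ q, magCoeff Λ ε j q ^ 2 ∂photonMeasure) * ‖Ψ‖ ^ 2 + ‖Db j‖ ^ 2 := by
  have h1 := (h.creB j).inner_isCre (h.creB j) (h.annB j) (h.annB j)
  have e : ∀ q, (starRingEnd ℂ) (magC Λ ε j q) * magC Λ ε j q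
      = ((magCoeff Λ ε j q ^ 2 : ℝ) : ℂ) := by
    intro q
    simp only [magC, map_mul, map_neg, Complex.conj_I, Complex.conj_ofReal]
    push_cast
    linear_combination -(magCoeff Λ ε j q : ℂ) ^ 2 * Complex.I_sq
  simp only [e, integral_complex_ofReal, state_inner_self] at h1
  exact_mod_cast h1

/-- The parts of `σ·B` creating and annihilating photons have conjugate expectations. -/
theorem FieldParts.inner_sigma_creB (h : FieldParts hΛ hε Ψ D C Db Cb K) (m : Fin 3) :
    inner ℂ Ψ (sigma m (Cb m)) = inner ℂ (Db m) (sigma m Ψ) := by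
  have h1 := (h.creB m).inner_left ((h.annB m).sigma m)
  rw [← state_inner_conj_symm, inner_sigma, h1, state_inner_conj_symm, inner_sigma]

/-- Transversality of the vector potential. -/
theorem FieldParts.sum_annK (h : FieldParts hΛ hε Ψ D C Db Cb K) : ∑ j, K j j = 0 := by
  have h1 := isAnn_sum (c₀ := fun _ => 0) (MemLp.zero') (fun _ : Fin 3 => 1) (fun q => by
    have := sum_mul_potCoeff (Λ := Λ) hε q
    have h2 : ((∑ j, q.1 j * potCoeff Λ ε j q : ℝ) : ℂ) = 0 := by rw [this]; simp
    simp only [one_mul]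
    rw [← h2]; push_cast; rfl) (fun j => h.annK j j)
  simp only [map_one, one_smul] at h1
  refine h1.unique (hc := MemLp.zero') fun n => ?_
  rw [sec_zero, annS, annL_eq_sum (ι := Fin 0) MemLp.zero' (c := fun _ => fun _ => 0)
    (fun _ => MemLp.zero') (fun _ => 0) (fun q => by simp)]
  simp

theorem FieldParts.sum_inner_momentum (h : FieldParts hΛ hε Ψ D C Db Cb K) {P : Fin 3 → State}
    (hP : ∀ j, Momentum j Ψ (P j)) : ∑ j, inner ℂ (C j) (P j) = ∑ j, inner ℂ (P j) (D j) := by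
  have h1 := fun j => (h.creA j).inner_momentum (hP j) (hP j) (h.annA j) (h.annK j j)
  have h2 : ∑ j, inner ℂ Ψ (K j j) = 0 := by
    rw [← inner_sum Finset.univ (fun j => K j j) Ψ, h.sum_annK, inner_zero_right]
  simp only [h1, Finset.sum_sub_distrib, h2, sub_zero]

/-- The value of the quadratic form. -/
def formValue (α : ℝ) (Ψ : State) (P A : Fin 3 → State) (S F : State) : ℝ :=
  ∑ j, ‖P j + (Real.sqrt α : ℂ) • A j‖ ^ 2 + Real.sqrt α * (inner ℂ Ψ S : ℂ).re + ‖F‖ ^ 2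

/-- Normal ordering of the quadratic form. -/
theorem FieldParts.formValue_eq (h : FieldParts hΛ hε Ψ D C Db Cb K) {α : ℝ} (hα : 0 < α)
    {P A : Fin 3 → State} {S F : State} (hf : InFormDomain Λ ε Ψ P A S F) :
    formValue α Ψ P A S F = ∑ j, ‖P j‖ ^ 2 + ‖F‖ ^ 2 + α * (Λ ^ 2 / Real.pi) * ‖Ψ‖ ^ 2
      + 2 * α * ∑ j, ‖D j‖ ^ 2 + 4 * Real.sqrt α * ∑ j, (inner ℂ (P j) (D j) : ℂ).re
      + 2 * α * ∑ j, (inner ℂ (C j) (D j) : ℂ).re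
      + 2 * Real.sqrt α * (inner ℂ Ψ (∑ m, sigma m (Db m)) : ℂ).re := by
  have hs : Real.sqrt α ^ 2 = α := Real.sq_sqrt hα.le
  unfold formValue
  set s := Real.sqrt α
  have e1 : ∀ j, ‖P j + (s : ℂ) • A j‖ ^ 2 = ‖P j‖ ^ 2
      + 2 * s * ((inner ℂ (P j) (D j) : ℂ).re + (inner ℂ (C j) (P j) : ℂ).re)
      + α * (‖D j‖ ^ 2 + ‖C j‖ ^ 2 + 2 * (inner ℂ (C j) (D j) : ℂ).re) := by
    intro j
    rw [h.potential_eq (hf.potential j), norm_add_sq (𝕜 := ℂ), state_inner_smul_right,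
      norm_smul, mul_pow,
      Complex.norm_real, Real.norm_eq_abs, sq_abs, hs, add_comm (D j) (C j),
      norm_add_sq (𝕜 := ℂ) (C j), inner_add_right]
    have : (inner ℂ (P j) (C j) : ℂ).re = (inner ℂ (C j) (P j) : ℂ).re := by
      rw [← state_inner_conj_symm, Complex.conj_re]
    simp only [RCLike.re_eq_complex_re, Complex.re_ofReal_mul, Complex.add_re, this]
    ring
  have e2 : (inner ℂ Ψ S : ℂ).re = 2 * (inner ℂ Ψ (∑ m, sigma m (Db m)) : ℂ).re := by
    rw [h.spin_eq hf.spin]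
    simp only [map_add, Finset.sum_add_distrib, inner_add_right, inner_sum, Complex.add_re,
      Complex.re_sum, h.inner_sigma_creB]
    have : ∀ m, (inner ℂ (Db m) (sigma m Ψ) : ℂ).re = (inner ℂ Ψ (sigma m (Db m)) : ℂ).re := by
      intro m
      rw [← inner_sigma, ← inner_conj_symm, Complex.conj_re]
    simp only [this]
    ring
  have e3 : ∑ j, (inner ℂ (C j) (P j) : ℂ).re = ∑ j, (inner ℂ (P j) (D j) : ℂ).re := by
    rw [← Complex.re_sum, ← Complex.re_sum, h.sum_inner_momentum hf.momentum]
  rw [e2]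
  simp only [e1, Finset.sum_add_distrib, ← Finset.mul_sum, e3, h.sum_norm_creA_sq]
  ring

/-- The commutator of two components of the kinetic momentum is the magnetic field. -/
theorem FieldParts.inner_commutator (h : FieldParts hΛ hε Ψ D C Db Cb K) {P : Fin 3 → State}
    (hP : ∀ j, Momentum j Ψ (P j)) {j l m : Fin 3} (s : ℝ)
    (hb : ∀ q : Photon, magCoeff Λ ε m q = q.1 j * potCoeff Λ ε l q - q.1 l * potCoeff Λ ε j q) :
    Complex.I * (inner ℂ (P j + (s : ℂ) • (D j + C j)) (sigma m (P l + (s : ℂ) • (D l + C l)))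
      - inner ℂ (P l + (s : ℂ) • (D l + C l)) (sigma m (P j + (s : ℂ) • (D j + C j))))
      = s * inner ℂ Ψ (sigma m (Db m + Cb m)) := by
  have hDb : Db m = Complex.I • K j l - Complex.I • K l j := by
    have h1 := isAnn_sum (ι := Fin 2) (memLp_magC hΛ hε m) ![-Complex.I, Complex.I]
      (c := ![fun q => (q.1 j : ℂ) * potC Λ ε l q, fun q => (q.1 l : ℂ) * potC Λ ε j q])
      (hc := fun i => by
        fin_cases i
        · exact memLp_coord_potCoeff hΛ hε j l
        · exact memLp_coord_potCoeff hΛ hε l j)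
      (fun q => by
        simp only [magC, potC, hb, Fin.sum_univ_two, Matrix.cons_val_zero, Matrix.cons_val_one]
        push_cast; ring)
      (Ψ := Ψ) (D := ![K j l, K l j]) (fun i => by
        fin_cases i
        · exact h.annK j l
        · exact h.annK l j)
    rw [(h.annB m).unique h1]
    simp [Fin.sum_univ_two, sub_eq_add_neg]
  have f1 : inner ℂ (P j) (sigma m (P l)) = inner ℂ (P l) (sigma m (P j)) :=
    ((hP j).sigma m).inner_comm ((hP l).sigma m) (hP j) (hP l)
  have f2 := (h.creA j).inner_isCre ((h.creA l).sigma m) (h.annA l) ((h.annA j).sigma m)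
  have f2' := (h.creA l).inner_isCre ((h.creA j).sigma m) (h.annA j) ((h.annA l).sigma m)
  rw [integral_conj_potC_mul] at f2 f2'
  have hI : ∫ q, potCoeff Λ ε l q * potCoeff Λ ε j q ∂photonMeasure
      = ∫ q, potCoeff Λ ε j q * potCoeff Λ ε l q ∂photonMeasure := by simp only [mul_comm]
  rw [hI] at f2'
  have f3 := ((h.annA j).sigma m).inner_isCre_comm (h.creA l) ((h.annA l).sigma m) (h.creA j)
  have f4 := (h.annA j).inner_isCre_comm ((h.creA l).sigma m) (h.annA l) ((h.creA j).sigma m)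
  have f5 := (h.creA l).inner_momentum ((hP j).sigma m) (hP j) ((h.annA l).sigma m)
    ((h.annK j l).sigma m)
  have f5' := (h.creA j).inner_momentum ((hP l).sigma m) (hP l) ((h.annA j).sigma m)
    ((h.annK l j).sigma m)
  have f6 := ((h.creA l).sigma m).inner_momentum (hP j) ((hP j).sigma m) (h.annA l) (h.annK j l)
  have f6' := ((h.creA j).sigma m).inner_momentum (hP l) ((hP l).sigma m) (h.annA j) (h.annK l j)
  have cs : ∀ X Y : State, inner ℂ (sigma m X) Y = (starRingEnd ℂ) (inner ℂ Y (sigma m X)) :=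
    fun X Y => (state_inner_conj_symm _ _).symm
  rw [cs, cs] at f4
  rw [cs, cs, cs, ← map_sub] at f6 f6'
  replace f4 := (starRingEnd ℂ).injective f4
  replace f6 := (starRingEnd ℂ).injective f6
  replace f6' := (starRingEnd ℂ).injective f6'
  rw [map_add (sigma m) (Db m), inner_add_right Ψ, h.inner_sigma_creB, hDb]
  simp only [map_add, map_sub, sigma_smul, inner_add_left, inner_add_right, inner_sub_left,
    inner_sub_right, state_inner_smul_left, state_inner_smul_right, Complex.conj_ofReal,
    Complex.conj_I]
  linear_combination Complex.I * f1 + Complex.I * (s : ℂ) ^ 2 * (f2 - f2' - f3 + f4)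
    + Complex.I * s * (f6 - f6' - f5 + f5')

/-- The form without the field energy is the square of `σ·(p + √α A)`. -/
theorem FieldParts.pauli_identity (h : FieldParts hΛ hε Ψ D C Db Cb K) {P : Fin 3 → State}
    (hP : ∀ j, Momentum j Ψ (P j)) (s : ℝ) :
    ((‖∑ j, sigma j (P j + (s : ℂ) • (D j + C j))‖ ^ 2 : ℝ) : ℂ)
      = ∑ j, ((‖P j + (s : ℂ) • (D j + C j)‖ ^ 2 : ℝ) : ℂ)
        + s * inner ℂ Ψ (∑ m, sigma m (Db m + Cb m)) := by
  have hm := magCoeff_eq Λ ε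
  have c2 := h.inner_commutator hP (j := 0) (l := 1) (m := 2) s fun q => (hm q).2.2
  have c0 := h.inner_commutator hP (j := 1) (l := 2) (m := 0) s fun q => (hm q).1
  have c1 := h.inner_commutator hP (j := 2) (l := 0) (m := 1) s fun q => (hm q).2.1
  obtain ⟨p01, p10, p12, p21, p20, p02⟩ := pauli_mul
  generalize hX : (fun j => P j + (s : ℂ) • (D j + C j)) = X
  have hX' : ∀ j, P j + (s : ℂ) • (D j + C j) = X j := fun j => by rw [← hX]
  simp only [hX'] at *
  simp only [← state_inner_self, Fin.sum_univ_three, inner_add_left, inner_add_right,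
    inner_sigma, sigma_mul_self, sigma_sigma p01, sigma_sigma p10, sigma_sigma p12,
    sigma_sigma p21, sigma_sigma p20, sigma_sigma p02, state_inner_smul_right]
  simp only [map_add, inner_add_right] at c0 c1 c2 ⊢
  linear_combination c0 + c1 + c2

theorem formValue_nonneg (hΛ : 0 < Λ) (hε : IsPolarization ε) {α : ℝ} {P A : Fin 3 → State}
    {S F : State} (hf : InFormDomain Λ ε Ψ P A S F) : 0 ≤ formValue α Ψ P A S F := by
  obtain ⟨D, C, Db, Cb, K, h, -, -⟩ := exists_fieldParts hΛ hε hf.energy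
  have h1 := congrArg Complex.re (h.pauli_identity hf.momentum (Real.sqrt α))
  rw [← Complex.ofReal_sum, Complex.add_re, Complex.ofReal_re, Complex.ofReal_re,
    Complex.re_ofReal_mul, ← h.spin_eq hf.spin] at h1
  simp only [← h.potential_eq (hf.potential _)] at h1
  rw [formValue, ← h1]
  positivity

theorem inner_spin_im (hΛ : 0 < Λ) (hε : IsPolarization ε) {P A : Fin 3 → State}
    {S F : State} (hf : InFormDomain Λ ε Ψ P A S F) : (inner ℂ Ψ S : ℂ).im = 0 := by
  obtain ⟨D, C, Db, Cb, K, h, -, -⟩ := exists_fieldParts hΛ hε hf.energy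
  have h1 := congrArg Complex.im (h.pauli_identity hf.momentum 1)
  rw [← Complex.ofReal_sum, Complex.add_im, Complex.ofReal_im, Complex.ofReal_im,
    Complex.im_ofReal_mul, ← h.spin_eq hf.spin] at h1
  linarith

/-- The fields are bounded relative to the square root of the field energy. -/
theorem exists_field_bound (hΛ : 0 < Λ) (hε : IsPolarization ε) :
    ∃ κ : ℝ, 0 < κ ∧ ∀ (Ψ : State) (P A : Fin 3 → State) (S F : State),
      InFormDomain Λ ε Ψ P A S F →
        (∀ j, ‖A j‖ ^ 2 ≤ κ * (‖F‖ ^ 2 + ‖Ψ‖ ^ 2)) ∧ ‖S‖ ^ 2 ≤ κ * (‖F‖ ^ 2 + ‖Ψ‖ ^ 2) := by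
  set a : ℝ := 2 * Λ / Real.pi
  set b : ℝ := Λ ^ 2 * (2 * Λ / Real.pi)
  set u : Fin 3 → ℝ := fun j => ∫ q, potCoeff Λ ε j q ^ 2 ∂photonMeasure
  set v : Fin 3 → ℝ := fun j => ∫ q, magCoeff Λ ε j q ^ 2 ∂photonMeasure
  have ha : 0 < a := by positivity
  have hb : 0 < b := by positivity
  have hu : ∀ j, 0 ≤ u j := fun j => integral_nonneg fun _ => sq_nonneg _
  have hv : ∀ j, 0 ≤ v j := fun j => integral_nonneg fun _ => sq_nonneg _
  refine ⟨4 * a + 2 * ∑ j, u j + 36 * b + 6 * ∑ j, v j, by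
    have := Finset.sum_nonneg fun j (_ : j ∈ Finset.univ) => hu j
    have := Finset.sum_nonneg fun j (_ : j ∈ Finset.univ) => hv j
    positivity, fun Ψ P A S F hf => ?_⟩
  obtain ⟨D, C, Db, Cb, K, h, hD, hDb⟩ := exists_fieldParts hΛ hε hf.energy
  have hF := sq_nonneg ‖F‖
  have hΨ := sq_nonneg ‖Ψ‖
  have key : ∀ X Y : State, ‖X + Y‖ ^ 2 ≤ 2 * ‖X‖ ^ 2 + 2 * ‖Y‖ ^ 2 := fun X Y => by
    have := norm_add_le X Y
    nlinarith [norm_nonneg (X + Y), sq_nonneg (‖X‖ - ‖Y‖)]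
  have su : ∀ j, u j ≤ ∑ j, u j := fun j =>
    Finset.single_le_sum (fun j _ => hu j) (Finset.mem_univ j)
  have hU : 0 ≤ ∑ j, u j := Finset.sum_nonneg fun j _ => hu j
  have hV : 0 ≤ ∑ j, v j := Finset.sum_nonneg fun j _ => hv j
  constructor
  · intro j
    rw [h.potential_eq (hf.potential j)]
    have h1 := key (D j) (C j)
    rw [h.norm_creA_sq j] at h1
    have h2 := hD j
    have h3 := mul_le_mul_of_nonneg_right (su j) hΨ
    have h4 := mul_nonneg hU hF
    have h5 := mul_nonneg hV hF
    have h6 := mul_nonneg hV hΨ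
    have h7 := mul_nonneg hb.le hF
    have h8 := mul_nonneg hb.le hΨ
    have h9 := mul_nonneg ha.le hΨ
    simp only [u, a] at *
    linarith
  · rw [h.spin_eq hf.spin]
    have hσ : ∀ m X, ‖sigma m X‖ = ‖X‖ := fun m X => by
      have e : inner ℂ (sigma m X) (sigma m X) = inner ℂ X X := by
        rw [inner_sigma, sigma_mul_self]
      rw [state_inner_self, state_inner_self] at e
      have e2 : ‖sigma m X‖ ^ 2 = ‖X‖ ^ 2 := by exact_mod_cast e
      exact (sq_eq_sq₀ (norm_nonneg _) (norm_nonneg _)).1 e2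
    have h1 : ‖∑ m, sigma m (Db m + Cb m)‖ ^ 2 ≤ 3 * ∑ m, ‖Db m + Cb m‖ ^ 2 := by
      have h2 : ‖∑ m, sigma m (Db m + Cb m)‖ ≤ ∑ m, ‖Db m + Cb m‖ := by
        refine (norm_sum_le _ _).trans (le_of_eq ?_)
        simp only [hσ]
      calc _ ≤ (∑ m, ‖Db m + Cb m‖) ^ 2 := by gcongr
        _ ≤ _ := by
          have := sq_sum_le_card_mul_sum_sq (s := Finset.univ) (f := fun m => ‖Db m + Cb m‖)
          simpa using this
    have h3 : ∀ m, ‖Db m + Cb m‖ ^ 2 ≤ 4 * b * ‖F‖ ^ 2 + 2 * (v m * ‖Ψ‖ ^ 2) := fun m => by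
      have h4 := key (Db m) (Cb m)
      rw [h.norm_creB_sq m] at h4
      have h5 := hDb m
      simp only [v, b] at *
      linarith
    have h6 := Finset.sum_le_sum fun m (_ : m ∈ Finset.univ) => h3 m
    rw [Finset.sum_add_distrib, Finset.sum_const, ← Finset.mul_sum, ← Finset.sum_mul,
      Finset.card_univ, Fintype.card_fin, nsmul_eq_mul] at h6
    have g1 := mul_nonneg hU hF
    have g2 := mul_nonneg hU hΨ
    have g3 := mul_nonneg hV hF
    have g4 := mul_nonneg hb.le hΨ
    have g5 := mul_nonneg ha.le hF
    have g6 := mul_nonneg ha.le hΨ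
    push_cast at h6
    linarith

end Form

/-! ### Insertion of a photon by the magnetic field -/

section MagneticInsertion

variable {Λ : ℝ} {ε : Fin 2 → R3 → R3}

/-- The coupling functions of the magnetic field, multiplied by `w`, are square integrable. -/
def IsWeight (Λ : ℝ) (ε : Fin 2 → R3 → R3) (w : Photon → ℝ) : Prop :=
  ∀ m, MemLp (fun q => (w q : ℂ) * magC Λ ε m q) 2 photonMeasure

theorem isWeight_of_mul_sq_le (hΛ : 0 < Λ) (hε : IsPolarization ε) {w : Photon → ℝ}
    (hw : Measurable w) {C : ℝ} (h : ∀ q : Photon, w q ^ 2 * ‖q.1‖ ^ 2 ≤ C) : IsWeight Λ ε w := by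
  intro m
  have h1 := (memLp_weight_magCoeff hΛ hε m hw h).const_mul (-Complex.I)
  refine h1.congr_norm ?_ (ae_of_all _ fun q => ?_)
  · exact ((Complex.measurable_ofReal.comp hw).mul ((Complex.measurable_ofReal.comp
      (measurable_magCoeff hε m)).const_mul _)).aestronglyMeasurable
  · simp only [magC]; congr 1; push_cast; ring

theorem isWeight_of_sq_le (hΛ : 0 < Λ) (hε : IsPolarization ε) {w : Photon → ℝ}
    (hw : Measurable w) {C : ℝ} (h : ∀ q : Photon, |w q| ≤ C) : IsWeight Λ ε w := by
  intro m
  refine (memLp_magC hΛ hε m).of_le_mul (c := C) ?_ (ae_of_all _ fun q => ?_)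
  · exact ((Complex.measurable_ofReal.comp hw).mul ((Complex.measurable_ofReal.comp
      (measurable_magCoeff hε m)).const_mul _)).aestronglyMeasurable
  · rw [norm_mul, Complex.norm_real]
    exact mul_le_mul_of_nonneg_right (h q) (norm_nonneg _)

/-- The wave function of `n + 1` photons arising from `h` when the magnetic field inserts the
first photon. -/
def magF (Λ : ℝ) (ε : Fin 2 → R3 → R3) {n : ℕ} (h : Sector n → ℂ) : Sector (n + 1) → ℂ :=
  fun z => ∑ m, spinF (pauli m) (ins (magC Λ ε m) h) z

/-- The insertion of a photon by the magnetic field, with a weight in the new photon. -/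
def magL {n : ℕ} {w : Photon → ℝ} (hw : IsWeight Λ ε w) (h : SectorSpace n) :
    SectorSpace (n + 1) :=
  ∑ m, spinL (pauli m) (insL (hw m) h)

theorem coeFn_magL {n : ℕ} {w : Photon → ℝ} (hw : IsWeight Λ ε w) (h : SectorSpace n) :
    magL hw h =ᵐ[sectorMeasure (n + 1)] fun z => (w (hd z) : ℂ) * magF Λ ε h z := by
  have e5 := fun m => (coeFn_spinL (pauli m) (insL (hw m) h)).trans
    (spinF_congr (pauli m) (coeFn_insL (hw m) h))
  filter_upwards [coeFn_sum Finset.univ fun m => spinL (pauli m) (insL (hw m) h), ae_all_iff.2 e5]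
    with z h1 h2
  rw [magL, h1, magF, Finset.mul_sum]
  refine Finset.sum_congr rfl fun m _ => ?_
  rw [h2 m]
  simp only [spinF, ins, Finset.mul_sum]
  exact Finset.sum_congr rfl fun t _ => by simp only [hd, tl]; ring

theorem magF_congr {n : ℕ} {h h' : Sector n → ℂ} (e : h =ᵐ[sectorMeasure n] h') :
    magF Λ ε h =ᵐ[sectorMeasure (n + 1)] magF Λ ε h' := by
  filter_upwards [ae_all_iff.2 fun m => spinF_congr (pauli m) (ins_congr (magC Λ ε m) e)] with z hz
  simp only [magF, hz]

theorem magF_energy {n : ℕ} (h : Sector n → ℂ) (z : Sector (n + 1)) :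
    magF Λ ε (fun z => (Real.sqrt (energy z.2.2) : ℂ) * h z) z
      = (Real.sqrt (energy (tl z).2.2) : ℂ) * magF Λ ε h z := by
  simp only [magF, spinF, ins, tl, Finset.mul_sum]
  exact Finset.sum_congr rfl fun m _ => Finset.sum_congr rfl fun t _ => by ring

/-- The Pauli matrices turn the three components of the coupling function into its length. -/
theorem inner_magL_magL {n : ℕ} {w w' : Photon → ℝ} (hw : IsWeight Λ ε w) (hw' : IsWeight Λ ε w')
    (h h' : SectorSpace n) :
    inner ℂ (magL hw h) (magL hw' h')
      = ((∫ q, w q * w' q * ∑ m, magCoeff Λ ε m q ^ 2 ∂photonMeasure : ℝ) : ℂ) * inner ℂ h h' := by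
  set J : Fin 3 → Fin 3 → ℝ := fun m l =>
    ∫ q, w q * w' q * (magCoeff Λ ε m q * magCoeff Λ ε l q) ∂photonMeasure
  have hIc : ∀ m l q, (starRingEnd ℂ) ((w q : ℂ) * magC Λ ε m q) * ((w' q : ℂ) * magC Λ ε l q)
      = ((w q * w' q * (magCoeff Λ ε m q * magCoeff Λ ε l q) : ℝ) : ℂ) := by
    intro m l q
    simp only [magC, map_mul, map_neg, Complex.conj_I, Complex.conj_ofReal]
    push_cast
    linear_combination -(w q * w' q * magCoeff Λ ε m q * magCoeff Λ ε l q : ℂ) * Complex.I_sq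
  obtain ⟨V, hV⟩ : ∃ V : Fin 3 → SectorSpace (n + 1),
      ∀ m, V m = spinL (pauli m) (insL (hw m) h) := ⟨_, fun _ => rfl⟩
  obtain ⟨W, hW⟩ : ∃ W : Fin 3 → SectorSpace (n + 1),
      ∀ m, W m = spinL (pauli m) (insL (hw' m) h') := ⟨_, fun _ => rfl⟩
  have hJ : ∀ m l, inner ℂ (V m) (W l)
      = (J m l : ℂ) * inner ℂ h (spinL (pauli m * pauli l) h') := by
    intro m l
    rw [hV, hW, inner_spinL_pauli, spinL_spinL, spinL_insL, inner_insL_insL]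
    simp only [hIc, integral_complex_ofReal, J]
  have hint : ∀ m, Integrable (fun q => w q * w' q * magCoeff Λ ε m q ^ 2) photonMeasure := by
    intro m
    have h1 := ((hw m).star.integrable_mul (hw' m)).re
    refine h1.congr (ae_of_all _ fun q => ?_)
    have := congrArg Complex.re (hIc m m q)
    rw [Complex.ofReal_re, ← sq] at this
    exact this
  have hS : ∫ q, w q * w' q * ∑ m, magCoeff Λ ε m q ^ 2 ∂photonMeasure = J 0 0 + J 1 1 + J 2 2 := by
    simp only [Finset.mul_sum]
    rw [integral_finsetSum _ fun m _ => hint m, Fin.sum_univ_three]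
    simp only [J, ← sq]
  have hsym : ∀ m l, J m l = J l m := fun m l => by
    simp only [J, mul_comm (magCoeff Λ ε m _)]
  obtain ⟨p01, p10, p12, p21, p20, p02⟩ := pauli_mul
  have eV : magL hw h = ∑ m, V m := (Finset.sum_congr rfl fun m _ => hV m).symm
  have eW : magL hw' h' = ∑ m, W m := (Finset.sum_congr rfl fun m _ => hW m).symm
  rw [hS, eV, eW]
  simp only [sum_inner, inner_sum, hJ]
  simp only [Fin.sum_univ_three, pauli_mul_self, spinL_one, p01, p10, p12, p21, p20,
    p02, spinL_matrix_smul, inner_smul_right]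
  rw [hsym 1 0, hsym 2 0, hsym 2 1]
  push_cast
  ring

theorem norm_magL_sq {n : ℕ} {w : Photon → ℝ} (hw : IsWeight Λ ε w) (h : SectorSpace n) :
    ‖magL hw h‖ ^ 2 = (∫ q, w q ^ 2 * ∑ m, magCoeff Λ ε m q ^ 2 ∂photonMeasure) * ‖h‖ ^ 2 := by
  have h1 := inner_magL_magL hw hw h h
  rw [inner_self_eq_ofReal, inner_self_eq_ofReal] at h1
  simp only [← sq] at h1
  exact_mod_cast h1

/-- Parity forbids interference of the two fields. -/
theorem inner_insL_magL (hΛ : 0 < Λ) (hε : IsPolarization ε) {n : ℕ} {w : Photon → ℝ}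
    (hw : IsWeight Λ ε w) {ρ : ℝ → ℝ} (hρ : ∀ q : Photon, w q = ρ ‖q.1‖) (j : Fin 3)
    (h h' : SectorSpace n) :
    inner ℂ (insL (memLp_potC hΛ hε j) h) (magL hw h') = 0 := by
  rw [magL, inner_sum]
  refine Finset.sum_eq_zero fun m _ => ?_
  rw [spinL_insL, inner_insL_insL]
  have e : ∀ q, (starRingEnd ℂ) (potC Λ ε j q) * ((w q : ℂ) * magC Λ ε m q)
      = -Complex.I * ((ρ ‖q.1‖ * (potCoeff Λ ε j q * magCoeff Λ ε m q) : ℝ) : ℂ) := fun q => by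
    simp only [potC, magC, Complex.conj_ofReal, hρ]; push_cast; ring
  simp only [e]
  rw [integral_const_mul, integral_potCoeff_mul_magCoeff Λ hε, mul_zero, zero_mul]

theorem inner_magL_coord (hε : IsPolarization ε) {n : ℕ} {w w' : Photon → ℝ}
    (hw : IsWeight Λ ε w) (hw' : IsWeight Λ ε w') {ρ : ℝ → ℝ} (j : Fin 3)
    (hρ : ∀ q : Photon, w q * w' q = ρ ‖q.1‖ * q.1 j) (h h' : SectorSpace n) :
    inner ℂ (magL hw h) (magL hw' h') = 0 := by
  rw [inner_magL_magL]
  have h1 := integral_coord_mul_magCoeff_sq Λ hε j ρ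
  rw [integral_complex_ofReal] at h1
  simp only [hρ, mul_assoc]
  rw [h1, zero_mul]

theorem IsMom.sum {ι : Type*} (s : Finset ι) {n : ℕ} {j : Fin 3} {h g : ι → SectorSpace n}
    (hm : ∀ i, IsMom j (h i) (g i)) : IsMom j (∑ i ∈ s, h i) (∑ i ∈ s, g i) := by
  classical
  induction s using Finset.induction_on with
  | empty => simpa using IsMom.zero
  | insert a s ha ih => rw [Finset.sum_insert ha, Finset.sum_insert ha]; exact (hm a).add ih

theorem insL_congr {n : ℕ} {c c' : Photon → ℂ} (hc : MemLp c 2 photonMeasure)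
    (hc' : MemLp c' 2 photonMeasure) (e : ∀ q, c q = c' q) (h : SectorSpace n) :
    insL hc h = insL hc' h := by
  obtain rfl : c = c' := funext e
  rfl

theorem IsMom.magL {n : ℕ} {j : Fin 3} {h g : SectorSpace n} (hm : IsMom j h g) {w : Photon → ℝ}
    (hw : IsWeight Λ ε w) (hkw : IsWeight Λ ε fun q => w q * q.1 j) :
    IsMom j (magL hw h) (magL hw g - magL hkw h) := by
  have hk : ∀ m, MemLp (fun q => (q.1 j : ℂ) * ((w q : ℂ) * magC Λ ε m q)) 2 photonMeasure :=
    fun m => by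
      convert hkw m using 2 with q
      push_cast; ring
  have h1 := IsMom.sum Finset.univ fun m => (hm.insL (hw m) (hk m)).spinL (pauli m)
  have e : PauliFierz.magL hw g - PauliFierz.magL hkw h
      = ∑ m, PauliFierz.spinL (pauli m) (PauliFierz.insL (hw m) g - PauliFierz.insL (hk m) h) := by
    simp only [PauliFierz.magL, map_sub, Finset.sum_sub_distrib]
    congr 1
    refine Finset.sum_congr rfl fun m _ => ?_
    rw [insL_congr (hkw m) (hk m) fun q => by push_cast; ring]
  rw [e]
  exact h1

end MagneticInsertion

/-! ### Completing the squares -/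

set_option maxHeartbeats 1000000 in
/-- The quadratic polynomial in the amplitude `a` and its momenta `b` for one photon with wave
vector `k`, `K = |k|`. Here `y = 1 / (K + K²)`, `H` is the energy of the other photons, `θ` is the
share of the photon in the momentum energy, and `u`, `g`, `r` are the source, its momenta, and the
source of the vector potential. Up to the remainders in the last line, the squares are
completed by shifting `a` and `b` by `-y s u / ζ` and the momenta of this function. -/
theorem quadratic_nonneg_real {K H ζ s y θ : ℝ} (hK : 0 < K) (hH : 0 ≤ H) (hζ : 1 / 2 ≤ ζ)
    (hy : y * (K + K ^ 2) = 1) (hθ : θ * (K + H) = K) {k : Fin 3 → ℝ}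
    (hk : ∑ j, k j ^ 2 = K ^ 2) (a u r : ℝ) (b g : Fin 3 → ℝ) :
    0 ≤ ζ * (K * a ^ 2 + θ * ∑ j, b j ^ 2) + 2 * s * (u * a) + 2 * (r * a)
      - 2 * s * (y * K ^ 2 * (u * a) - ∑ j, y * k j * (g j * a) + ∑ j, y * k j * (u * b j))
      + 2 * s / ζ * (y * (r * u)) + 2 * s ^ 2 / ζ * ∑ j, y ^ 2 * k j * (g j * u)
      + s ^ 2 / ζ * (y * u ^ 2) + 4 * s ^ 2 * ∑ j, y ^ 2 * (K + 2) * g j ^ 2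
      + 8 * s ^ 2 * (y ^ 2 * K * (H * u ^ 2)) + 4 * (r ^ 2 / K) := by
  have hζ0 : 0 < ζ := by linarith
  set i := 1 / ζ with hi0
  have hi : ζ * i = 1 := by rw [hi0]; field_simp
  have hi2 : i ≤ 2 := by
    rw [hi0, div_le_iff₀ hζ0]; linarith
  have hipos : 0 < i := by rw [hi0]; positivity
  have hθe : θ = K / (K + H) := by rw [eq_div_iff (by positivity)]; exact hθ
  have hθ0 : 0 < θ := by rw [hθe]; positivity
  have hθ1 : θ ≤ 1 := by rw [hθe, div_le_one (by positivity)]; linarith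
  have hKH : (1 - θ) * K ≤ H := by
    have := mul_le_of_le_one_left hH hθ1
    linarith
  simp only [Fin.sum_univ_three, div_eq_mul_inv (2 * s) ζ, div_eq_mul_inv (2 * s ^ 2) ζ,
    div_eq_mul_inv (s ^ 2) ζ, show ζ⁻¹ = i by rw [hi0, one_div]] at *
  set β := a + y * s * i * u
  set kg := k 0 * g 0 + k 1 * g 1 + k 2 * g 2 with hkg
  set g2 := g 0 ^ 2 + g 1 ^ 2 + g 2 ^ 2 with hg2
  have hcs : kg ^ 2 ≤ K ^ 2 * g2 := by
    rw [hkg, hg2, ← hk]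
    linarith [sq_nonneg (k 0 * g 1 - k 1 * g 0), sq_nonneg (k 0 * g 2 - k 2 * g 0),
      sq_nonneg (k 1 * g 2 - k 2 * g 1)]
  have hg20 : 0 ≤ g2 := by positivity
  -- the square in the photon amplitude
  have A : 0 ≤ ζ * K * β ^ 2 + 2 * β * (r + s * y * kg) + 4 * (r ^ 2 / K)
      + 4 * s ^ 2 * y ^ 2 * K * g2 := by
    have h1 : 0 ≤ i / K * (ζ * K * β + (r + s * y * kg)) ^ 2 := by positivity
    have h2 : i / K * (ζ * K * β + (r + s * y * kg)) ^ 2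
        = ζ * K * β ^ 2 + 2 * β * (r + s * y * kg) + i * ((r + s * y * kg) ^ 2 / K) := by
      field_simp
      linear_combination (ζ * K ^ 2 * β ^ 2 + 2 * K * β * (r + s * y * kg)) * hi
    have h3 : (r + s * y * kg) ^ 2 / K ≤ 2 * (r ^ 2 / K) + 2 * (s ^ 2 * y ^ 2 * K * g2) := by
      rw [div_le_iff₀ hK]
      have h4 : s ^ 2 * y ^ 2 * kg ^ 2 ≤ s ^ 2 * y ^ 2 * (K ^ 2 * g2) := by gcongr
      have h5 : (2 * (r ^ 2 / K) + 2 * (s ^ 2 * y ^ 2 * K * g2)) * K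
          = 2 * r ^ 2 + 2 * (s ^ 2 * y ^ 2 * (K ^ 2 * g2)) := by field_simp
      have h6 : (r + s * y * kg) ^ 2
          = 2 * r ^ 2 + 2 * (s ^ 2 * y ^ 2 * kg ^ 2) - (r - s * y * kg) ^ 2 := by ring
      linarith [sq_nonneg (r - s * y * kg)]
    have h6 : 0 ≤ (r + s * y * kg) ^ 2 / K := by positivity
    linarith [mul_le_mul_of_nonneg_right hi2 h6]
  -- the squares in the momenta of the amplitude
  have B : ∀ bj gj kj : ℝ, 0 ≤ ζ * θ * (bj + y * s * i * (gj - kj * u)) ^ 2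
      - 2 * y * s * (bj + y * s * i * (gj - kj * u)) * (θ * gj + (1 - θ) * kj * u)
      + 4 * s ^ 2 * y ^ 2 * (gj ^ 2 + (1 - θ) ^ 2 / θ * (kj ^ 2 * u ^ 2)) := by
    intro bj gj kj
    set γ := bj + y * s * i * (gj - kj * u)
    set q := θ * gj + (1 - θ) * kj * u with hq
    have h1 : 0 ≤ i / θ * (ζ * θ * γ - y * s * q) ^ 2 := by positivity
    have h2 : i / θ * (ζ * θ * γ - y * s * q) ^ 2
        = ζ * θ * γ ^ 2 - 2 * y * s * γ * q + i * (y ^ 2 * s ^ 2 * (q ^ 2 / θ)) := by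
      field_simp
      linear_combination (ζ * θ ^ 2 * γ ^ 2 - 2 * θ * y * s * γ * q) * hi
    have h3 : q ^ 2 / θ ≤ 2 * (gj ^ 2 + (1 - θ) ^ 2 / θ * (kj ^ 2 * u ^ 2)) := by
      rw [div_le_iff₀ hθ0]
      have h4 : (2 * (gj ^ 2 + (1 - θ) ^ 2 / θ * (kj ^ 2 * u ^ 2))) * θ
          = 2 * (θ * gj ^ 2 + (1 - θ) ^ 2 * (kj ^ 2 * u ^ 2)) := by field_simp
      rw [h4, hq]
      have h5 : θ ^ 2 * gj ^ 2 ≤ θ * gj ^ 2 := by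
        have : θ ^ 2 ≤ θ := by rw [sq]; exact mul_le_of_le_one_left hθ0.le hθ1
        gcongr
      have h6 : (θ * gj + (1 - θ) * kj * u) ^ 2 = 2 * (θ ^ 2 * gj ^ 2)
          + 2 * ((1 - θ) ^ 2 * (kj ^ 2 * u ^ 2)) - (θ * gj - (1 - θ) * kj * u) ^ 2 := by ring
      linarith [sq_nonneg (θ * gj - (1 - θ) * kj * u)]
    have h6 : 0 ≤ y ^ 2 * s ^ 2 * (q ^ 2 / θ) := by positivity
    have h7 : y ^ 2 * s ^ 2 * (q ^ 2 / θ)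
        ≤ y ^ 2 * s ^ 2 * (2 * (gj ^ 2 + (1 - θ) ^ 2 / θ * (kj ^ 2 * u ^ 2))) := by gcongr
    linarith [mul_le_mul_of_nonneg_right hi2 h6]
  have hθK : (1 - θ) ^ 2 / θ * K ^ 2 ≤ K * H := by
    have h1 : (1 - θ) * K = θ * H := by linarith
    have h2 : (1 - θ) ^ 2 / θ * K ^ 2 = (1 - θ) * K * H := by
      have : (1 - θ) ^ 2 * K ^ 2 = (1 - θ) * K * (θ * H) := by rw [← h1]; ring
      rw [div_mul_eq_mul_div, div_eq_iff hθ0.ne', this]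
      ring
    rw [h2]
    linarith [mul_nonneg hθ0.le (mul_nonneg hK.le hH)]
  -- the remainder due to the energy of the other photons
  have Cc : ∀ gj kj : ℝ, i * (1 - θ) * (gj - kj * u) ^ 2
      ≤ 4 * (gj ^ 2 + (1 - θ) * (kj ^ 2 * u ^ 2)) := by
    intro gj kj
    have h1 : (gj - kj * u) ^ 2 ≤ 2 * (gj ^ 2 + kj ^ 2 * u ^ 2) := by
      linarith [sq_nonneg (gj + kj * u)]
    have h2 : 0 ≤ i * (1 - θ) := mul_nonneg hipos.le (by linarith)
    have h3 : i * (1 - θ) ≤ 2 * (1 - θ) := mul_le_mul_of_nonneg_right hi2 (by linarith)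
    have h4 : 0 ≤ 2 * (gj ^ 2 + kj ^ 2 * u ^ 2) := by positivity
    calc i * (1 - θ) * (gj - kj * u) ^ 2 ≤ (2 * (1 - θ)) * (2 * (gj ^ 2 + kj ^ 2 * u ^ 2)) :=
          mul_le_mul h3 h1 (sq_nonneg _) (by linarith)
      _ ≤ _ := by linarith [mul_nonneg hθ0.le (sq_nonneg gj)]
  have hC := add_le_add (add_le_add (Cc (g 0) (k 0)) (Cc (g 1) (k 1))) (Cc (g 2) (k 2))
  have hB := add_nonneg (add_nonneg (B (b 0) (g 0) (k 0)) (B (b 1) (g 1) (k 1)))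
    (B (b 2) (g 2) (k 2))
  have hsy : 0 ≤ s ^ 2 * y ^ 2 := by positivity
  have hC' := mul_le_mul_of_nonneg_left hC hsy
  have hu1 : s ^ 2 * y ^ 2 * ((1 - θ) ^ 2 / θ * K ^ 2 * u ^ 2)
      ≤ s ^ 2 * y ^ 2 * (K * H * u ^ 2) := by
    gcongr
  have hu2 : s ^ 2 * y ^ 2 * ((1 - θ) * K ^ 2 * u ^ 2)
      ≤ s ^ 2 * y ^ 2 * (K * H * u ^ 2) := by
    have : (1 - θ) * K ^ 2 ≤ K * H := by linarith [mul_le_mul_of_nonneg_left hKH hK.le]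
    gcongr
  have hi3 : 0 ≤ s ^ 2 * y ^ 2 * (i * g2) := by positivity
  -- `y (K + K²) = 1` cancels the terms linear in `u` after the shift
  have key : ζ * (K * a ^ 2 + θ * (b 0 ^ 2 + b 1 ^ 2 + b 2 ^ 2)) + 2 * s * (u * a) + 2 * (r * a)
      - 2 * s * (y * K ^ 2 * (u * a) - (y * k 0 * (g 0 * a) + y * k 1 * (g 1 * a)
        + y * k 2 * (g 2 * a)) + (y * k 0 * (u * b 0) + y * k 1 * (u * b 1) + y * k 2 * (u * b 2)))
      + 2 * s * i * (y * (r * u)) + 2 * s ^ 2 * i * (y ^ 2 * k 0 * (g 0 * u)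
        + y ^ 2 * k 1 * (g 1 * u) + y ^ 2 * k 2 * (g 2 * u)) + s ^ 2 * i * (y * u ^ 2)
      = ζ * K * β ^ 2 + 2 * β * (r + s * y * kg)
        + ((ζ * θ * (b 0 + y * s * i * (g 0 - k 0 * u)) ^ 2
        - 2 * y * s * (b 0 + y * s * i * (g 0 - k 0 * u)) * (θ * g 0 + (1 - θ) * k 0 * u))
        + (ζ * θ * (b 1 + y * s * i * (g 1 - k 1 * u)) ^ 2
        - 2 * y * s * (b 1 + y * s * i * (g 1 - k 1 * u)) * (θ * g 1 + (1 - θ) * k 1 * u))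
        + (ζ * θ * (b 2 + y * s * i * (g 2 - k 2 * u)) ^ 2
        - 2 * y * s * (b 2 + y * s * i * (g 2 - k 2 * u)) * (θ * g 2 + (1 - θ) * k 2 * u)))
        + s ^ 2 * y ^ 2 * (i * g2 - (i * (1 - θ) * (g 0 - k 0 * u) ^ 2
          + i * (1 - θ) * (g 1 - k 1 * u) ^ 2 + i * (1 - θ) * (g 2 - k 2 * u) ^ 2)) := by
    simp only [β, kg, g2]
    linear_combination (-(2 * K * y * s * a * u + K * y ^ 2 * s ^ 2 * i * u ^ 2
      + (2 * θ * y * s * b 0 * (g 0 - k 0 * u) + θ * y ^ 2 * s ^ 2 * i * (g 0 - k 0 * u) ^ 2)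
      + (2 * θ * y * s * b 1 * (g 1 - k 1 * u) + θ * y ^ 2 * s ^ 2 * i * (g 1 - k 1 * u) ^ 2)
      + (2 * θ * y * s * b 2 * (g 2 - k 2 * u) + θ * y ^ 2 * s ^ 2 * i * (g 2 - k 2 * u) ^ 2))) * hi
      + (-2 * s * a * u - s ^ 2 * y * i * u ^ 2) * hy - y ^ 2 * s ^ 2 * i * u ^ 2 * hk
  have hk1 : s ^ 2 * y ^ 2 * ((1 - θ) ^ 2 / θ * K ^ 2 * u ^ 2)
      = s ^ 2 * y ^ 2 * ((1 - θ) ^ 2 / θ * (k 0 ^ 2 * u ^ 2)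
        + (1 - θ) ^ 2 / θ * (k 1 ^ 2 * u ^ 2) + (1 - θ) ^ 2 / θ * (k 2 ^ 2 * u ^ 2)) := by
    rw [← hk]; ring
  have hk2 : s ^ 2 * y ^ 2 * ((1 - θ) * K ^ 2 * u ^ 2)
      = s ^ 2 * y ^ 2 * ((1 - θ) * (k 0 ^ 2 * u ^ 2)
        + (1 - θ) * (k 1 ^ 2 * u ^ 2) + (1 - θ) * (k 2 ^ 2 * u ^ 2)) := by
    rw [← hk]; ring
  rw [hk1] at hu1
  rw [hk2] at hu2
  rw [key]
  simp only [g2] at *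
  linarith

/-- The real and imaginary parts of the amplitudes decouple. -/
theorem quadratic_nonneg {K H ζ s y θ : ℝ} (hK : 0 < K) (hH : 0 ≤ H) (hζ : 1 / 2 ≤ ζ)
    (hy : y * (K + K ^ 2) = 1) (hθ : θ * (K + H) = K) {k : Fin 3 → ℝ}
    (hk : ∑ j, k j ^ 2 = K ^ 2) (a u r : ℂ) (b g : Fin 3 → ℂ) :
    0 ≤ ζ * (K * ‖a‖ ^ 2 + θ * ∑ j, ‖b j‖ ^ 2) + 2 * s * ((starRingEnd ℂ) u * a).re
      + 2 * ((starRingEnd ℂ) r * a).re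
      - 2 * s * (y * K ^ 2 * ((starRingEnd ℂ) u * a).re
        - ∑ j, y * k j * ((starRingEnd ℂ) (g j) * a).re
        + ∑ j, y * k j * ((starRingEnd ℂ) u * b j).re)
      + 2 * s / ζ * (y * ((starRingEnd ℂ) r * u).re)
      + 2 * s ^ 2 / ζ * ∑ j, y ^ 2 * k j * ((starRingEnd ℂ) (g j) * u).re
      + s ^ 2 / ζ * (y * ‖u‖ ^ 2) + 4 * s ^ 2 * ∑ j, y ^ 2 * (K + 2) * ‖g j‖ ^ 2
      + 8 * s ^ 2 * (y ^ 2 * K * (H * ‖u‖ ^ 2)) + 4 * (‖r‖ ^ 2 / K) := by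
  have h1 := quadratic_nonneg_real (s := s) hK hH hζ hy hθ hk a.re u.re r.re (fun j => (b j).re)
    (fun j => (g j).re)
  have h2 := quadratic_nonneg_real (s := s) hK hH hζ hy hθ hk a.im u.im r.im (fun j => (b j).im)
    (fun j => (g j).im)
  have e : ∀ x y : ℂ, ((starRingEnd ℂ) x * y).re = x.re * y.re + x.im * y.im := fun x y => by
    simp [Complex.mul_re]
  have e2 : ∀ x : ℂ, ‖x‖ ^ 2 = x.re ^ 2 + x.im ^ 2 := fun x => by
    rw [← Complex.normSq_eq_norm_sq, Complex.normSq_apply]; ring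
  simp only [e, e2, Fin.sum_univ_three, add_div] at *
  linarith

/-! ### The energy gained by one more photon -/

/-- `f` is integrable with integral `v`. -/
def HasIntegralValue {α : Type*} [MeasurableSpace α] (μ : Measure α) (f : α → ℝ) (v : ℝ) : Prop :=
  Integrable f μ ∧ ∫ z, f z ∂μ = v

namespace HasIntegralValue

variable {α : Type*} [MeasurableSpace α] {μ : Measure α} {f g : α → ℝ} {v w : ℝ}

theorem add (hf : HasIntegralValue μ f v) (hg : HasIntegralValue μ g w) :
    HasIntegralValue μ (fun z => f z + g z) (v + w) :=
  ⟨hf.1.add hg.1, by rw [integral_add hf.1 hg.1, hf.2, hg.2]⟩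

theorem sub (hf : HasIntegralValue μ f v) (hg : HasIntegralValue μ g w) :
    HasIntegralValue μ (fun z => f z - g z) (v - w) :=
  ⟨hf.1.sub hg.1, by rw [integral_sub hf.1 hg.1, hf.2, hg.2]⟩

theorem const_mul (a : ℝ) (hf : HasIntegralValue μ f v) :
    HasIntegralValue μ (fun z => a * f z) (a * v) :=
  ⟨hf.1.const_mul a, by rw [integral_const_mul, hf.2]⟩

theorem nonneg (hf : HasIntegralValue μ f v) (h : ∀ᵐ z ∂μ, 0 ≤ f z) : 0 ≤ v :=
  hf.2 ▸ integral_nonneg_of_ae h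

theorem sum {ι : Type*} [Fintype ι] {f : ι → α → ℝ} {v : ι → ℝ}
    (hf : ∀ i, HasIntegralValue μ (f i) (v i)) :
    HasIntegralValue μ (fun z => ∑ i, f i z) (∑ i, v i) :=
  ⟨integrable_finsetSum _ fun i _ => (hf i).1, by
    rw [integral_finsetSum _ fun i _ => (hf i).1]
    exact Finset.sum_congr rfl fun i _ => (hf i).2⟩

end HasIntegralValue

theorem hasIntegralValue_re_inner {n : ℕ} (f g : SectorSpace n) :
    HasIntegralValue (sectorMeasure n) (fun z => ((starRingEnd ℂ) (f z) * g z).re)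
      (inner ℂ f g : ℂ).re := by
  have h1 : Integrable (fun z => (starRingEnd ℂ) (f z) * g z) (sectorMeasure n) :=
    (Lp.memLp f).star.integrable_mul (Lp.memLp g)
  refine ⟨h1.re, ?_⟩
  rw [inner_eq_integral]
  exact integral_re h1

theorem hasIntegralValue_norm_sq {n : ℕ} (f : SectorSpace n) :
    HasIntegralValue (sectorMeasure n) (fun z => ‖f z‖ ^ 2) (‖f‖ ^ 2) :=
  ⟨integrable_norm_sq f, (norm_sq_eq_integral f).symm⟩

theorem ae_photon_ne_zero : ∀ᵐ q ∂photonMeasure, q.1 ≠ 0 := by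
  have h : ∀ᵐ k ∂(volume : Measure R3), k ≠ 0 := by
    rw [ae_iff]; simp
  exact Measure.quasiMeasurePreserving_fst.ae h

section SectorInequality

variable {Λ : ℝ} {ε : Fin 2 → R3 → R3}

theorem isWeight_one (hΛ : 0 < Λ) (hε : IsPolarization ε) : IsWeight Λ ε fun _ => 1 :=
  isWeight_of_sq_le hΛ hε measurable_const (C := 1) fun _ => by simp

theorem isWeight_denom (hΛ : 0 < Λ) (hε : IsPolarization ε) : IsWeight Λ ε denom :=
  isWeight_of_mul_sq_le hΛ hε measurable_denom (C := 1) fun q => by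
    have := norm_mul_denom_le q
    have h0 : 0 ≤ ‖q.1‖ * denom q := mul_nonneg (norm_nonneg _) (denom_nonneg q)
    calc _ = (‖q.1‖ * denom q) ^ 2 := by ring
      _ ≤ 1 := pow_le_one₀ h0 this

theorem isWeight_sqrt_denom (hΛ : 0 < Λ) (hε : IsPolarization ε) :
    IsWeight Λ ε fun q => Real.sqrt (denom q) :=
  isWeight_of_mul_sq_le hΛ hε measurable_denom.sqrt (C := 1) fun q => by
    rw [Real.sq_sqrt (denom_nonneg q), mul_comm]
    exact norm_sq_mul_denom_le q

theorem isWeight_denom_norm_sq (hΛ : 0 < Λ) (hε : IsPolarization ε) :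
    IsWeight Λ ε fun q => denom q * ‖q.1‖ ^ 2 :=
  isWeight_of_sq_le hΛ hε (measurable_denom.mul (measurable_fst.norm.pow_const 2)) (C := 1)
    fun q => by
      rw [abs_of_nonneg (mul_nonneg (denom_nonneg q) (sq_nonneg _)), mul_comm]
      exact norm_sq_mul_denom_le q

theorem abs_coord_le (k : R3) (j : Fin 3) : |k j| ≤ ‖k‖ :=
  abs_le_of_sq_le_sq (coord_sq_le k j) (norm_nonneg k)

theorem isWeight_denom_coord (hΛ : 0 < Λ) (hε : IsPolarization ε) (j : Fin 3) :
    IsWeight Λ ε fun q => denom q * q.1 j :=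
  isWeight_of_sq_le hΛ hε (measurable_denom.mul (measurable_coord j)) (C := 1) fun q => by
    rw [abs_mul, abs_of_nonneg (denom_nonneg q), mul_comm]
    exact (mul_le_mul_of_nonneg_right (abs_coord_le _ j) (denom_nonneg q)).trans
      (norm_mul_denom_le q)

theorem isWeight_denom_coord_coord (hΛ : 0 < Λ) (hε : IsPolarization ε) (j : Fin 3) :
    IsWeight Λ ε fun q => denom q * q.1 j * q.1 j :=
  isWeight_of_sq_le hΛ hε ((measurable_denom.mul (measurable_coord j)).mul (measurable_coord j))
    (C := 1) fun q => by
      rw [mul_assoc, ← sq, abs_of_nonneg (mul_nonneg (denom_nonneg q) (sq_nonneg _)), mul_comm]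
      exact (mul_le_mul_of_nonneg_right (coord_sq_le _ j) (denom_nonneg q)).trans
        (norm_sq_mul_denom_le q)

theorem isWeight_denom_sqrt (hΛ : 0 < Λ) (hε : IsPolarization ε) {a : ℝ} (ha : 0 ≤ a) :
    IsWeight Λ ε fun q => denom q * Real.sqrt (‖q.1‖ + a) :=
  isWeight_of_mul_sq_le hΛ hε (measurable_denom.mul (measurable_fst.norm.add_const a).sqrt)
    (C := 1 + a) fun q => by
      have h1 := norm_mul_denom_le q
      have h2 := norm_sq_mul_denom_le q
      have h0 := denom_nonneg q
      have hK := norm_nonneg q.1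
      have h3 : 0 ≤ ‖q.1‖ * denom q := mul_nonneg hK h0
      rw [mul_pow, Real.sq_sqrt (by positivity)]
      calc denom q ^ 2 * (‖q.1‖ + a) * ‖q.1‖ ^ 2
          = (‖q.1‖ * denom q) * (‖q.1‖ ^ 2 * denom q) + a * (‖q.1‖ * denom q) ^ 2 := by ring
        _ ≤ 1 * 1 + a * 1 := by
            gcongr
            exact pow_le_one₀ h3 h1
        _ = 1 + a := by ring

theorem integral_weight_le (hΛ : 0 < Λ) {w : Photon → ℝ} {C : ℝ}
    (hw : ∀ q, w q ^ 2 * ∑ m, magCoeff Λ ε m q ^ 2 ≤ C * irWeight Λ q) :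
    ∫ q, w q ^ 2 * ∑ m, magCoeff Λ ε m q ^ 2 ∂photonMeasure ≤ C * (2 * Λ / Real.pi) := by
  rw [← integral_irWeight hΛ, ← integral_const_mul]
  exact integral_mono_of_nonneg (ae_of_all _ fun q => mul_nonneg (sq_nonneg _)
    (Finset.sum_nonneg fun _ _ => sq_nonneg _)) ((integrable_irWeight hΛ).const_mul C)
    (ae_of_all _ hw)

theorem memLp_sqrt_irWeight (hΛ : 0 < Λ) :
    MemLp (fun q => (Real.sqrt (irWeight Λ q) : ℂ)) 2 photonMeasure := by
  refine memLp_of_sq_le hΛ ?_ 1 fun q => ?_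
  · unfold irWeight
    exact ((((measurable_cutoff Λ).comp measurable_fst).mul
      (measurable_const.mul (measurable_const.div (measurable_fst.norm.pow_const 2))))).sqrt
  · rw [Real.sq_sqrt (irWeight_nonneg Λ q), one_mul]

theorem norm_insL_sqrt_irWeight (hΛ : 0 < Λ) {n : ℕ} (h : SectorSpace n) :
    ‖insL (memLp_sqrt_irWeight hΛ) h‖ ^ 2 = 2 * Λ / Real.pi * ‖h‖ ^ 2 := by
  have h1 := inner_insL_insL (memLp_sqrt_irWeight hΛ) (memLp_sqrt_irWeight hΛ) h h
  have e : ∀ q, (starRingEnd ℂ) (Real.sqrt (irWeight Λ q) : ℂ) * (Real.sqrt (irWeight Λ q) : ℂ)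
      = (irWeight Λ q : ℂ) := fun q => by
    rw [Complex.conj_ofReal, ← Complex.ofReal_mul, Real.mul_self_sqrt (irWeight_nonneg Λ q)]
  simp only [e, integral_complex_ofReal, integral_irWeight hΛ, inner_self_eq_ofReal] at h1
  exact_mod_cast h1

theorem inner_magL_one (hΛ : 0 < Λ) (hε : IsPolarization ε) {n : ℕ} (h : SectorSpace n)
    (Θ : SectorSpace (n + 1)) :
    inner ℂ (magL (isWeight_one hΛ hε) h) ((Real.sqrt (n + 1) : ℂ) • Θ)
      = inner ℂ h (∑ m, spinL (pauli m) (annL (memLp_magC hΛ hε m) Θ)) := by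
  rw [magL, sum_inner, inner_sum]
  refine Finset.sum_congr rfl fun m _ => ?_
  rw [insL_congr (isWeight_one hΛ hε m) (memLp_magC hΛ hε m) fun q => by simp, spinL_insL,
    inner_smul_right, inner_insL_eq, inner_spinL_pauli]

/-- Symmetry of the momentum between `Θ` and the inserted photon: the recoil of the photon gives
`|k|²`. It permits to replace the correlation between the momenta of electron and photon. -/
theorem sum_inner_magL_coord (hΛ : 0 < Λ) (hε : IsPolarization ε) {n : ℕ} {ψ : SectorSpace n}
    {p : Fin 3 → SectorSpace n} {a : SectorSpace (n + 1)} {b : Fin 3 → SectorSpace (n + 1)}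
    (hp : ∀ j, IsMom j ψ (p j)) (hb : ∀ j, IsMom j a (b j)) :
    inner ℂ (magL (isWeight_denom_norm_sq hΛ hε) ψ) a
      - ∑ j, inner ℂ (magL (isWeight_denom_coord hΛ hε j) (p j)) a
      + ∑ j, inner ℂ (magL (isWeight_denom_coord hΛ hε j) ψ) (b j) = 0 := by
  have h1 := fun j => (hb j).inner_symm ((hp j).magL (isWeight_denom_coord hΛ hε j)
    (isWeight_denom_coord_coord hΛ hε j))
  have h2 : magL (isWeight_denom_norm_sq hΛ hε) ψ
      = ∑ j, magL (isWeight_denom_coord_coord hΛ hε j) ψ := by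
    refine Lp.ext ?_
    filter_upwards [coeFn_magL (isWeight_denom_norm_sq hΛ hε) ψ,
      coeFn_sum Finset.univ fun j => magL (isWeight_denom_coord_coord hΛ hε j) ψ,
      ae_all_iff.2 fun j => coeFn_magL (isWeight_denom_coord_coord hΛ hε j) ψ] with z h3 h4 h5
    rw [h3, h4]
    simp only [h5, ← Finset.sum_mul]
    congr 1
    rw [EuclideanSpace.real_norm_sq_eq, Finset.mul_sum]
    push_cast
    exact Finset.sum_congr rfl fun j _ => by ring
  simp only [h1, inner_sub_left, Finset.sum_sub_distrib]
  rw [h2, sum_inner]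
  ring

set_option maxHeartbeats 1000000 in
/-- Lower bound for the terms of the energy which couple `n` to `n + 1` photons, obtained by
integrating `quadratic_nonneg` over all configurations with the first photon singled out. The
vectors `R j` are arbitrary, `s = √α`, and `ζ` is the fraction of the kinetic and the field energy
which is used. -/
theorem sector_inequality (hΛ : 0 < Λ) (hε : IsPolarization ε) {ζ : ℝ} (s : ℝ) (hζ : 1 / 2 ≤ ζ)
    {n : ℕ} {ψ f : SectorSpace n} {p : Fin 3 → SectorSpace n} (R : Fin 3 → SectorSpace n)
    {Θ FΘ : SectorSpace (n + 1)} {PΘ : Fin 3 → SectorSpace (n + 1)} (hΘ : IsSym Θ)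
    (hPΘ : ∀ j, IsSym (PΘ j)) (hf : IsSqrtEnergy ψ f) (hFΘ : IsSqrtEnergy Θ FΘ)
    (hp : ∀ j, IsMom j ψ (p j)) (hb : ∀ j, IsMom j Θ (PΘ j)) :
    0 ≤ ζ * (‖FΘ‖ ^ 2 + ∑ j, ‖PΘ j‖ ^ 2)
      + 2 * s * (inner ℂ ψ (∑ m, spinL (pauli m) (annL (memLp_magC hΛ hε m) Θ)) : ℂ).re
      + 2 * ∑ j, (inner ℂ (R j) (annL (memLp_potC hΛ hε j) Θ) : ℂ).re
      + s ^ 2 / ζ * (spinShiftEnergy Λ * ‖ψ‖ ^ 2)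
      + 2 * Λ / Real.pi * (8 * s ^ 2 * ∑ j, ‖p j‖ ^ 2 + 8 * s ^ 2 * ‖f‖ ^ 2
        + 4 * ∑ j, ‖R j‖ ^ 2) := by
  have hζ0 : 0 < ζ := by linarith
  set N : ℂ := (Real.sqrt (n + 1) : ℂ) with hN
  set a : SectorSpace (n + 1) := N • Θ with ha
  set b : Fin 3 → SectorSpace (n + 1) := fun j => N • PΘ j with hbdef
  set U1 := magL (isWeight_one hΛ hε) ψ with hU1
  set UK := magL (isWeight_denom_norm_sq hΛ hε) ψ with hUK
  set Uk : Fin 3 → SectorSpace (n + 1) := fun j => magL (isWeight_denom_coord hΛ hε j) ψ with hUk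
  set Gk : Fin 3 → SectorSpace (n + 1) := fun j => magL (isWeight_denom_coord hΛ hε j) (p j)
    with hGk
  set Uy := magL (isWeight_denom hΛ hε) ψ with hUy
  set Us := magL (isWeight_sqrt_denom hΛ hε) ψ with hUs
  set Gd : Fin 3 → SectorSpace (n + 1) := fun j => magL (isWeight_denom_sqrt hΛ hε
    (show (0 : ℝ) ≤ 2 by norm_num)) (p j) with hGd
  set V := magL (isWeight_denom_sqrt hΛ hε (le_refl (0 : ℝ))) f with hV
  set r : SectorSpace (n + 1) := ∑ j, insL (memLp_potC hΛ hε j) (R j) with hr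
  set W : Fin 3 → SectorSpace (n + 1) := fun j => insL (memLp_sqrt_irWeight hΛ) (R j) with hW
  set T : Fin 3 → ℝ := fun j => ∫ z, ‖(hd z).1‖ / energy z.2.2 * ‖PΘ j z‖ ^ 2
    ∂(sectorMeasure (n + 1)) with hT
  -- the two integrals with unbounded or position dependent weights
  have i1 : HasIntegralValue (sectorMeasure (n + 1))
      (fun z => ((n : ℝ) + 1) * (‖(hd z).1‖ * ‖Θ z‖ ^ 2)) (‖FΘ‖ ^ 2) := by
    refine ⟨(integrable_weight (measurable_fst.comp measurable_hd).norm (fun _ => norm_nonneg _)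
      norm_hd_le_energy hFΘ.integrable).const_mul _, ?_⟩
    rw [integral_const_mul]
    exact hΘ.integral_energy hFΘ
  have i2 : ∀ j, HasIntegralValue (sectorMeasure (n + 1))
      (fun z => ((n : ℝ) + 1) * (‖(hd z).1‖ / energy z.2.2 * ‖PΘ j z‖ ^ 2))
      (((n : ℝ) + 1) * T j) := by
    intro j
    refine ⟨Integrable.const_mul (integrable_weight (v := fun _ => 1)
      ((measurable_fst.comp measurable_hd).norm.div measurable_energy)
      (fun z => div_nonneg (norm_nonneg _) (energy_nonneg _))
      (fun z => div_le_one_of_le₀ (norm_hd_le_energy z) (energy_nonneg _))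
      (by simpa using integrable_norm_sq (PΘ j))) _, ?_⟩
    rw [integral_const_mul]
  have hI := ((((((((((i1.add (HasIntegralValue.sum i2)).const_mul ζ).add
    ((hasIntegralValue_re_inner U1 a).const_mul (2 * s))).add
    ((hasIntegralValue_re_inner r a).const_mul 2)).sub
    ((((hasIntegralValue_re_inner UK a).sub (HasIntegralValue.sum fun j =>
      hasIntegralValue_re_inner (Gk j) a)).add (HasIntegralValue.sum fun j =>
      hasIntegralValue_re_inner (Uk j) (b j))).const_mul (2 * s))).add
    ((hasIntegralValue_re_inner r Uy).const_mul (2 * s / ζ))).add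
    ((HasIntegralValue.sum fun j => hasIntegralValue_re_inner (Gk j) Uy).const_mul
      (2 * s ^ 2 / ζ))).add
    ((hasIntegralValue_norm_sq Us).const_mul (s ^ 2 / ζ))).add
    ((HasIntegralValue.sum fun j => hasIntegralValue_norm_sq (Gd j)).const_mul (4 * s ^ 2))).add
    ((hasIntegralValue_norm_sq V).const_mul (8 * s ^ 2))).add
    ((HasIntegralValue.sum fun j => hasIntegralValue_norm_sq (W j)).const_mul 4)
  have hnn := hI.nonneg (by
    filter_upwards [coeFn_magL (isWeight_one hΛ hε) ψ,
      coeFn_magL (isWeight_denom_norm_sq hΛ hε) ψ,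
      ae_all_iff.2 fun j => coeFn_magL (isWeight_denom_coord hΛ hε j) ψ,
      ae_all_iff.2 fun j => coeFn_magL (isWeight_denom_coord hΛ hε j) (p j),
      coeFn_magL (isWeight_denom hΛ hε) ψ,
      coeFn_magL (isWeight_sqrt_denom hΛ hε) ψ,
      ae_all_iff.2 fun j => coeFn_magL (isWeight_denom_sqrt hΛ hε
        (show (0 : ℝ) ≤ 2 by norm_num)) (p j),
      (coeFn_magL (isWeight_denom_sqrt hΛ hε (le_refl (0 : ℝ))) f),
      magF_congr (Λ := Λ) (ε := ε) hf,
      coeFn_sum Finset.univ fun j => insL (memLp_potC hΛ hε j) (R j),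
      ae_all_iff.2 fun j => coeFn_insL (memLp_potC hΛ hε j) (R j),
      ae_all_iff.2 fun j => coeFn_insL (memLp_sqrt_irWeight hΛ) (R j),
      Lp.coeFn_smul N Θ, ae_all_iff.2 fun j => Lp.coeFn_smul N (PΘ j),
      quasiMeasurePreserving_hd.ae ae_photon_ne_zero]
      with z z1 z2 z3 z4 z5 z6 z7 z8 z9 z10 z11 z12 z13 z14 z15
    have hK : 0 < ‖(hd z).1‖ := norm_pos_iff.2 z15
    have hH := energy_nonneg (tl z).2.2
    have hE := energy_succ z
    have hy : denom (hd z) * (‖(hd z).1‖ + ‖(hd z).1‖ ^ 2) = 1 := by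
      unfold denom; field_simp
    have hθ : ‖(hd z).1‖ / energy z.2.2 * (‖(hd z).1‖ + energy (tl z).2.2) = ‖(hd z).1‖ := by
      rw [hE]; field_simp
    have hk := (EuclideanSpace.real_norm_sq_eq (hd z).1).symm
    have hmain := quadratic_nonneg (s := s) hK hH hζ hy hθ hk (a z) (magF Λ ε ψ z) (r z)
      (fun j => b j z) (fun j => magF Λ ε (p j) z)
    have hNN : ‖N‖ ^ 2 = (n : ℝ) + 1 := by
      rw [hN, Complex.norm_real, Real.norm_eq_abs, sq_abs, Real.sq_sqrt (by positivity)]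
    have na : ‖a z‖ ^ 2 = ((n : ℝ) + 1) * ‖Θ z‖ ^ 2 := by
      rw [z13, Pi.smul_apply, norm_smul, mul_pow, hNN]
    have nb : ∀ j, ‖b j z‖ ^ 2 = ((n : ℝ) + 1) * ‖PΘ j z‖ ^ 2 := fun j => by
      rw [z14 j, Pi.smul_apply, norm_smul, mul_pow, hNN]
    have nr : ‖r z‖ ^ 2 / ‖(hd z).1‖ ≤ ∑ j, ‖W j z‖ ^ 2 := by
      have e1 : ∀ j, ‖W j z‖ ^ 2 = irWeight Λ (hd z) * ‖R j (tl z)‖ ^ 2 := fun j => by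
        rw [z12 j]
        simp only [ins, norm_mul, norm_wave, mul_one, mul_pow, Complex.norm_real,
          Real.norm_eq_abs, sq_abs, Real.sq_sqrt (irWeight_nonneg Λ (hd z))]
      have e2 : ‖r z‖ ≤ ∑ j, |potCoeff Λ ε j (hd z)| * ‖R j (tl z)‖ := by
        rw [z10]
        refine (norm_sum_le _ _).trans (Finset.sum_le_sum fun j _ => le_of_eq ?_)
        rw [z11 j]
        simp only [ins, norm_mul, norm_wave, mul_one, potC, Complex.norm_real, Real.norm_eq_abs]
      have e3 : ∑ j, potCoeff Λ ε j (hd z) ^ 2 = ‖(hd z).1‖ * irWeight Λ (hd z) := by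
        rw [sum_potCoeff_sq hε, irWeight]; field_simp
      rw [div_le_iff₀ hK]
      simp only [e1, ← Finset.mul_sum]
      calc ‖r z‖ ^ 2 ≤ (∑ j, |potCoeff Λ ε j (hd z)| * ‖R j (tl z)‖) ^ 2 := by gcongr
        _ ≤ (∑ j, |potCoeff Λ ε j (hd z)| ^ 2) * ∑ j, ‖R j (tl z)‖ ^ 2 :=
            Finset.sum_mul_sq_le_sq_mul_sq _ _ _
        _ = _ := by simp only [sq_abs, e3]; ring
    have rc : ∀ (t : ℝ) (x y : ℂ), ((starRingEnd ℂ) ((t : ℂ) * x) * y).re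
        = t * ((starRingEnd ℂ) x * y).re := fun t x y => by
      rw [map_mul, Complex.conj_ofReal, mul_assoc, Complex.re_ofReal_mul]
    have rc2 : ∀ (t : ℝ) (x y : ℂ), (x * ((t : ℂ) * y)).re = t * (x * y).re := fun t x y => by
      rw [mul_left_comm, Complex.re_ofReal_mul]
    have nU : ‖Us z‖ ^ 2 = denom (hd z) * ‖magF Λ ε ψ z‖ ^ 2 := by
      rw [z6, norm_mul, mul_pow, Complex.norm_real, Real.norm_eq_abs, sq_abs,
        Real.sq_sqrt (denom_nonneg _)]
    have nG : ∀ j, ‖Gd j z‖ ^ 2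
        = denom (hd z) ^ 2 * (‖(hd z).1‖ + 2) * ‖magF Λ ε (p j) z‖ ^ 2 := fun j => by
      rw [z7 j, norm_mul, mul_pow, Complex.norm_real, Real.norm_eq_abs, sq_abs, mul_pow,
        Real.sq_sqrt (by positivity)]
    have nV : ‖V z‖ ^ 2 = denom (hd z) ^ 2 * ‖(hd z).1‖ *
        (energy (tl z).2.2 * ‖magF Λ ε ψ z‖ ^ 2) := by
      rw [z8, z9, magF_energy, norm_mul, mul_pow, Complex.norm_real, Real.norm_eq_abs, sq_abs,
        mul_pow, Real.sq_sqrt (by positivity), norm_mul, mul_pow, Complex.norm_real,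
        Real.norm_eq_abs, sq_abs, Real.sq_sqrt hH, add_zero]
    have y1 : ((starRingEnd ℂ) (U1 z) * a z).re = ((starRingEnd ℂ) (magF Λ ε ψ z) * a z).re := by
      rw [z1, rc, one_mul]
    have y2 : ((starRingEnd ℂ) (UK z) * a z).re
        = denom (hd z) * ‖(hd z).1‖ ^ 2 * ((starRingEnd ℂ) (magF Λ ε ψ z) * a z).re := by
      rw [z2, rc]
    have y3 : ∀ j, ((starRingEnd ℂ) (Uk j z) * b j z).re
        = denom (hd z) * (hd z).1 j * ((starRingEnd ℂ) (magF Λ ε ψ z) * b j z).re := fun j => by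
      rw [z3 j, rc]
    have y4 : ∀ j, ((starRingEnd ℂ) (Gk j z) * a z).re
        = denom (hd z) * (hd z).1 j * ((starRingEnd ℂ) (magF Λ ε (p j) z) * a z).re := fun j => by
      rw [z4 j, rc]
    have y5 : ∀ j, ((starRingEnd ℂ) (Gk j z) * Uy z).re = denom (hd z) ^ 2 * (hd z).1 j *
        ((starRingEnd ℂ) (magF Λ ε (p j) z) * magF Λ ε ψ z).re := fun j => by
      rw [z4 j, z5, rc, rc2]; ring
    have y6 : ((starRingEnd ℂ) (r z) * Uy z).re
        = denom (hd z) * ((starRingEnd ℂ) (r z) * magF Λ ε ψ z).re := by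
      rw [z5, rc2]
    rw [y1, y2, y6, nU, nV]
    simp only [y3, y4, y5, nG]
    rw [na] at hmain
    simp only [nb] at hmain
    have e4 : ∑ j, ((n : ℝ) + 1) * (‖(hd z).1‖ / energy z.2.2 * ‖PΘ j z‖ ^ 2)
        = ‖(hd z).1‖ / energy z.2.2 * ∑ j, ((n : ℝ) + 1) * ‖PΘ j z‖ ^ 2 := by
      rw [Finset.mul_sum]; exact Finset.sum_congr rfl fun j _ => by ring
    have e5 : ((n : ℝ) + 1) * (‖(hd z).1‖ * ‖Θ z‖ ^ 2)
        = ‖(hd z).1‖ * (((n : ℝ) + 1) * ‖Θ z‖ ^ 2) := by ring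
    rw [e4, e5]
    linarith)
  -- the values of the integrals; the interference terms vanish by parity
  have v1 := inner_magL_one hΛ hε ψ Θ
  have v2 : inner ℂ r a = ∑ j, inner ℂ (R j) (annL (memLp_potC hΛ hε j) Θ) := by
    rw [hr, sum_inner]
    exact Finset.sum_congr rfl fun j _ => by rw [ha, inner_smul_right, hN, inner_insL_eq]
  have v3 := congrArg Complex.re (sum_inner_magL_coord hΛ hε hp fun j => (hb j).smul N)
  rw [Complex.add_re, Complex.sub_re, Complex.re_sum, Complex.re_sum, Complex.zero_re] at v3
  have v4 : inner ℂ r Uy = 0 := by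
    rw [hr, sum_inner]
    exact Finset.sum_eq_zero fun j _ => inner_insL_magL hΛ hε (isWeight_denom hΛ hε)
      (ρ := fun K => 1 / (K + K ^ 2)) (fun q => rfl) j (R j) ψ
  have v5 : ∀ j, inner ℂ (Gk j) Uy = 0 := fun j =>
    inner_magL_coord hε (isWeight_denom_coord hΛ hε j) (isWeight_denom hΛ hε)
      (ρ := fun K => (1 / (K + K ^ 2)) ^ 2) j (fun q => by unfold denom; ring) (p j) ψ
  have v6 : ‖Us‖ ^ 2 = spinShiftEnergy Λ * ‖ψ‖ ^ 2 := by
    rw [hUs, norm_magL_sq, ← (integral_denom_magCoeff hΛ hε).2]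
    simp only [Real.sq_sqrt (denom_nonneg _)]
  have hw : ∀ (c : ℝ), 0 ≤ c → ∀ q, (denom q * Real.sqrt (‖q.1‖ + c)) ^ 2
      * ∑ m, magCoeff Λ ε m q ^ 2 ≤ (max 1 c) * irWeight Λ q := by
    intro c hc q
    have h1 := denom_sq_mul_magCoeff_le (Λ := Λ) hε q
    have h2 : ‖q.1‖ + c ≤ max 1 c * (‖q.1‖ + 1) := by
      have := mul_le_mul_of_nonneg_right (le_max_left 1 c) (norm_nonneg q.1)
      have := le_max_right 1 c
      linarith
    rw [mul_pow, Real.sq_sqrt (by positivity)]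
    have h3 : 0 ≤ denom q ^ 2 * ∑ m, magCoeff Λ ε m q ^ 2 := by positivity
    have h4 : 0 ≤ max 1 c := le_trans zero_le_one (le_max_left 1 c)
    linarith [mul_le_mul_of_nonneg_left h2 h3, mul_le_mul_of_nonneg_left h1 h4]
  have v7 : ∀ j, ‖Gd j‖ ^ 2 ≤ 2 * (2 * Λ / Real.pi) * ‖p j‖ ^ 2 := fun j => by
    rw [hGd, norm_magL_sq]
    refine mul_le_mul_of_nonneg_right (integral_weight_le hΛ fun q => ?_) (sq_nonneg _)
    simpa using hw 2 (by norm_num) q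
  have v8 : ‖V‖ ^ 2 ≤ 1 * (2 * Λ / Real.pi) * ‖f‖ ^ 2 := by
    rw [hV, norm_magL_sq]
    refine mul_le_mul_of_nonneg_right (integral_weight_le hΛ fun q => ?_) (sq_nonneg _)
    simpa using hw 0 le_rfl q
  have v9 : ∀ j, ‖W j‖ ^ 2 = 2 * Λ / Real.pi * ‖R j‖ ^ 2 := fun j => norm_insL_sqrt_irWeight hΛ _
  have v10 : ∑ j, ((n : ℝ) + 1) * T j ≤ ∑ j, ‖PΘ j‖ ^ 2 := Finset.sum_le_sum fun j _ =>
    (hPΘ j).integral_energy_ratio_le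
  have v7' := mul_le_mul_of_nonneg_left (Finset.sum_le_sum fun j (_ : j ∈ Finset.univ) => v7 j)
    (show 0 ≤ 4 * s ^ 2 by positivity)
  have v8' := mul_le_mul_of_nonneg_left v8 (show 0 ≤ 8 * s ^ 2 by positivity)
  have v10' := mul_le_mul_of_nonneg_left v10 hζ0.le
  rw [v1, v2, v4, v6] at hnn
  simp only [v5, v9, Complex.zero_re, Finset.sum_const_zero, mul_zero, add_zero,
    Complex.re_sum] at hnn
  rw [v3] at hnn
  simp only [← Finset.mul_sum] at hnn v7' v10'
  linarith

end SectorInequality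

/-! ### The lower bound -/

section LowerBound

variable {Λ : ℝ} {ε : Fin 2 → R3 → R3}

/-- The main term of the ground state energy. -/
def mainTerm (α Λ : ℝ) : ℝ := 2 * (α / Real.pi) * (Λ - Real.log (1 + Λ))

theorem mainTerm_eq (α Λ : ℝ) :
    mainTerm α Λ = α * (Λ ^ 2 / Real.pi) - α * spinShiftEnergy Λ := by
  unfold mainTerm spinShiftEnergy
  field_simp
  ring

theorem spinShiftEnergy_nonneg (hΛ : 0 < Λ) (hε : IsPolarization ε) : 0 ≤ spinShiftEnergy Λ := by
  rw [← (integral_denom_magCoeff hΛ hε).2]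
  exact integral_nonneg fun q => mul_nonneg (denom_nonneg q)
    (Finset.sum_nonneg fun _ _ => sq_nonneg _)

theorem spinShiftEnergy_le (hΛ : 0 < Λ) : spinShiftEnergy Λ ≤ Λ ^ 2 / Real.pi := by
  have h := Real.log_le_sub_one_of_pos (show 0 < 1 + Λ by linarith)
  have : spinShiftEnergy Λ = (Λ ^ 2 + 2 * (Real.log (1 + Λ) - Λ)) / Real.pi := by
    unfold spinShiftEnergy
    field_simp
    ring
  rw [this]
  gcongr
  linarith

theorem inv_pi_le : 1 / Real.pi ≤ 1 / 3 :=
  one_div_le_one_div_of_le (by norm_num) Real.pi_gt_three.le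

theorem hasSum_norm_sq_succ (Ψ : State) :
    HasSum (fun n => ‖sec Ψ (n + 1)‖ ^ 2) (‖Ψ‖ ^ 2 - ‖sec Ψ 0‖ ^ 2) := by
  simpa using (hasSum_nat_add_iff' 1).2 (hasSum_norm_sq_sec Ψ)

/-- The sum of `sector_inequality` over all photon numbers. -/
theorem coupling_inequality (hΛ : 0 < Λ) (hε : IsPolarization ε) {ζ : ℝ} (s : ℝ) (hζ : 1 / 2 ≤ ζ)
    {Ψ F : State} {P : Fin 3 → State} (R : Fin 3 → State) {D Db : Fin 3 → State}
    (hF : SqrtFieldEnergy Ψ F) (hP : ∀ j, Momentum j Ψ (P j))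
    (hD : ∀ j, IsAnn (memLp_potC hΛ hε j) Ψ (D j))
    (hDb : ∀ j, IsAnn (memLp_magC hΛ hε j) Ψ (Db j)) :
    0 ≤ ζ * (‖F‖ ^ 2 + ∑ j, ‖P j‖ ^ 2)
      + 2 * s * (inner ℂ Ψ (∑ m, sigma m (Db m)) : ℂ).re
      + 2 * ∑ j, (inner ℂ (R j) (D j) : ℂ).re
      + s ^ 2 / ζ * (spinShiftEnergy Λ * ‖Ψ‖ ^ 2)
      + 2 * Λ / Real.pi * (8 * s ^ 2 * ∑ j, ‖P j‖ ^ 2 + 8 * s ^ 2 * ‖F‖ ^ 2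
        + 4 * ∑ j, ‖R j‖ ^ 2) := by
  have hsum := (((((((hasSum_norm_sq_succ F).add (hasSum_sum (s := Finset.univ)
    fun j _ => hasSum_norm_sq_succ (P j))).mul_left ζ).add
    ((hasSum_re_inner_sec Ψ (∑ m, sigma m (Db m))).mul_left (2 * s))).add
    ((hasSum_sum (s := Finset.univ) fun j _ => hasSum_re_inner_sec (R j) (D j)).mul_left 2)).add
    (((hasSum_norm_sq_sec Ψ).mul_left (spinShiftEnergy Λ)).mul_left (s ^ 2 / ζ))).add
    (((((hasSum_sum (s := Finset.univ) fun j _ => hasSum_norm_sq_sec (P j)).mul_left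
      (8 * s ^ 2)).add ((hasSum_norm_sq_sec F).mul_left (8 * s ^ 2))).add
      ((hasSum_sum (s := Finset.univ) fun j _ => hasSum_norm_sq_sec (R j)).mul_left 4)).mul_left
      (2 * Λ / Real.pi)))
  have hnn := hsum.nonneg fun n => by
    have h := sector_inequality hΛ hε s hζ (fun j => sec (R j) n) (isSym_sec Ψ (n + 1))
      (fun j => isSym_sec (P j) (n + 1)) (hF.sec n) (hF.sec (n + 1)) (fun j => (hP j).sec n)
      (fun j => (hP j).sec (n + 1))
    have e1 : ∀ j, annL (memLp_potC hΛ hε j) (sec Ψ (n + 1)) = sec (D j) n := fun j =>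
      (hD j n).symm
    have e2 : ∑ m, spinL (pauli m) (annL (memLp_magC hΛ hε m) (sec Ψ (n + 1)))
        = sec (∑ m, sigma m (Db m)) n := by
      rw [sec_sum]
      exact Finset.sum_congr rfl fun m _ => by rw [sec_sigma, hDb m n]; rfl
    rw [e2] at h
    simp only [e1] at h
    exact h
  have h0 : 0 ≤ ζ * (‖sec F 0‖ ^ 2 + ∑ j, ‖sec (P j) 0‖ ^ 2) := by positivity
  rw [Finset.sum_sub_distrib] at hnn
  linarith

theorem norm_sq_two_smul_add_smul_le {α s : ℝ} (hα : 0 < α) (hs0 : 0 ≤ s) (hs : s ^ 2 = α)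
    (X Y : State) :
    ‖((2 * s : ℝ) : ℂ) • X + (α : ℂ) • Y‖ ^ 2 ≤ 8 * α * ‖X‖ ^ 2 + 2 * α ^ 2 * ‖Y‖ ^ 2 := by
  have h2 := norm_add_le (((2 * s : ℝ) : ℂ) • X) ((α : ℂ) • Y)
  rw [norm_smul, norm_smul, Complex.norm_real, Complex.norm_real, Real.norm_eq_abs,
    Real.norm_eq_abs, abs_of_nonneg (by positivity), abs_of_pos hα] at h2
  have h3 := pow_le_pow_left₀ (norm_nonneg _) h2 2
  have h4 : 2 * (2 * s * ‖X‖) ^ 2 = 8 * α * ‖X‖ ^ 2 := by rw [← hs]; ring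
  have h5 := sq_nonneg (2 * s * ‖X‖ - α * ‖Y‖)
  linarith only [h3, h4, h5]

/-- The arithmetic of the lower bound for small `αΛ`; `N`, `P`, `F`, `D`, `R` are squared norms and
`ϖ = 1 / π`. -/
theorem form_arithmetic {α Λ X N P F D R I J M s ϖ : ℝ} (hα : 0 < α) (hΛ : 0 < Λ)
    (hsmall : α * Λ ≤ 1 / 64) (hX0 : 0 ≤ X) (hX1 : X ≤ Λ ^ 2 * ϖ) (p0 : 0 < ϖ) (p1 : ϖ ≤ 1 / 3)
    (n1 : 0 ≤ N) (n2 : 0 ≤ P) (n3 : 0 ≤ F) (n4 : 0 ≤ D)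
    (hR : R ≤ 8 * α * P + 2 * α ^ 2 * (Λ ^ 2 * ϖ * N + D))
    (h1 : 0 ≤ (1 - 32 * (α * Λ)) * (F + P) + 2 * s * M + 2 * (2 * s * I + α * J)
      + α / (1 - 32 * (α * Λ)) * (X * N) + 2 * Λ * ϖ * (8 * α * P + 8 * α * F + 4 * R)) :
    (α * (Λ ^ 2 * ϖ) - α * X - 24 * (α ^ 2 * Λ ^ 3)) * N
      ≤ P + F + α * (Λ ^ 2 * ϖ) * N + 2 * α * D + 4 * s * I + 2 * α * J + 2 * s * M := by
  have hζ0 : 0 < 1 - 32 * (α * Λ) := by linarith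
  have hδ : 0 < α * Λ := by positivity
  have e3 := mul_le_mul_of_nonneg_left hR (show 0 ≤ 2 * Λ * ϖ * 4 by positivity)
  -- `1 / ζ ≤ 1 + 64 αΛ` for `ζ = 1 - 32 αΛ`
  have z1 : α / (1 - 32 * (α * Λ)) * (X * N) ≤ α * (1 + 64 * (α * Λ)) * (X * N) := by
    refine mul_le_mul_of_nonneg_right ?_ (mul_nonneg hX0 n1)
    rw [div_le_iff₀ hζ0, mul_assoc]
    refine le_mul_of_one_le_right hα.le ?_
    nlinarith
  have z2 : α * (64 * (α * Λ)) * (X * N) ≤ α * (64 * (α * Λ)) * (Λ ^ 2 * (1 / 3) * N) := by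
    have : X ≤ Λ ^ 2 * (1 / 3) := hX1.trans (by gcongr)
    gcongr
  have z3 : α * Λ * ϖ * (P + F) ≤ α * Λ * (1 / 3) * (P + F) := by gcongr
  have z4 : α * (α * Λ) * ϖ * D ≤ α * (1 / 64) * (1 / 3) * D := by gcongr
  have z5 : α ^ 2 * Λ ^ 3 * (ϖ * ϖ) * N ≤ α ^ 2 * Λ ^ 3 * (1 / 3 * (1 / 3)) * N := by gcongr
  have z6 : 0 ≤ α * Λ * F := by positivity
  have z7 : 0 ≤ α * D := by positivity
  have z8 : 0 ≤ α ^ 2 * Λ ^ 3 * N := by positivity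
  have z9 : 0 ≤ α * Λ * P := by positivity
  have z10 : 0 ≤ α * Λ * ϖ * F := by positivity
  linarith

/-- Normalization errors are of second order in the coupling if `αΛ` is small. -/
theorem formValue_ge_of_small (hΛ : 0 < Λ) (hε : IsPolarization ε) {α : ℝ} (hα : 0 < α)
    (hsmall : α * Λ ≤ 1 / 64) {Ψ : State} {P A : Fin 3 → State} {S F : State}
    (hf : InFormDomain Λ ε Ψ P A S F) :
    (mainTerm α Λ - 24 * (α ^ 2 * Λ ^ 3)) * ‖Ψ‖ ^ 2 ≤ formValue α Ψ P A S F := by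
  obtain ⟨D, C, Db, Cb, K, h, -, -⟩ := exists_fieldParts hΛ hε hf.energy
  have hs : Real.sqrt α ^ 2 = α := Real.sq_sqrt hα.le
  have h1 := coupling_inequality hΛ hε (Real.sqrt α) (ζ := 1 - 32 * (α * Λ)) (by linarith)
    (fun j => ((2 * Real.sqrt α : ℝ) : ℂ) • P j + (α : ℂ) • C j)
    hf.energy hf.momentum h.annA h.annB
  rw [h.formValue_eq hα hf]
  have e1 : ∀ j, (inner ℂ (((2 * Real.sqrt α : ℝ) : ℂ) • P j + (α : ℂ) • C j) (D j) : ℂ).re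
      = 2 * Real.sqrt α * (inner ℂ (P j) (D j) : ℂ).re
        + α * (inner ℂ (C j) (D j) : ℂ).re := fun j => by
    rw [inner_add_left, state_inner_smul_left, state_inner_smul_left, Complex.conj_ofReal,
      Complex.conj_ofReal, Complex.add_re, Complex.re_ofReal_mul, Complex.re_ofReal_mul]
  have e3 := Finset.sum_le_sum fun j (_ : j ∈ Finset.univ) =>
    norm_sq_two_smul_add_smul_le hα (Real.sqrt_nonneg α) hs (P j) (C j)
  rw [Finset.sum_add_distrib, ← Finset.mul_sum, ← Finset.mul_sum, h.sum_norm_creA_sq] at e3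
  simp only [e1, Finset.sum_add_distrib, ← Finset.mul_sum] at h1
  have q1 : Λ ^ 2 / Real.pi = Λ ^ 2 * (1 / Real.pi) := by ring
  have q2 : 2 * Λ / Real.pi = 2 * Λ * (1 / Real.pi) := by ring
  have hX1 := spinShiftEnergy_le hΛ
  rw [mainTerm_eq]
  rw [q1] at e3 hX1 ⊢
  rw [q2, hs] at h1
  have := form_arithmetic hα hΛ hsmall (spinShiftEnergy_nonneg hΛ hε) hX1 (by positivity)
    inv_pi_le (sq_nonneg _) (Finset.sum_nonneg fun _ _ => sq_nonneg _) (sq_nonneg _)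
    (Finset.sum_nonneg fun _ _ => sq_nonneg _) e3 h1
  linarith only [this]

/-- The lower bound on the quadratic form. For large `αΛ` the right-hand side is nonnegative
and the main term is dominated by the error. -/
theorem formValue_ge (hΛ : 0 < Λ) (hε : IsPolarization ε) {α : ℝ} (hα : 0 < α) {Ψ : State}
    {P A : Fin 3 → State} {S F : State} (hf : InFormDomain Λ ε Ψ P A S F) :
    (mainTerm α Λ - 100 * α ^ 2 * (Λ ^ 2 + Λ ^ 3)) * ‖Ψ‖ ^ 2 ≤ formValue α Ψ P A S F := by
  rcases le_or_gt (α * Λ) (1 / 64) with h | h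
  · refine le_trans (mul_le_mul_of_nonneg_right ?_ (sq_nonneg _))
      (formValue_ge_of_small hΛ hε hα h hf)
    have h1 : 0 ≤ α ^ 2 * Λ ^ 2 := by positivity
    have h2 : 0 ≤ α ^ 2 * Λ ^ 3 := by positivity
    linarith
  · refine le_trans (mul_nonpos_of_nonpos_of_nonneg ?_ (sq_nonneg _)) (formValue_nonneg hΛ hε hf)
    have h1 : mainTerm α Λ ≤ α * Λ := by
      unfold mainTerm
      have h2 := Real.log_nonneg (show 1 ≤ 1 + Λ by linarith)
      have h3 := mul_le_mul_of_nonneg_left inv_pi_le (show 0 ≤ 2 * (α * Λ) by positivity)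
      have h4 : 0 ≤ 2 * (α / Real.pi) * Real.log (1 + Λ) := by positivity
      have h5 : 2 * (α / Real.pi) * Λ = 2 * (α * Λ) * (1 / Real.pi) := by ring
      have h6 : 0 < α * Λ := by positivity
      linarith
    have h2 : α * Λ ≤ 64 * (α * Λ) ^ 2 := by nlinarith
    have h3 : 0 ≤ α ^ 2 * Λ ^ 3 := by positivity
    have h4 : 0 ≤ α ^ 2 * Λ ^ 2 := by positivity
    linarith

end LowerBound

/-! ### The upper bound -/

section SlowElectron

instance : IsFiniteMeasure (innerMeasure 0) := by
  have : IsFiniteMeasure (Measure.pi fun _ : Fin 0 => photonMeasure) := by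
    rw [Measure.pi_of_empty]; infer_instance
  unfold innerMeasure
  infer_instance

/-- The state without photons whose electron wave function is `f`, for both spins. -/
def electronL {f : R3 → ℂ} (hf : MemLp f 2) : SectorSpace 0 :=
  (hf.comp_fst (innerMeasure 0)).toLp

theorem coeFn_electronL {f : R3 → ℂ} (hf : MemLp f 2) :
    electronL hf =ᵐ[sectorMeasure 0] fun z => f z.1 := MemLp.coeFn_toLp _

theorem norm_electronL_sq {f : R3 → ℂ} (hf : MemLp f 2) :
    ‖electronL hf‖ ^ 2 = (innerMeasure 0).real Set.univ * ∫ x, ‖f x‖ ^ 2 := by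
  rw [norm_sq_eq_integral, integral_congr_ae ((coeFn_electronL hf).mono fun z hz => by
    show _ = ‖f z.1‖ ^ 2; rw [hz])]
  exact integral_fun_fst fun x => ‖f x‖ ^ 2

theorem isMom_electronL {f : R3 → ℂ} (hf : ContDiff ℝ ∞ f) (hc : HasCompactSupport f) (j : Fin 3)
    (h1 : MemLp f 2)
    (h2 : MemLp (fun x => -Complex.I * fderiv ℝ f x (EuclideanSpace.single j 1)) 2) :
    IsMom j (electronL h1) (electronL h2) := by
  filter_upwards [ae_section (coeFn_electronL h1), ae_section (coeFn_electronL h2)] with y e1 e2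
  refine WeakMomentum.congr_ae (fun φ hφ hφc => ?_) (Filter.EventuallyEq.symm e1)
    (Filter.EventuallyEq.symm e2)
  set e : R3 := EuclideanSpace.single j 1
  have cf : Continuous fun x => fderiv ℝ f x e :=
    (hf.continuous_fderiv (by simp)).clm_apply continuous_const
  have cφ : Continuous fun x => fderiv ℝ φ x e :=
    (hφ.continuous_fderiv (by simp)).clm_apply continuous_const
  have key := integral_mul_fderiv_eq_neg_fderiv_mul_of_integrable (𝕜 := ℂ) (μ := volume)
    (f := φ) (g := f) (v := e)
    ((cφ.mul hf.continuous).integrable_of_hasCompactSupport hc.mul_left)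
    ((hφ.continuous.mul cf).integrable_of_hasCompactSupport hφc.mul_right)
    ((hφ.continuous.mul hf.continuous).integrable_of_hasCompactSupport hφc.mul_right)
    (fun x _ => hφ.differentiable (by simp) x) (fun x _ => hf.differentiable (by simp) x)
  calc ∫ x, φ x * (-Complex.I * fderiv ℝ f x e) = ∫ x, -Complex.I * (φ x * fderiv ℝ f x e) := by
        congr 1; funext x; ring
    _ = Complex.I * ∫ x, fderiv ℝ φ x e * f x := by
        rw [integral_const_mul, key]; ring

/-- Wave functions spread over a large region have small kinetic energy. -/
theorem exists_slow {δ : ℝ} (hδ : 0 < δ) :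
    ∃ (h : SectorSpace 0) (g : Fin 3 → SectorSpace 0), 0 < ‖h‖ ∧ (∀ j, IsMom j h (g j)) ∧
      ∑ j, ‖g j‖ ^ 2 ≤ δ * ‖h‖ ^ 2 := by
  obtain ⟨χ⟩ : Nonempty (ContDiffBump (0 : R3)) := inferInstance
  set f : R3 → ℂ := fun x => (χ x : ℂ) with hfdef
  have hf : ContDiff ℝ ∞ f := Complex.ofRealCLM.contDiff.comp χ.contDiff
  have hc : HasCompactSupport f :=
    χ.hasCompactSupport.comp_left (g := fun r : ℝ => (r : ℂ)) (by simp)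
  set a : ℝ := ∫ x, ‖f x‖ ^ 2
  set b : ℝ := ∑ j : Fin 3, ∫ x, ‖fderiv ℝ f x (EuclideanSpace.single j 1)‖ ^ 2
  have ha : 0 < a := by
    refine Continuous.integral_pos_of_hasCompactSupport_nonneg_nonzero (x := (0 : R3))
      (hf.continuous.norm.pow 2) (hc.comp_left (g := fun z : ℂ => ‖z‖ ^ 2) (by simp))
      (fun x => sq_nonneg _) ?_
    have : χ (0 : R3) = 1 := χ.one_of_mem_closedBall (by simp [χ.rIn_pos.le])
    simp [hfdef, this]
  have hb : 0 ≤ b := Finset.sum_nonneg fun _ _ => integral_nonneg fun _ => sq_nonneg _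
  obtain ⟨c, hc0, hcb⟩ : ∃ c : ℝ, 0 < c ∧ c ^ 2 * b ≤ δ * a := by
    refine ⟨Real.sqrt (δ * a / (b + 1)), by positivity, ?_⟩
    rw [Real.sq_sqrt (by positivity), div_mul_eq_mul_div, div_le_iff₀ (by positivity)]
    exact mul_le_mul_of_nonneg_left (by linarith) (by positivity)
  set F : R3 → ℂ := fun x => f (c • x) with hF
  have hF1 : ContDiff ℝ ∞ F := hf.comp (contDiff_const_smul c)
  have hFc : HasCompactSupport F := hc.comp_smul hc0.ne'
  have hd : ∀ (j : Fin 3) x, fderiv ℝ F x (EuclideanSpace.single j 1)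
      = (c : ℂ) * fderiv ℝ f (c • x) (EuclideanSpace.single j 1) := fun j x => by
    rw [hF, fderiv_comp_smul]; simp
  have m1 : MemLp F 2 := hF1.continuous.memLp_of_hasCompactSupport hFc
  have m2 : ∀ j : Fin 3,
      MemLp (fun x => -Complex.I * fderiv ℝ F x (EuclideanSpace.single j 1)) 2 := fun j => by
    refine Continuous.memLp_of_hasCompactSupport
      (continuous_const.mul ((hF1.continuous_fderiv (by simp)).clm_apply continuous_const)) ?_
    exact ((hFc.fderiv (𝕜 := ℝ)).comp_left (g := fun L : R3 →L[ℝ] ℂ =>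
      -Complex.I * L (EuclideanSpace.single j 1)) (by simp))
  set v := |(c ^ Module.finrank ℝ R3)⁻¹| with hv
  have hv0 : 0 < v := by positivity
  have n1 : ‖electronL m1‖ ^ 2 = (innerMeasure 0).real Set.univ * (v * a) := by
    rw [norm_electronL_sq]
    have := Measure.integral_comp_smul (volume : Measure R3) (fun x => ‖f x‖ ^ 2) c
    rw [smul_eq_mul] at this
    rw [← this]
  have n2 : ∑ j, ‖electronL (m2 j)‖ ^ 2 = (innerMeasure 0).real Set.univ * (v * (c ^ 2 * b)) := by
    simp only [norm_electronL_sq, ← Finset.mul_sum, b]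
    congr 1
    simp only [Finset.mul_sum]
    refine Finset.sum_congr rfl fun j _ => ?_
    have := Measure.integral_comp_smul (volume : Measure R3)
      (fun x => ‖fderiv ℝ f x (EuclideanSpace.single j 1)‖ ^ 2) c
    rw [smul_eq_mul, ← hv] at this
    rw [mul_left_comm, ← this, ← integral_const_mul]
    refine integral_congr_ae (ae_of_all _ fun x => ?_)
    simp only [hd, norm_mul, norm_neg, Complex.norm_I, one_mul, Complex.norm_real, mul_pow,
      Real.norm_eq_abs, sq_abs]
  have hu : 0 < (innerMeasure 0).real Set.univ := by
    refine ENNReal.toReal_pos ?_ (measure_ne_top _ _)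
    simp [innerMeasure, ← Set.univ_prod_univ, Measure.prod_prod]
  refine ⟨electronL m1, fun j => electronL (m2 j), ?_,
    fun j => isMom_electronL hF1 hFc j m1 (m2 j), ?_⟩
  · have : 0 < ‖electronL m1‖ ^ 2 := by rw [n1]; positivity
    exact lt_of_pow_lt_pow_left₀ 2 (norm_nonneg _) (by simpa using this)
  · rw [n1, n2]
    have := mul_le_mul_of_nonneg_left hcb
      (show 0 ≤ (innerMeasure 0).real Set.univ * v by positivity)
    linarith

end SlowElectron

section Trial

variable {Λ : ℝ} {ε : Fin 2 → R3 → R3}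

theorem isSym_of_subsingleton {n : ℕ} (hn : n ≤ 1) (h : SectorSpace n) : IsSym h := fun τ => by
  have : Subsingleton (Fin n) := Fin.subsingleton_iff_le_one.2 hn
  rw [Subsingleton.elim τ 1, permL_one]

/-- The components of a state with at most one photon. -/
def pairFun (a : SectorSpace 0) (b : SectorSpace 1) : ∀ n, SectorSpace n
  | 0 => a
  | 1 => b
  | _ + 2 => 0

/-- The state with at most one photon and the given components. -/
def pairState (a : SectorSpace 0) (b : SectorSpace 1) : State :=
  mkState (pairFun a b) (fun n => match n with
    | 0 => isSym_of_subsingleton (by norm_num) _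
    | 1 => isSym_of_subsingleton le_rfl _
    | _ + 2 => fun _ => map_zero _)
    (summable_of_ne_finset_zero (s := Finset.range 2) fun n hn => by
      match n with
      | 0 => simp at hn
      | 1 => simp at hn
      | _ + 2 => simp [pairFun])

variable (a a' : SectorSpace 0) (b b' : SectorSpace 1)

theorem sec_pairState_zero : sec (pairState a b) 0 = a := rfl

theorem sec_pairState_one : sec (pairState a b) 1 = b := rfl

theorem sec_pairState_add_two (n : ℕ) : sec (pairState a b) (n + 2) = 0 := rfl

theorem inner_pairState (Φ : State) :
    inner ℂ (pairState a b) Φ = inner ℂ a (sec Φ 0) + inner ℂ b (sec Φ 1) := by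
  refine (hasSum_inner_sec _ _).unique ?_
  have h : HasSum (fun n => (inner ℂ (sec (pairState a b) n) (sec Φ n) : ℂ))
      (∑ n ∈ Finset.range 2, inner ℂ (sec (pairState a b) n) (sec Φ n)) :=
    hasSum_sum_of_ne_finset_zero fun n hn => by
      match n with
      | 0 => simp at hn
      | 1 => simp at hn
      | n + 2 => rw [sec_pairState_add_two, inner_zero_left]
  simpa [Finset.sum_range_succ, sec_pairState_zero, sec_pairState_one] using h

theorem norm_pairState_sq : ‖pairState a b‖ ^ 2 = ‖a‖ ^ 2 + ‖b‖ ^ 2 := by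
  have h := inner_pairState a b (pairState a b)
  rw [state_inner_self, sec_pairState_zero, sec_pairState_one, inner_self_eq_ofReal,
    inner_self_eq_ofReal] at h
  exact_mod_cast h

theorem IsWeight.integrable {w : Photon → ℝ} (hw : IsWeight Λ ε w) :
    Integrable (fun q => w q ^ 2 * ∑ m, magCoeff Λ ε m q ^ 2) photonMeasure := by
  simp only [Finset.mul_sum]
  refine integrable_finsetSum _ fun m _ => ?_
  have h1 := (memLp_two_iff_integrable_sq_norm (hw m).1).1 (hw m)
  simpa [magC, mul_pow] using h1

theorem isSqrtEnergy_magL (hΛ : 0 < Λ) (hε : IsPolarization ε) (h : SectorSpace 0) :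
    IsSqrtEnergy (magL (isWeight_denom hΛ hε) h)
      (magL (isWeight_denom_sqrt hΛ hε le_rfl) h) := by
  filter_upwards [coeFn_magL (isWeight_denom hΛ hε) h,
    coeFn_magL (isWeight_denom_sqrt hΛ hε le_rfl) h] with z h1 h2
  have e : energy z.2.2 = ‖(hd z).1‖ + 0 := by rw [energy_succ]; simp [energy]
  rw [h1, h2, e]
  push_cast
  ring

theorem IsSqrtEnergy.smul {n : ℕ} {h g : SectorSpace n} (hg : IsSqrtEnergy h g) (c : ℂ) :
    IsSqrtEnergy (c • h) (c • g) := by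
  filter_upwards [hg, Lp.coeFn_smul c h, Lp.coeFn_smul c g] with z h1 h2 h3
  rw [h3, h2, Pi.smul_apply, Pi.smul_apply, h1, smul_eq_mul, smul_eq_mul]
  ring

theorem isSqrtEnergy_zero {n : ℕ} : IsSqrtEnergy (0 : SectorSpace n) 0 := by
  filter_upwards [Lp.coeFn_zero ℂ 2 (sectorMeasure n)] with z h1
  rw [h1]; simp

theorem isSqrtEnergy_vacuum (h : SectorSpace 0) : IsSqrtEnergy h 0 := by
  filter_upwards [Lp.coeFn_zero ℂ 2 (sectorMeasure 0)] with z h1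
  rw [h1]; simp [energy]

/-- The kinetic and the field energy of the photon add up to `denom⁻¹`. -/
theorem sum_integral_denom_sq (hΛ : 0 < Λ) (hε : IsPolarization ε) :
    ∑ j : Fin 3, (∫ q, (denom q * q.1 j) ^ 2 * ∑ m, magCoeff Λ ε m q ^ 2 ∂photonMeasure)
      + ∫ q, (denom q * Real.sqrt (‖q.1‖ + 0)) ^ 2 * ∑ m, magCoeff Λ ε m q ^ 2 ∂photonMeasure
      = spinShiftEnergy Λ := by
  rw [← integral_finsetSum _ fun j _ => (isWeight_denom_coord hΛ hε j).integrable,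
    ← integral_add (integrable_finsetSum _ fun j _ => (isWeight_denom_coord hΛ hε j).integrable)
      (isWeight_denom_sqrt hΛ hε le_rfl).integrable, ← (integral_denom_magCoeff hΛ hε).2]
  refine integral_congr_ae (ae_of_all _ fun q => ?_)
  simp only [← Finset.sum_mul, ← add_mul, mul_pow, ← Finset.mul_sum, add_zero,
    Real.sq_sqrt (norm_nonneg q.1)]
  congr 1
  have h1 : ∑ j, q.1 j ^ 2 = ‖q.1‖ ^ 2 := by
    rw [EuclideanSpace.norm_sq_eq]; simp
  rw [h1, ← mul_add, denom]
  rcases eq_or_lt_of_le (norm_nonneg q.1) with h0 | h0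
  · simp [← h0]
  · have : ‖q.1‖ + ‖q.1‖ ^ 2 ≠ 0 := by positivity
    field_simp
    ring

/-- The arithmetic of the upper bound; `N` and `G` are the squared norm and the kinetic energy of
the electron, `X` is the energy gained by the emission of a photon and `α Y` its probability. -/
theorem trial_arithmetic {α Λ δ X Y V W N G c s : ℝ} (hα : 0 < α) (hΛ : 0 < Λ) (hN : 0 ≤ N)
    (hY : 0 ≤ Y) (hY1 : Y ≤ Λ) (hX1 : X ≤ Λ ^ 2) (hG : G ≤ δ * N) (hVW : V + W = X)
    (hs : s ^ 2 = α) :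
    G + α * (Y * G + V * N) + α * (W * N) + α * c * (N + α * (Y * N)) + 0 + 0 + 0
      + 2 * s * (-s * (X * N)) ≤ (α * c - α * X + α ^ 2 * Λ ^ 3 + δ) * (N + α * (Y * N)) := by
  have t1 : α * Y * G ≤ α * Y * (δ * N) := by gcongr
  have t2 : α ^ 2 * (X * Y) * N ≤ α ^ 2 * (Λ ^ 2 * Λ) * N := by gcongr
  have t3 : 0 ≤ α ^ 2 * Λ ^ 3 * (α * (Y * N)) := by positivity
  have t4 : 2 * s * (-s * (X * N)) = -(2 * α * (X * N)) := by rw [← hs]; ring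
  rw [t4, ← hVW] at *
  linarith

/-- The upper bound on the infimum of the quadratic form: in the trial states the electron is slow
and a single photon is emitted by the spin. -/
theorem exists_formValue_le (hΛ : 0 < Λ) (hε : IsPolarization ε) {α : ℝ} (hα : 0 < α) {δ : ℝ}
    (hδ : 0 < δ) :
    ∃ (Ψ : State) (P A : Fin 3 → State) (S F : State), InFormDomain Λ ε Ψ P A S F ∧ 0 < ‖Ψ‖ ∧
      formValue α Ψ P A S F ≤ (mainTerm α Λ + α ^ 2 * Λ ^ 3 + δ) * ‖Ψ‖ ^ 2 := by
  obtain ⟨h, g, h0, hg, hle⟩ := exists_slow hδ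
  have hs : Real.sqrt α ^ 2 = α := Real.sq_sqrt hα.le
  set s := Real.sqrt α with hsdef
  have hw := isWeight_denom hΛ hε
  have hwj := isWeight_denom_coord hΛ hε
  have hwe := isWeight_denom_sqrt hΛ hε (le_refl (0 : ℝ))
  set Ψ := pairState h ((-s : ℂ) • magL hw h) with hΨ
  set P := fun j => pairState (g j) ((-s : ℂ) • (magL hw (g j) - magL (hwj j) h)) with hP
  set F := pairState 0 ((-s : ℂ) • magL hwe h) with hF
  have hmom : ∀ j, Momentum j Ψ (P j) := fun j => momentum_iff.2 fun n => match n with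
    | 0 => hg j
    | 1 => ((hg j).magL hw (hwj j)).smul _
    | _ + 2 => IsMom.zero
  have hen : SqrtFieldEnergy Ψ F := fun n => match n with
    | 0 => isSqrtEnergy_vacuum h
    | 1 => (isSqrtEnergy_magL hΛ hε h).smul _
    | _ + 2 => isSqrtEnergy_zero
  obtain ⟨D, C, Db, Cb, K, hp, -, -⟩ := exists_fieldParts hΛ hε hen
  have hf : InFormDomain Λ ε Ψ P (fun j => D j + C j) (∑ m, sigma m (Db m + Cb m)) F :=
    ⟨hmom, hp.potential, hp.spin, hen⟩
  have nsm : ∀ v : SectorSpace 1, ‖(-s : ℂ) • v‖ ^ 2 = α * ‖v‖ ^ 2 := fun v => by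
    rw [norm_smul, mul_pow, norm_neg, Complex.norm_real, Real.norm_eq_abs, sq_abs, hs]
  have hD : ∀ j, D j = 0 := fun j => State.ext_sec fun n => by
    rw [hp.annA j n, sec_zero]
    match n with
    | 0 =>
      refine inner_self_eq_zero (𝕜 := ℂ) |>.1 ?_
      nth_rewrite 2 [annS]
      rw [← inner_insL_eq]
      rw [hΨ, sec_pairState_one, inner_smul_right, inner_insL_magL hΛ hε hw
        (ρ := fun r => 1 / (r + r ^ 2)) (fun _ => rfl)]
      simp
    | n + 1 => rw [annS, hΨ, sec_pairState_add_two, map_zero]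
  have hS : (inner ℂ Ψ (∑ m, sigma m (Db m)) : ℂ).re = -s * (spinShiftEnergy Λ * ‖h‖ ^ 2) := by
    have e : ∀ n, sec (∑ m, sigma m (Db m)) n
        = ∑ m, spinL (pauli m) (annL (memLp_magC hΛ hε m) (sec Ψ (n + 1))) := fun n => by
      rw [sec_sum]
      exact Finset.sum_congr rfl fun m _ => by rw [sec_sigma, hp.annB m n]; rfl
    rw [hΨ, inner_pairState, e, e, ← inner_magL_one hΛ hε, hΨ, sec_pairState_one,
      sec_pairState_add_two]
    simp only [map_zero, Finset.sum_const_zero, inner_zero_right, add_zero, inner_smul_right,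
      inner_magL_magL, one_mul, (integral_denom_magCoeff hΛ hε).2, inner_self_eq_ofReal]
    rw [← Complex.ofReal_mul, ← Complex.ofReal_neg, ← Complex.ofReal_mul]
    simp [-Complex.ofReal_pow]
  set Y := ∫ q, denom q ^ 2 * ∑ m, magCoeff Λ ε m q ^ 2 ∂photonMeasure with hY
  have nΨ : ‖Ψ‖ ^ 2 = ‖h‖ ^ 2 + α * (Y * ‖h‖ ^ 2) := by
    rw [hΨ, norm_pairState_sq, nsm, norm_magL_sq]
  have nP : ∀ j, ‖P j‖ ^ 2 = ‖g j‖ ^ 2 + α * (Y * ‖g j‖ ^ 2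
      + (∫ q, (denom q * q.1 j) ^ 2 * ∑ m, magCoeff Λ ε m q ^ 2 ∂photonMeasure) * ‖h‖ ^ 2) := by
    intro j
    have e0 := inner_magL_coord (n := 0) hε hw (hwj j) (ρ := fun r => (1 / (r + r ^ 2)) ^ 2) j
      (fun q => by rw [denom]; ring) (g j) h
    rw [hP]
    simp only
    rw [norm_pairState_sq, nsm, norm_sub_sq (𝕜 := ℂ), e0, norm_magL_sq, norm_magL_sq]
    simp [hY]
  have nF : ‖F‖ ^ 2 = α * ((∫ q, (denom q * Real.sqrt (‖q.1‖ + 0)) ^ 2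
      * ∑ m, magCoeff Λ ε m q ^ 2 ∂photonMeasure) * ‖h‖ ^ 2) := by
    rw [hF, norm_pairState_sq, nsm, norm_magL_sq]
    simp
  have hX := sum_integral_denom_sq hΛ hε
  refine ⟨Ψ, P, _, _, F, hf, ?_, ?_⟩
  · refine lt_of_pow_lt_pow_left₀ 2 (norm_nonneg _) ?_
    rw [hΨ, norm_pairState_sq]
    have := pow_pos h0 2
    rw [zero_pow two_ne_zero]
    positivity
  rw [hp.formValue_eq hα hf, ← hsdef, hS]
  simp only [hD, inner_zero_right, norm_zero, Complex.zero_re, zero_pow two_ne_zero,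
    Finset.sum_const_zero, mul_zero, nP, nF, Finset.sum_add_distrib, ← Finset.mul_sum, ← Finset.sum_mul, nΨ,
    mainTerm_eq]
  have hY0 : 0 ≤ Y := integral_nonneg fun q => mul_nonneg (sq_nonneg _)
    (Finset.sum_nonneg fun _ _ => sq_nonneg _)
  have hY1 : Y ≤ 1 * (2 * Λ / Real.pi) := integral_weight_le hΛ fun q => by
    refine le_trans ?_ ((denom_sq_mul_magCoeff_le hε q).trans (one_mul _).ge)
    refine mul_le_mul_of_nonneg_right ?_ (Finset.sum_nonneg fun _ _ => sq_nonneg _)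
    exact le_mul_of_one_le_right (sq_nonneg _) (by linarith [norm_nonneg q.1])
  have hX1 := spinShiftEnergy_le hΛ
  refine trial_arithmetic hα hΛ (sq_nonneg ‖h‖) hY0 ?_ ?_ hle hX hs
  · refine hY1.trans ?_
    have := mul_le_mul_of_nonneg_left inv_pi_le (show 0 ≤ 2 * Λ by positivity)
    have e : 1 * (2 * Λ / Real.pi) = 2 * Λ * (1 / Real.pi) := by ring
    linarith
  · refine hX1.trans (div_le_self (sq_nonneg Λ) ?_)
    linarith [Real.pi_gt_three]

end Trial

/-! ### The infimum of the spectrum of the operator of a quadratic form -/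

section Spectrum

variable {V H : Type*} [NormedAddCommGroup V] [InnerProductSpace ℂ V]
  [NormedAddCommGroup H] [InnerProductSpace ℂ H]

/-- The graph of the operator on `H` associated with the form `⟪v', B v⟫` on the form domain `V`,
where `ι` is the embedding of the form domain. -/
def formOperator (ι : V →L[ℂ] H) (B : V →L[ℂ] V) (u w : H) : Prop :=
  ∃ v, ι v = u ∧ ∀ v', inner ℂ v' (B v) = inner ℂ (ι v') w

variable {ι : V →L[ℂ] H} {B : V →L[ℂ] V}

theorem mem_resolventSet_of_isUnit [CompleteSpace V] [CompleteSpace H] {t : ℝ}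
    (h : IsUnit (B - (t : ℂ) • (ContinuousLinearMap.adjoint ι ∘L ι))) :
    (t : ℂ) ∈ resolventSet (formOperator ι B) := by
  obtain ⟨U, hU⟩ := h
  have hl : ∀ v, (↑U⁻¹ : V →L[ℂ] V) ((U : V →L[ℂ] V) v) = v := fun v => by
    rw [← mul_apply_eq_comp, U.inv_mul, one_apply_eq_self]
  have hr : ∀ v, (U : V →L[ℂ] V) ((↑U⁻¹ : V →L[ℂ] V) v) = v := fun v => by
    rw [← mul_apply_eq_comp, U.mul_inv, one_apply_eq_self]
  have hUv : ∀ v, (U : V →L[ℂ] V) v = B v - (t : ℂ) • ContinuousLinearMap.adjoint ι (ι v) :=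
    fun v => by rw [hU]; rfl
  have hiff : ∀ v w, (∀ v', inner ℂ v' (B v) = inner ℂ (ι v') w)
      ↔ B v = ContinuousLinearMap.adjoint ι w := fun v w => by
    refine ⟨fun h => ext_inner_left ℂ fun v' => ?_, fun h v' => ?_⟩
    · rw [h, ContinuousLinearMap.adjoint_inner_right]
    · rw [h, ContinuousLinearMap.adjoint_inner_right]
  refine ⟨ι ∘L (↑U⁻¹ : V →L[ℂ] V) ∘L ContinuousLinearMap.adjoint ι, fun u w => ⟨?_, fun h => ?_⟩⟩
  · rintro ⟨v, rfl, h⟩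
    have e : ContinuousLinearMap.adjoint ι (w - (t : ℂ) • ι v) = (U : V →L[ℂ] V) v := by
      rw [hUv, map_sub, map_smul, (hiff v w).1 h]
    rw [ContinuousLinearMap.comp_apply, ContinuousLinearMap.comp_apply, e, hl]
  · refine ⟨(↑U⁻¹ : V →L[ℂ] V) (ContinuousLinearMap.adjoint ι (w - (t : ℂ) • u)), h,
      (hiff _ _).2 ?_⟩
    have e := hUv ((↑U⁻¹ : V →L[ℂ] V) (ContinuousLinearMap.adjoint ι (w - (t : ℂ) • u)))
    rw [hr] at e
    have h' : ι ((↑U⁻¹ : V →L[ℂ] V) (ContinuousLinearMap.adjoint ι (w - (t : ℂ) • u))) = u := h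
    rw [h', eq_sub_iff_add_eq, ← map_smul, ← map_add, sub_add_cancel] at e
    exact e.symm

/-- Below the infimum of the form the shifted form is coercive. -/
theorem le_of_mem_realSpectrum [CompleteSpace V] [CompleteSpace H] {c C E t : ℝ} (hc : 0 < c)
    (hcoer : ∀ v, c * ‖v‖ ^ 2 ≤ (inner ℂ v (B v)).re + C * ‖ι v‖ ^ 2)
    (hE : ∀ v, E * ‖ι v‖ ^ 2 ≤ (inner ℂ v (B v)).re)
    (ht : t ∈ realSpectrum (formOperator ι B)) : E ≤ t := by
  by_contra! hlt
  refine ht (mem_resolventSet_of_isUnit ?_)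
  have hd : 0 < E - t := by linarith
  set K := |C + t| / (E - t) with hK
  have hK0 : 0 ≤ K := by positivity
  have hK1 : K * (E - t) = |C + t| := by rw [hK]; field_simp
  refine ContinuousLinearMap.isUnit_of_forall_le_norm_inner_map _
    (c := (c / (1 + K)).toNNReal) (Real.toNNReal_pos.2 (by positivity)) fun v => ?_
  rw [norm_inner_symm]
  refine le_trans ?_ (Complex.re_le_norm _)
  have e : (inner ℂ v ((B - (t : ℂ) • (ContinuousLinearMap.adjoint ι ∘L ι)) v)).re
      = (inner ℂ v (B v)).re - t * ‖ι v‖ ^ 2 := by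
    rw [sub_apply, inner_sub_right, smul_apply,
      inner_smul_right, ContinuousLinearMap.comp_apply, ContinuousLinearMap.adjoint_inner_right,
      inner_self_eq_ofReal, ← Complex.ofReal_mul, Complex.sub_re, Complex.ofReal_re]
  rw [e, Real.coe_toNNReal _ (by positivity), mul_div_assoc', div_le_iff₀ (by positivity)]
  have h1 := hcoer v
  have h2 := mul_le_mul_of_nonneg_left (hE v) hK0
  have h3 := mul_le_mul_of_nonneg_right (le_abs_self (C + t)) (sq_nonneg ‖ι v‖)
  rw [← hK1] at h3
  linarith

/-- The infimum of the form belongs to the spectrum: with a bounded resolvent `R` the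
Cauchy–Schwarz inequality of the form bounds `‖R‖⁻¹` by the form. -/
theorem mem_realSpectrum {E : ℝ} (hB : ∀ v v', inner ℂ v' (B v) = inner ℂ (B v') v)
    (hE : ∀ v, E * ‖ι v‖ ^ 2 ≤ (inner ℂ v (B v)).re)
    (hE' : ∀ δ : ℝ, 0 < δ → ∃ v, 0 < ‖ι v‖ ∧ (inner ℂ v (B v)).re ≤ (E + δ) * ‖ι v‖ ^ 2) :
    E ∈ realSpectrum (formOperator ι B) := by
  rintro ⟨R, hR⟩
  set τ : ℝ := 1 / (‖R‖ + 1) with hτ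
  have hτ0 : 0 < τ := by positivity
  have hτR : τ * ‖R‖ ≤ 1 := by
    rw [hτ, one_div_mul_eq_div, div_le_one (by positivity)]; linarith
  obtain ⟨v, hv, hle⟩ := hE' (τ / 2) (by positivity)
  obtain ⟨v', hv', h⟩ := (hR (R (ι v)) (ι v + (E : ℂ) • R (ι v))).2 (by rw [add_sub_cancel_right])
  set n := ‖ι v‖ ^ 2 with hn
  have hn0 : 0 < n := by positivity
  set d := (inner ℂ (R (ι v)) (ι v)).re
  have hd : d ≤ ‖R‖ * n := by
    calc d ≤ ‖R (ι v)‖ * ‖ι v‖ := (Complex.re_le_norm _).trans (norm_inner_le_norm _ _)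
      _ ≤ ‖R‖ * ‖ι v‖ * ‖ι v‖ := by gcongr; exact R.le_opNorm _
      _ = _ := by rw [hn]; ring
  have h1 : inner ℂ v (B v') = ((n : ℝ) : ℂ) + E * inner ℂ (ι v) (R (ι v)) := by
    rw [h v, inner_add_right, inner_smul_right, inner_self_eq_ofReal]
  have h2 : inner ℂ v' (B v') = inner ℂ (R (ι v)) (ι v) + E * ((‖R (ι v)‖ ^ 2 : ℝ) : ℂ) := by
    rw [h v', hv', inner_add_right, inner_smul_right, inner_self_eq_ofReal]
  have h3 : (inner ℂ v' (B v)).re = (inner ℂ v (B v')).re := by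
    rw [hB v v', ← inner_conj_symm, Complex.conj_re]
  have h4 := hE (v - (τ : ℂ) • v')
  rw [map_sub, map_smul, hv', norm_sub_sq (𝕜 := ℂ), inner_smul_right, map_sub, map_smul,
    inner_sub_left, inner_sub_right, inner_sub_right, inner_smul_left, inner_smul_left,
    inner_smul_right, inner_smul_right, Complex.conj_ofReal, norm_smul, Complex.norm_real, mul_pow,
    Real.norm_eq_abs, sq_abs, Complex.sub_re, Complex.sub_re, Complex.sub_re,
    Complex.re_ofReal_mul, Complex.re_ofReal_mul, Complex.re_ofReal_mul, Complex.re_ofReal_mul,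
    h3, h1, h2] at h4
  simp only [Complex.add_re, Complex.re_ofReal_mul, Complex.ofReal_re, RCLike.re_to_complex] at h4
  have h5 : τ ^ 2 * d ≤ τ * n := by
    calc τ ^ 2 * d ≤ τ ^ 2 * (‖R‖ * n) := by gcongr
      _ = τ * (τ * ‖R‖) * n := by ring
      _ ≤ τ * 1 * n := by gcongr
      _ = _ := by ring
  have h6 : 0 < τ * n := by positivity
  linarith

theorem isGLB_realSpectrum [CompleteSpace V] [CompleteSpace H] {c C E : ℝ} (hc : 0 < c)
    (hB : ∀ v v', inner ℂ v' (B v) = inner ℂ (B v') v)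
    (hcoer : ∀ v, c * ‖v‖ ^ 2 ≤ (inner ℂ v (B v)).re + C * ‖ι v‖ ^ 2)
    (hE : ∀ v, E * ‖ι v‖ ^ 2 ≤ (inner ℂ v (B v)).re)
    (hE' : ∀ δ : ℝ, 0 < δ → ∃ v, 0 < ‖ι v‖ ∧ (inner ℂ v (B v)).re ≤ (E + δ) * ‖ι v‖ ^ 2) :
    IsGLB (realSpectrum (formOperator ι B)) E :=
  ⟨fun _ ht => le_of_mem_realSpectrum hc hcoer hE ht, fun _ hl => hl (mem_realSpectrum hB hE hE')⟩

end Spectrum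

/-! Vectors of the form domain together with their images under the operators in the form. The
components of `x` are a vector `x (inl 0)`, its spin energy `x (inl 1)`, the square root `x (inl 2)`
of its field energy, and the components of its momentum and its vector potential. -/

section FormGraph

variable {H : Type*} [NormedAddCommGroup H] [InnerProductSpace ℂ H]

/-- The quadratic form `∑ⱼ ⟨(pⱼ + s Aⱼ) y, (pⱼ + s Aⱼ) x⟩ + s ⟨y, S x⟩ + ⟨F y, F x⟩`. -/
def formSum (s : ℝ) (y x : PiLp 2 fun _ : Fin 3 ⊕ Fin 3 ⊕ Fin 3 => H) : ℂ :=
  ∑ j, inner ℂ (y (.inr (.inl j)) + (s : ℂ) • y (.inr (.inr j)))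
    (x (.inr (.inl j)) + (s : ℂ) • x (.inr (.inr j)))
    + (s : ℂ) * inner ℂ (y (.inl 0)) (x (.inl 1)) + inner ℂ (y (.inl 2)) (x (.inl 2))

/-- The graph of the operator associated with `formSum s` on the form domain `W`. -/
def formGraph (W : Submodule ℂ (PiLp 2 fun _ : Fin 3 ⊕ Fin 3 ⊕ Fin 3 => H)) (s : ℝ) (u w : H) :
    Prop :=
  ∃ x ∈ W, x (.inl 0) = u ∧ ∀ y ∈ W, formSum s y x = inner ℂ (y (.inl 0)) w

variable (W : Submodule ℂ (PiLp 2 fun _ : Fin 3 ⊕ Fin 3 ⊕ Fin 3 => H))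

/-- The components of an element of the form domain. -/
def coordL (i : Fin 3 ⊕ Fin 3 ⊕ Fin 3) : W →L[ℂ] H :=
  PiLp.proj 2 (fun _ => H) i ∘L W.subtypeL

/-- `(p_j + s A_j) x`. -/
def kineticL (s : ℝ) (j : Fin 3) : W →L[ℂ] H :=
  coordL W (.inr (.inl j)) + (s : ℂ) • coordL W (.inr (.inr j))

variable [CompleteSpace H] [CompleteSpace W]

/-- The bounded operator on the form domain which represents the quadratic form. -/
def formL (s : ℝ) : W →L[ℂ] W :=
  ∑ j, ContinuousLinearMap.adjoint (kineticL W s j) ∘L kineticL W s j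
    + ContinuousLinearMap.adjoint (coordL W (.inl 0)) ∘L ((s : ℂ) • coordL W (.inl 1))
    + ContinuousLinearMap.adjoint (coordL W (.inl 2)) ∘L coordL W (.inl 2)

theorem inner_formL (s : ℝ) (v v' : W) : inner ℂ v' (formL W s v) = formSum s v'.1 v.1 := by
  simp only [formL, add_apply, sum_apply, smul_apply, ContinuousLinearMap.comp_apply,
    inner_add_right, inner_sum, ContinuousLinearMap.adjoint_inner_right, inner_smul_right]
  rfl

theorem inner_formL_symm (s : ℝ) (hW : ∀ x ∈ W, (inner ℂ (x (.inl 0)) (x (.inl 1))).im = 0)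
    (v v' : W) : inner ℂ v' (formL W s v) = inner ℂ (formL W s v') v := by
  have hs : (ContinuousLinearMap.adjoint (coordL W (.inl 0)) ∘L coordL W (.inl 1) :
      W →ₗ[ℂ] W).IsSymmetric := by
    rw [LinearMap.isSymmetric_iff_inner_map_self_real]
    intro u
    rw [Complex.conj_eq_iff_im]
    change (inner ℂ (ContinuousLinearMap.adjoint (coordL W (.inl 0))
      (coordL W (.inl 1) u)) u).im = 0
    rw [ContinuousLinearMap.adjoint_inner_left, ← inner_conj_symm, Complex.conj_im, neg_eq_zero]
    exact hW u.1 u.2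
  have h1 : inner ℂ (v'.1 (.inl 0)) (v.1 (.inl 1)) = inner ℂ (v'.1 (.inl 1)) (v.1 (.inl 0)) := by
    have h2 := hs v' v
    change inner ℂ (ContinuousLinearMap.adjoint (coordL W (.inl 0)) (coordL W (.inl 1) v')) v
      = inner ℂ v' (ContinuousLinearMap.adjoint (coordL W (.inl 0)) (coordL W (.inl 1) v)) at h2
    rw [ContinuousLinearMap.adjoint_inner_left, ContinuousLinearMap.adjoint_inner_right] at h2
    exact h2.symm
  rw [← inner_conj_symm (formL W s v') v, inner_formL, inner_formL, formSum, formSum, h1]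
  simp only [map_add, map_sum, map_mul, Complex.conj_ofReal, inner_conj_symm]

theorem formGraph_eq (s : ℝ) : formGraph W s = formOperator (coordL W (.inl 0)) (formL W s) := by
  funext u w
  refine propext ⟨?_, ?_⟩
  · rintro ⟨x, hx, rfl, h⟩
    exact ⟨⟨x, hx⟩, rfl, fun v' => (inner_formL W s _ v').trans (h v'.1 v'.2)⟩
  · rintro ⟨v, rfl, h⟩
    exact ⟨v.1, v.2, rfl, fun y hy => (inner_formL W s v ⟨y, hy⟩).symm.trans (h ⟨y, hy⟩)⟩

theorem isGLB_realSpectrum_formGraph {s c C E : ℝ} (hc : 0 < c)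
    (hW : ∀ x ∈ W, (inner ℂ (x (.inl 0)) (x (.inl 1))).im = 0)
    (hcoer : ∀ x ∈ W, c * ‖x‖ ^ 2 ≤ (formSum s x x).re + C * ‖x (.inl 0)‖ ^ 2)
    (hE : ∀ x ∈ W, E * ‖x (.inl 0)‖ ^ 2 ≤ (formSum s x x).re)
    (hE' : ∀ δ : ℝ, 0 < δ → ∃ x ∈ W, 0 < ‖x (.inl 0)‖ ∧
      (formSum s x x).re ≤ (E + δ) * ‖x (.inl 0)‖ ^ 2) :
    IsGLB (realSpectrum (formGraph W s)) E := by
  rw [formGraph_eq]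
  refine isGLB_realSpectrum (C := C) hc (inner_formL_symm W s hW) (fun v => ?_)
    (fun v => ?_) fun δ hδ => ?_
  · rw [inner_formL]
    exact hcoer v.1 v.2
  · rw [inner_formL]
    exact hE v.1 v.2
  · obtain ⟨x, hx, h0, h⟩ := hE' δ hδ
    refine ⟨⟨x, hx⟩, h0, ?_⟩
    rw [inner_formL]
    exact h

end FormGraph

/-! ### Closedness of the quadratic form -/

section Closed

/-- The `n`-photon component, as a continuous linear map. -/
def secL (n : ℕ) : State →L[ℂ] SectorSpace n :=
  lp.evalCLM ℂ (fun n : ℕ => Lp ℂ 2 (sectorMeasure n)) 2 n ∘L State.subtypeL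

theorem continuous_sec (n : ℕ) : Continuous fun Ψ : State => sec Ψ n := (secL n).continuous

theorem isClosed_state : IsClosed (State : Set FullSpace) := by
  have e : (State : Set FullSpace) = ⋂ (n : ℕ) (τ : Equiv.Perm (Fin n)),
      {Ψ : FullSpace | permL τ (lp.evalCLM ℂ (fun n : ℕ => Lp ℂ 2 (sectorMeasure n)) 2 n Ψ)
        = lp.evalCLM ℂ (fun n : ℕ => Lp ℂ 2 (sectorMeasure n)) 2 n Ψ} := by
    ext Ψ
    simp only [Set.mem_iInter, Set.mem_ofPred_eq]
    refine ⟨fun h n τ => State.isSym ⟨Ψ, h⟩ n τ, fun h => ?_⟩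
    exact (mkState (fun n => Ψ n) h
      (by simpa using (lp.memℓp Ψ).summable (by norm_num))).2
  rw [e]
  exact isClosed_iInter fun n => isClosed_iInter fun τ =>
    isClosed_eq ((permL τ).continuous.comp (ContinuousLinearMap.continuous _))
      (ContinuousLinearMap.continuous _)

instance : CompleteSpace State := isClosed_state.completeSpace_coe

section Test

variable {n : ℕ} {φ : R3 → ℂ}

theorem memLp_testFun (hφ : Continuous φ) (hc : HasCompactSupport φ) {s : Set (Inner n)}
    (hs : MeasurableSet s) (hμ : innerMeasure n s < ⊤) :
    MemLp (fun z : Sector n => (starRingEnd ℂ) (φ z.1) * s.indicator (fun _ => (1 : ℂ)) z.2) 2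
      (sectorMeasure n) := by
  have h1 : MemLp (fun x => (starRingEnd ℂ) (φ x)) 2 :=
    (hφ.memLp_of_hasCompactSupport hc (p := 2) (μ := volume)).star
  have h2 : MemLp (s.indicator fun _ => (1 : ℂ)) 2 (innerMeasure n) :=
    memLp_indicator_const 2 hs 1 (Or.inr hμ.ne)
  have hm : AEStronglyMeasurable
      (fun z : Sector n => (starRingEnd ℂ) (φ z.1) * s.indicator (fun _ => (1 : ℂ)) z.2)
      (sectorMeasure n) := h1.1.comp_fst.mul h2.1.comp_snd
  rw [memLp_two_iff_integrable_sq_norm hm]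
  simp only [norm_mul, mul_pow]
  exact ((memLp_two_iff_integrable_sq_norm h1.1).1 h1).mul_prod
    ((memLp_two_iff_integrable_sq_norm h2.1).1 h2)

/-- The test function `φ(x)` restricted to a set of spins and photons. -/
def testL (hφ : Continuous φ) (hc : HasCompactSupport φ) {s : Set (Inner n)}
    (hs : MeasurableSet s) (hμ : innerMeasure n s < ⊤) : SectorSpace n :=
  (memLp_testFun hφ hc hs hμ).toLp

theorem integrable_test (hφ : Continuous φ) (hc : HasCompactSupport φ) {s : Set (Inner n)}
    (hs : MeasurableSet s) (hμ : innerMeasure n s < ⊤) (h : SectorSpace n) :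
    Integrable (fun z : Sector n => s.indicator (fun _ => (1 : ℂ)) z.2 * (φ z.1 * h z))
      (sectorMeasure n) := by
  refine ((memLp_testFun hφ hc hs hμ).star.integrable_mul (Lp.memLp h)).congr
    (ae_of_all _ fun z => ?_)
  by_cases hz : z.2 ∈ s <;> simp [hz]

theorem integrableOn_section (hφ : Continuous φ) (hc : HasCompactSupport φ) {s : Set (Inner n)}
    (hs : MeasurableSet s) (hμ : innerMeasure n s < ⊤) (h : SectorSpace n) :
    IntegrableOn (fun y => ∫ x, φ x * h (x, y)) s (innerMeasure n) := by
  have h1 := (integrable_test hφ hc hs hμ h).integral_prod_right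
  simp only [integral_const_mul] at h1
  rw [← integrable_indicator_iff hs]
  refine h1.congr (ae_of_all _ fun y => ?_)
  by_cases hy : y ∈ s <;> simp [hy]

theorem inner_testL (hφ : Continuous φ) (hc : HasCompactSupport φ) {s : Set (Inner n)}
    (hs : MeasurableSet s) (hμ : innerMeasure n s < ⊤) (h : SectorSpace n) :
    inner ℂ (testL hφ hc hs hμ) h = ∫ y in s, ∫ x, φ x * h (x, y) ∂volume ∂(innerMeasure n) := by
  rw [inner_eq_integral]
  have e : ∫ z, (starRingEnd ℂ) (testL hφ hc hs hμ z) * h z ∂(sectorMeasure n)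
      = ∫ z, s.indicator (fun _ => (1 : ℂ)) z.2 * (φ z.1 * h z) ∂(sectorMeasure n) := by
    refine integral_congr_ae ?_
    filter_upwards [(memLp_testFun hφ hc hs hμ).coeFn_toLp] with z hz
    rw [testL, hz]
    by_cases hz : z.2 ∈ s <;> simp [hz]
  rw [e]
  refine (integral_prod_symm _ (integrable_test hφ hc hs hμ h)).trans ?_
  simp only [integral_const_mul]
  rw [← integral_indicator hs]
  refine integral_congr_ae (ae_of_all _ fun y => ?_)
  by_cases hy : y ∈ s <;> simp [hy]

end Test

/-- The momentum in terms of inner products with test functions. -/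
theorem momentum_iff_inner {j : Fin 3} {Ψ Φ : State} :
    Momentum j Ψ Φ ↔ ∀ (n : ℕ) (φ : R3 → ℂ) (hφ : ContDiff ℝ ∞ φ) (hc : HasCompactSupport φ)
      (s : Set (Inner n)) (hs : MeasurableSet s) (hμ : innerMeasure n s < ⊤),
      inner ℂ (testL hφ.continuous hc hs hμ) (sec Φ n)
        = Complex.I * inner ℂ (testL
          ((hφ.continuous_fderiv (by simp)).clm_apply continuous_const :
            Continuous fun x => fderiv ℝ φ x (EuclideanSpace.single j 1))
          (hc.fderiv_apply ℝ (EuclideanSpace.single j 1)) hs hμ) (sec Ψ n) := by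
  have hcont : ∀ {φ : R3 → ℂ}, ContDiff ℝ ∞ φ →
      Continuous fun x => fderiv ℝ φ x (EuclideanSpace.single j 1) := fun hφ =>
    (hφ.continuous_fderiv (by simp)).clm_apply continuous_const
  refine forall_congr' fun n => forall_congr' fun φ => forall_congr' fun hφ =>
    forall_congr' fun hc => ⟨fun h s hs hμ => ?_, fun h => ?_⟩
  · rw [inner_testL, inner_testL, ← integral_const_mul]
    exact setIntegral_congr_ae hs (h.mono fun y hy _ => hy)
  · have h0 := fun s hs hμ => integrableOn_section (s := s) hφ.continuous hc hs hμ (sec Φ n)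
    have h1 := fun s hs hμ => (integrableOn_section (s := s) (hcont hφ)
      (hc.fderiv_apply ℝ (EuclideanSpace.single j 1)) hs hμ (sec Ψ n)).const_mul Complex.I
    refine ae_eq_of_forall_setIntegral_eq_of_sigmaFinite h0 h1 fun s hs hμ => ?_
    rw [integral_const_mul]
    exact (inner_testL hφ.continuous hc hs hμ (sec Φ n)).symm.trans ((h s hs hμ).trans
      (congrArg _ (inner_testL (hcont hφ) _ hs hμ (sec Ψ n))))

theorem isClosed_momentum (j : Fin 3) : IsClosed {p : State × State | Momentum j p.1 p.2} := by
  simp only [momentum_iff_inner, Set.ofPred_forall]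
  refine isClosed_iInter fun n => isClosed_iInter fun φ => isClosed_iInter fun hφ =>
    isClosed_iInter fun hc => isClosed_iInter fun s => isClosed_iInter fun hs =>
    isClosed_iInter fun hμ => isClosed_eq ?_ ?_
  · exact continuous_const.inner ((continuous_sec n).comp continuous_snd)
  · exact continuous_const.mul (continuous_const.inner ((continuous_sec n).comp continuous_fst))

theorem isClosed_sqrtFieldEnergy : IsClosed {p : State × State | SqrtFieldEnergy p.1 p.2} := by
  have e : {p : State × State | SqrtFieldEnergy p.1 p.2}
      = ⋂ n, {p | IsSqrtEnergy (sec p.1 n) (sec p.2 n)} := by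
    rw [← Set.ofPred_forall]; rfl
  rw [e]
  refine isClosed_iInter fun n => IsSeqClosed.isClosed fun p q hp hq => ?_
  have h1 : Filter.Tendsto (fun k => sec (p k).1 n) Filter.atTop (nhds (sec q.1 n)) :=
    (((continuous_sec n).comp continuous_fst).tendsto q).comp hq
  have h2 : Filter.Tendsto (fun k => sec (p k).2 n) Filter.atTop (nhds (sec q.2 n)) :=
    (((continuous_sec n).comp continuous_snd).tendsto q).comp hq
  obtain ⟨u, hu, hu'⟩ := (tendstoInMeasure_of_tendsto_Lp h1).exists_seq_tendsto_ae
  obtain ⟨v, hv, hv'⟩ := (tendstoInMeasure_of_tendsto_Lp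
    (h2.comp hu.tendsto_atTop)).exists_seq_tendsto_ae
  filter_upwards [hu', hv', ae_all_iff.2 hp] with z z1 z2 z3
  refine tendsto_nhds_unique z2 ?_
  refine ((z1.comp hv.tendsto_atTop).const_mul _).congr fun k => ?_
  exact (z3 (u (v k))).symm

variable {Λ : ℝ} {ε : Fin 2 → R3 → R3}

/-- The components of the states created from a state, as continuous linear maps. -/
def creSL {c : Photon → ℂ} (hc : MemLp c 2 photonMeasure) : (n : ℕ) → State →L[ℂ] SectorSpace n
  | 0 => 0
  | n + 1 => creL hc ∘L secL n

theorem creSL_apply {c : Photon → ℂ} (hc : MemLp c 2 photonMeasure) (n : ℕ) (Ψ : State) :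
    creSL hc n Ψ = creS hc Ψ n := by
  cases n <;> rfl

/-- The `n`-photon component of `A_j(x)`. -/
def potL (hΛ : 0 < Λ) (hε : IsPolarization ε) (j : Fin 3) (n : ℕ) : State →L[ℂ] SectorSpace n :=
  annL (memLp_potC hΛ hε j) ∘L secL (n + 1) + creSL (memLp_potC hΛ hε j) n

/-- The `n`-photon component of `σ·B(x)`. -/
def spinFieldL (hΛ : 0 < Λ) (hε : IsPolarization ε) (n : ℕ) : State →L[ℂ] SectorSpace n :=
  ∑ m, spinL (pauli m) ∘L
    (annL (memLp_magC hΛ hε m) ∘L secL (n + 1) + creSL (memLp_magC hΛ hε m) n)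

theorem vectorPotential_iff_potL (hΛ : 0 < Λ) (hε : IsPolarization ε) {j : Fin 3} {Ψ Φ : State} :
    VectorPotential Λ ε j Ψ Φ ↔ ∀ n, secL n Φ = potL hΛ hε j n Ψ := by
  rw [vectorPotential_iff hΛ hε]
  refine forall_congr' fun n => ?_
  rw [potL, add_apply, creSL_apply]
  rfl

theorem spinField_iff_spinFieldL (hΛ : 0 < Λ) (hε : IsPolarization ε) {Ψ Φ : State} :
    SpinField Λ ε Ψ Φ ↔ ∀ n, secL n Φ = spinFieldL hΛ hε n Ψ := by
  rw [spinField_iff hΛ hε]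
  refine forall_congr' fun n => ?_
  have e : spinFieldL hΛ hε n Ψ = spinAnn hΛ hε Ψ n + spinCre hΛ hε Ψ n := by
    rw [spinFieldL, sum_apply, spinAnn, spinCre, ← Finset.sum_add_distrib]
    refine Finset.sum_congr rfl fun m _ => ?_
    rw [ContinuousLinearMap.comp_apply, add_apply, map_add, creSL_apply]
    rfl
  rw [e]
  rfl

theorem isClosed_vectorPotential (hΛ : 0 < Λ) (hε : IsPolarization ε) (j : Fin 3) :
    IsClosed {p : State × State | VectorPotential Λ ε j p.1 p.2} := by
  simp only [vectorPotential_iff_potL hΛ hε, Set.ofPred_forall]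
  exact isClosed_iInter fun n => isClosed_eq ((secL n).continuous.comp continuous_snd)
    ((potL hΛ hε j n).continuous.comp continuous_fst)

theorem isClosed_spinField (hΛ : 0 < Λ) (hε : IsPolarization ε) :
    IsClosed {p : State × State | SpinField Λ ε p.1 p.2} := by
  simp only [spinField_iff_spinFieldL hΛ hε, Set.ofPred_forall]
  exact isClosed_iInter fun n => isClosed_eq ((secL n).continuous.comp continuous_snd)
    ((spinFieldL hΛ hε n).continuous.comp continuous_fst)

theorem IsSqrtEnergy.add {n : ℕ} {h g h' g' : SectorSpace n} (hg : IsSqrtEnergy h g)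
    (hg' : IsSqrtEnergy h' g') : IsSqrtEnergy (h + h') (g + g') := by
  filter_upwards [hg, hg', Lp.coeFn_add h h', Lp.coeFn_add g g'] with z h1 h2 h3 h4
  rw [h4, h3, Pi.add_apply, Pi.add_apply, h1, h2]
  ring

theorem inFormDomain_zero (hΛ : 0 < Λ) (hε : IsPolarization ε) :
    InFormDomain Λ ε 0 (fun _ => 0) (fun _ => 0) 0 0 where
  momentum _ := momentum_iff.2 fun _ => IsMom.zero
  potential _ := (vectorPotential_iff_potL hΛ hε).2 fun n => by simp
  spin := (spinField_iff_spinFieldL hΛ hε).2 fun n => by simp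
  energy _ := isSqrtEnergy_zero

theorem InFormDomain.add (hΛ : 0 < Λ) (hε : IsPolarization ε) {Ψ S F Ψ' S' F' : State}
    {P A P' A' : Fin 3 → State} (h : InFormDomain Λ ε Ψ P A S F)
    (h' : InFormDomain Λ ε Ψ' P' A' S' F') :
    InFormDomain Λ ε (Ψ + Ψ') (fun j => P j + P' j) (fun j => A j + A' j) (S + S') (F + F') where
  momentum j := momentum_iff.2 fun n => ((h.momentum j).sec n).add ((h'.momentum j).sec n)
  potential j := (vectorPotential_iff_potL hΛ hε).2 fun n => by
    rw [map_add, map_add, (vectorPotential_iff_potL hΛ hε).1 (h.potential j) n,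
      (vectorPotential_iff_potL hΛ hε).1 (h'.potential j) n]
  spin := (spinField_iff_spinFieldL hΛ hε).2 fun n => by
    rw [map_add, map_add, (spinField_iff_spinFieldL hΛ hε).1 h.spin n,
      (spinField_iff_spinFieldL hΛ hε).1 h'.spin n]
  energy n := (h.energy.sec n).add (h'.energy.sec n)

theorem InFormDomain.smul (hΛ : 0 < Λ) (hε : IsPolarization ε) {Ψ S F : State}
    {P A : Fin 3 → State} (h : InFormDomain Λ ε Ψ P A S F) (c : ℂ) :
    InFormDomain Λ ε (c • Ψ) (fun j => c • P j) (fun j => c • A j) (c • S) (c • F) where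
  momentum j := momentum_iff.2 fun n => ((h.momentum j).sec n).smul c
  potential j := (vectorPotential_iff_potL hΛ hε).2 fun n => by
    rw [map_smul, map_smul, (vectorPotential_iff_potL hΛ hε).1 (h.potential j) n]
  spin := (spinField_iff_spinFieldL hΛ hε).2 fun n => by
    rw [map_smul, map_smul, (spinField_iff_spinFieldL hΛ hε).1 h.spin n]
  energy n := (h.energy.sec n).smul c

/-- The form domain, as the Hilbert space of the vectors `Ψ` together with `σ·B Ψ`, `H_f^{1/2} Ψ`,
and the components of `p Ψ` and `A Ψ`. -/
def formDomain (hΛ : 0 < Λ) (hε : IsPolarization ε) :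
    Submodule ℂ (PiLp 2 fun _ : Fin 3 ⊕ Fin 3 ⊕ Fin 3 => State) where
  carrier := {x | InFormDomain Λ ε (x (.inl 0)) (fun j => x (.inr (.inl j)))
    (fun j => x (.inr (.inr j))) (x (.inl 1)) (x (.inl 2))}
  zero_mem' := inFormDomain_zero hΛ hε
  add_mem' h h' := h.add hΛ hε h'
  smul_mem' c _ h := h.smul hΛ hε c

theorem isClosed_formDomain (hΛ : 0 < Λ) (hε : IsPolarization ε) :
    IsClosed (formDomain hΛ hε : Set (PiLp 2 fun _ : Fin 3 ⊕ Fin 3 ⊕ Fin 3 => State)) := by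
  have hcont : ∀ i i', Continuous
      fun x : PiLp 2 (fun _ : Fin 3 ⊕ Fin 3 ⊕ Fin 3 => State) => (x i, x i') := fun i i' => by
    fun_prop
  have e : (formDomain hΛ hε : Set (PiLp 2 fun _ : Fin 3 ⊕ Fin 3 ⊕ Fin 3 => State))
      = (⋂ j, {x | Momentum j (x (.inl 0)) (x (.inr (.inl j)))})
        ∩ (⋂ j, {x | VectorPotential Λ ε j (x (.inl 0)) (x (.inr (.inr j)))})
        ∩ {x | SpinField Λ ε (x (.inl 0)) (x (.inl 1))}
        ∩ {x | SqrtFieldEnergy (x (.inl 0)) (x (.inl 2))} := by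
    ext x
    simp only [Set.mem_inter_iff, Set.mem_iInter, Set.mem_ofPred_eq]
    exact ⟨fun h => ⟨⟨⟨h.momentum, h.potential⟩, h.spin⟩, h.energy⟩,
      fun h => ⟨h.1.1.1, h.1.1.2, h.1.2, h.2⟩⟩
  rw [e]
  exact (((isClosed_iInter fun j => (isClosed_momentum j).preimage (hcont _ _)).inter
    (isClosed_iInter fun j => (isClosed_vectorPotential hΛ hε j).preimage (hcont _ _))).inter
    ((isClosed_spinField hΛ hε).preimage (hcont _ _))).inter
    (isClosed_sqrtFieldEnergy.preimage (hcont _ _))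

end Closed

/-! ### The infimum of the spectrum of the Pauli–Fierz operator -/

section Main

variable {Λ : ℝ} {ε : Fin 2 → R3 → R3}

instance (hΛ : 0 < Λ) (hε : IsPolarization ε) : CompleteSpace (formDomain hΛ hε) :=
  (isClosed_formDomain hΛ hε).completeSpace_coe

/-- The vectors `Ψ`, `S = σ·B Ψ`, `F = H_f^{1/2} Ψ`, `P = p Ψ` and `A = A(x) Ψ` as one vector. -/
def formVector (Ψ : State) (P A : Fin 3 → State) (S F : State) :
    PiLp 2 fun _ : Fin 3 ⊕ Fin 3 ⊕ Fin 3 => State :=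
  WithLp.toLp 2 (Sum.elim ![Ψ, S, F] (Sum.elim P A))

theorem norm_sq_eq_sum_components (x : PiLp 2 fun _ : Fin 3 ⊕ Fin 3 ⊕ Fin 3 => State) :
    ‖x‖ ^ 2 = ‖x (.inl 0)‖ ^ 2 + ‖x (.inl 1)‖ ^ 2 + ‖x (.inl 2)‖ ^ 2
      + ∑ j, ‖x (.inr (.inl j))‖ ^ 2 + ∑ j, ‖x (.inr (.inr j))‖ ^ 2 := by
  rw [PiLp.norm_sq_eq_of_L2, Fintype.sum_sum_type, Fintype.sum_sum_type, Fin.sum_univ_three,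
    ← add_assoc]

theorem re_formSum (α : ℝ) (x : PiLp 2 fun _ : Fin 3 ⊕ Fin 3 ⊕ Fin 3 => State) :
    (formSum (Real.sqrt α) x x).re = formValue α (x (.inl 0)) (fun j => x (.inr (.inl j)))
      (fun j => x (.inr (.inr j))) (x (.inl 1)) (x (.inl 2)) := by
  simp only [formSum, inner_self_eq_ofReal, Complex.add_re, Complex.re_sum, Complex.ofReal_re,
    Complex.re_ofReal_mul]
  rfl

/-- The Pauli–Fierz operator is the operator associated with its quadratic form. -/
theorem pauliFierz_eq (hΛ : 0 < Λ) (hε : IsPolarization ε) (α : ℝ) :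
    pauliFierz α Λ ε = formGraph (formDomain hΛ hε) (Real.sqrt α) := by
  funext Ψ w
  refine propext ⟨?_, ?_⟩
  · rintro ⟨P, A, S, F, h, hw⟩
    exact ⟨formVector Ψ P A S F, h, rfl, fun y hy => hw _ _ _ _ _ hy⟩
  · rintro ⟨x, hx, rfl, hw⟩
    exact ⟨_, _, _, _, hx, fun Φ P' A' S' F' h' => hw (formVector Φ P' A' S' F') h'⟩

theorem coercivity_arithmetic {α κ s M N T F P A Q n t I : ℝ} (hα : 0 < α) (hκ : 0 < κ)
    (hs : s ^ 2 = α) (hM : M = 1 + 4 * κ + 6 * α * κ) (hN : N = n ^ 2) (hT : T = t ^ 2)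
    (hF : 0 ≤ F) (hQ : 0 ≤ Q) (hP : P ≤ 2 * Q + 2 * α * A) (hA : A ≤ 3 * (κ * (F + N)))
    (hS : T ≤ κ * (F + N)) (hI : -(s * (n * t)) ≤ I) :
    1 / (2 * M) * (N + T + F + P + A) ≤ Q + I + F + (1 + α * κ) * N := by
  have hN0 : 0 ≤ N := hN ▸ sq_nonneg n
  have hp : 0 ≤ 4 * κ + 6 * α * κ := by positivity
  have hM1 : 1 ≤ M := by rw [hM]; linarith
  have hM0 : 0 < M := by linarith
  -- the spin term is bounded by a quarter of `F + N` and a multiple of `N`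
  have h1 : s * (n * t) ≤ 1 / (4 * κ) * T + α * κ * N := by
    have h2 : 0 ≤ (t / (2 * κ) - s * n) ^ 2 * κ := by positivity
    have h3 : (t / (2 * κ) - s * n) ^ 2 * κ
        = 1 / (4 * κ) * t ^ 2 - s * (n * t) + s ^ 2 * κ * n ^ 2 := by
      field_simp
      ring
    rw [h3, hs] at h2
    rw [hN, hT]
    linarith
  have h2 : 1 / (4 * κ) * T ≤ 1 / 4 * (F + N) := by
    calc 1 / (4 * κ) * T ≤ 1 / (4 * κ) * (κ * (F + N)) := by gcongr
      _ = 1 / 4 * (F + N) := by field_simp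
  have h3 : N + T + F + P + A ≤ 2 * Q + M * (F + N) := by
    have h4 : 2 * α * A ≤ 2 * α * (3 * (κ * (F + N))) := by gcongr
    rw [hM]
    linarith
  have h4 : 1 / (2 * M) * (N + T + F + P + A) ≤ Q + 1 / 2 * (F + N) := by
    calc 1 / (2 * M) * (N + T + F + P + A) ≤ 1 / (2 * M) * (2 * Q + M * (F + N)) := by gcongr
      _ = 1 / M * Q + 1 / 2 * (F + N) := by field_simp
      _ ≤ 1 * Q + 1 / 2 * (F + N) := by
          gcongr
          rw [div_le_one hM0]
          exact hM1
      _ = _ := by rw [one_mul]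
  linarith

theorem norm_sq_le_norm_add_smul_sq {α : ℝ} (hα : 0 < α) (p a : State) :
    ‖p‖ ^ 2 ≤ 2 * ‖p + (Real.sqrt α : ℂ) • a‖ ^ 2 + 2 * α * ‖a‖ ^ 2 := by
  have h1 := norm_sub_le (p + (Real.sqrt α : ℂ) • a) ((Real.sqrt α : ℂ) • a)
  rw [add_sub_cancel_right, norm_smul (Real.sqrt α : ℂ) a, Complex.norm_real, Real.norm_eq_abs,
    abs_of_nonneg (Real.sqrt_nonneg α)] at h1
  have h2 := pow_le_pow_left₀ (norm_nonneg _) h1 2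
  have h3 := sq_nonneg (‖p + (Real.sqrt α : ℂ) • a‖ - Real.sqrt α * ‖a‖)
  have h4 : (Real.sqrt α * ‖a‖) ^ 2 = α * ‖a‖ ^ 2 := by rw [mul_pow, Real.sq_sqrt hα.le]
  linarith

/-- The form bounds the norm of the form domain. -/
theorem exists_coercive (hΛ : 0 < Λ) (hε : IsPolarization ε) {α : ℝ} (hα : 0 < α) :
    ∃ c C : ℝ, 0 < c ∧ ∀ x ∈ formDomain hΛ hε,
      c * ‖x‖ ^ 2 ≤ (formSum (Real.sqrt α) x x).re + C * ‖x (.inl 0)‖ ^ 2 := by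
  obtain ⟨κ, hκ, hb⟩ := exists_field_bound hΛ hε
  refine ⟨1 / (2 * (1 + 4 * κ + 6 * α * κ)), 1 + α * κ, by positivity, fun x hx => ?_⟩
  obtain ⟨hA, hS⟩ := hb _ _ _ _ _ hx
  rw [re_formSum, formValue, norm_sq_eq_sum_components]
  have hP := Finset.sum_le_sum fun j (_ : j ∈ Finset.univ) =>
    norm_sq_le_norm_add_smul_sq hα (x (.inr (.inl j))) (x (.inr (.inr j)))
  have hA' := Finset.sum_le_sum fun j (_ : j ∈ Finset.univ) => hA j
  rw [Finset.sum_add_distrib, ← Finset.mul_sum, ← Finset.mul_sum] at hP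
  rw [Finset.sum_const, Finset.card_univ, Fintype.card_fin, nsmul_eq_mul] at hA'
  have hI : -(Real.sqrt α * (‖x (.inl 0)‖ * ‖x (.inl 1)‖))
      ≤ Real.sqrt α * (inner ℂ (x (.inl 0)) (x (.inl 1)) : ℂ).re := by
    rw [← mul_neg]
    exact mul_le_mul_of_nonneg_left (abs_le.1 ((Complex.abs_re_le_norm _).trans
      (norm_inner_le_norm (𝕜 := ℂ) (x (.inl 0)) (x (.inl 1))))).1 (Real.sqrt_nonneg α)
  exact coercivity_arithmetic hα hκ (Real.sq_sqrt hα.le) rfl rfl rfl (sq_nonneg _)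
    (Finset.sum_nonneg fun _ _ => sq_nonneg _) hP (mod_cast hA') hS hI

/-- A number which is the infimum of the quadratic form is the infimum of the spectrum. -/
theorem isGLB_realSpectrum_pauliFierz (hΛ : 0 < Λ) (hε : IsPolarization ε) {α : ℝ} (hα : 0 < α)
    {E : ℝ}
    (hE : ∀ (Ψ : State) (P A : Fin 3 → State) (S F : State), InFormDomain Λ ε Ψ P A S F →
      E * ‖Ψ‖ ^ 2 ≤ formValue α Ψ P A S F)
    (hE' : ∀ δ : ℝ, 0 < δ → ∃ (Ψ : State) (P A : Fin 3 → State) (S F : State),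
      InFormDomain Λ ε Ψ P A S F ∧ 0 < ‖Ψ‖ ∧ formValue α Ψ P A S F ≤ (E + δ) * ‖Ψ‖ ^ 2) :
    IsGLB (realSpectrum (pauliFierz α Λ ε)) E := by
  obtain ⟨c, C, hc, hcoer⟩ := exists_coercive hΛ hε hα
  rw [pauliFierz_eq hΛ hε]
  refine isGLB_realSpectrum_formGraph _ (C := C) hc (fun x hx => inner_spin_im hΛ hε hx) hcoer
    (fun x hx => ?_) fun δ hδ => ?_
  · rw [re_formSum]
    exact hE _ _ _ _ _ hx
  · obtain ⟨Ψ, P, A, S, F, h, h0, hle⟩ := hE' δ hδ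
    refine ⟨formVector Ψ P A S F, h, h0, ?_⟩
    rw [re_formSum]
    exact hle

/-- The infimum of the spectrum agrees with the main term up to errors of second order. -/
theorem exists_isGLB_realSpectrum (hΛ : 0 < Λ) (hε : IsPolarization ε) {α : ℝ} (hα : 0 < α) :
    ∃ E : ℝ, IsGLB (realSpectrum (pauliFierz α Λ ε)) E ∧
      mainTerm α Λ - 100 * α ^ 2 * (Λ ^ 2 + Λ ^ 3) ≤ E ∧ E ≤ mainTerm α Λ + α ^ 2 * Λ ^ 3 := by
  set Q : Set ℝ := {q | ∃ (Ψ : State) (P A : Fin 3 → State) (S F : State),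
    InFormDomain Λ ε Ψ P A S F ∧ 0 < ‖Ψ‖ ∧ formValue α Ψ P A S F = q * ‖Ψ‖ ^ 2} with hQ
  have hmem : ∀ {Ψ : State} {P A : Fin 3 → State} {S F : State}, InFormDomain Λ ε Ψ P A S F →
      0 < ‖Ψ‖ → formValue α Ψ P A S F / ‖Ψ‖ ^ 2 ∈ Q := fun h h0 =>
    ⟨_, _, _, _, _, h, h0, by field_simp⟩
  have hlow : mainTerm α Λ - 100 * α ^ 2 * (Λ ^ 2 + Λ ^ 3) ∈ lowerBounds Q := by
    rintro q ⟨Ψ, P, A, S, F, h, h0, e⟩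
    have := formValue_ge hΛ hε hα h
    rw [e] at this
    exact le_of_mul_le_mul_right this (by positivity)
  have hne : Q.Nonempty := by
    obtain ⟨Ψ, P, A, S, F, h, h0, -⟩ := exists_formValue_le hΛ hε hα one_pos
    exact ⟨_, hmem h h0⟩
  have hglb := isGLB_csInf hne ⟨_, hlow⟩
  refine ⟨sInf Q, isGLB_realSpectrum_pauliFierz hΛ hε hα (fun Ψ P A S F h => ?_) fun δ hδ => ?_,
    hglb.2 hlow, ?_⟩
  · rcases eq_or_lt_of_le (norm_nonneg Ψ) with h0 | h0
    · rw [← h0]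
      simpa using formValue_nonneg hΛ hε h
    · have := hglb.1 (hmem h h0)
      rwa [le_div_iff₀ (by positivity)] at this
  · obtain ⟨q, ⟨Ψ, P, A, S, F, h, h0, e⟩, hq⟩ := exists_lt_of_csInf_lt hne
      (lt_add_of_pos_right _ hδ)
    refine ⟨Ψ, P, A, S, F, h, h0, ?_⟩
    rw [e]
    gcongr
  · refine le_of_forall_pos_le_add fun δ hδ => ?_
    obtain ⟨Ψ, P, A, S, F, h, h0, hle⟩ := exists_formValue_le hΛ hε hα hδ
    refine (hglb.1 (hmem h h0)).trans ?_
    rwa [div_le_iff₀ (by positivity)]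

end Main

end PauliFierz

end

theorem theorem1 :
    ∃ C₁ : ℝ, 0 < C₁ ∧ ∃ C₂ : ℝ, 0 < C₂ ∧
      ∀ Λ : ℝ, 0 < Λ → ∀ α : ℝ, 0 < α →
        ∀ ε : Fin 2 → PauliFierz.R3 → PauliFierz.R3, PauliFierz.IsPolarization ε →
          ∃ E₀ : ℝ, IsGLB (PauliFierz.realSpectrum (PauliFierz.pauliFierz α Λ ε)) E₀ ∧
            |E₀ - 2 * (α / Real.pi) * (Λ - Real.log (1 + Λ))|
              ≤ C₁ * α ^ 2 * (Λ ^ 2 + Λ ^ 3)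
                + C₂ * α ^ 3 * (Λ ^ 3 + Λ ^ 4) * Real.log (1 + Λ) := by
  refine ⟨100, by norm_num, 1, one_pos, fun Λ hΛ α hα ε hε => ?_⟩
  obtain ⟨E, hE, h1, h2⟩ := PauliFierz.exists_isGLB_realSpectrum hΛ hε hα
  refine ⟨E, hE, ?_⟩
  change |E - PauliFierz.mainTerm α Λ| ≤ _
  have h3 : 0 ≤ 1 * α ^ 3 * (Λ ^ 3 + Λ ^ 4) * Real.log (1 + Λ) :=
    mul_nonneg (by positivity) (Real.log_nonneg (by linarith))
  have h4 : 0 ≤ α ^ 2 * Λ ^ 2 := by positivity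
  have h5 : 0 ≤ α ^ 2 * Λ ^ 3 := by positivity
  rw [abs_le]
  constructor <;> linarith
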